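/- Theorem 4.7. For $0<q<1$, $t\ge 0$ and $x\in\mathbb R$ let $$F(x,t;q)=\sum_{k=0}^\infty\frac{(-x)^kq^{k(k-1)/2}}{(q;q)_k}\,e^{t(1-q^{-k})},\qquad (q;q)_k=\prod_{i=1}^{k}(1-q^i).$$ Let $W_0:[-e^{-1},\infty)\to[-1,\infty)$ and $W_{-1}:[-e^{-1},0)\to(-\infty,-1]$ be the two real branches of the Lambert function (the inverse of $w\mapsto we^w$), and let $\mathrm{Li}_2(z)=-\int_0^z\frac{\log(1-v)}{v}\,dv$ for real $z<1$. For $x>1$ put $u_{-1}(x)=-W_{-1}\!\left(-\frac1{ex}\right)$, and let $$D=\big((0,1]\times(0,\infty)\big)\cup\{(x,u): x>1,\ u>u_{-1}(x)\}.$$ For $(x,u)\in D$ put $z_s=1+\frac1uW_{-1}(-xue^{-u})$ if $x=1$ and $0<u<1$, and $z_s=1+\frac1uW_0(-xue^{-u})$ otherwise. Then for every $(x,u)\in D$, as $\varepsilon\to0^+$ with $x$ and $u$ fixed, $$F\left(x,\frac u\varepsilon;e^{-\varepsilon}\right)=\frac{\exp\left\{\varepsilon^{-1}\left[\log x\log z_s+\mathrm{Li}_2(z_s)+u(1-z_s)-\frac{\pi^2}{6}\right]\right\}}{\sqrt{1+(1-u)(1-z_s)/z_s}}\,\bigl(1+O(\varepsilon)\bigr).$$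 Here the term $\log x\log z_s$ is read as $0$ when $x=1$, and at the point $(x,u)=(1,1)$, where $z_s=0$, the quantity $1+(1-u)(1-z_s)/z_s$ is read as its limit $\frac12$ as $u\to1$ along $x=1$. -/

import Mathlib

open Filter Topology Asymptotics

noncomputable section

/-- The `q`-shifted factorial `(z; q)_k = (1 - z) (1 - z q) ⋯ (1 - z q ^ (k - 1))`. -/
def qShiftedFactorial (z q : ℝ) (k : ℕ) : ℝ :=
  ∏ i ∈ Finset.range k, (1 - z * q ^ i)

/-- The series `F(x, t; q) = ∑ (-x)^k q^(k(k-1)/2) / (q; q)_k * exp (t (1 - q^(-k)))`.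
It converges absolutely for `0 < q < 1` and `0 ≤ t`. -/
def qSeries (x t q : ℝ) : ℝ :=
  ∑' k : ℕ, (-x) ^ k * q ^ (k.choose 2) / qShiftedFactorial q q k *
    Real.exp (t * (1 - (q ^ k)⁻¹))

/-- The dilogarithm `Li₂(z) = - ∫₀^z log (1 - v) / v dv`, for real `z < 1`
(where it is the principal branch; for `|z| ≤ 1` it is `∑ z^k / k^2`). -/
def dilog (z : ℝ) : ℝ :=
  - ∫ v in (0 : ℝ)..z, Real.log (1 - v) / v

/-- The real branch `W₀` of the Lambert function: for `h ≥ -1/e`, the unique `w ≥ -1` with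
`w * exp w = h`. -/
def lambertW0 (h : ℝ) : ℝ :=
  Function.invFunOn (fun w : ℝ => w * Real.exp w) (Set.Ici (-1)) h

/-- The real branch `W₋₁` of the Lambert function: for `-1/e ≤ h < 0`, the unique `w ≤ -1` with
`w * exp w = h`. -/
def lambertWm1 (h : ℝ) : ℝ :=
  Function.invFunOn (fun w : ℝ => w * Real.exp w) (Set.Iic (-1)) h

/-- `u₋₁(x) = -W₋₁(-1 / (e x))`, for `x > 1`: the larger root `u` of `x u exp (-u) = 1 / e`. -/
def uCrit (x : ℝ) : ℝ :=
  - lambertWm1 (-1 / (Real.exp 1 * x))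

/-- The saddle point `z_s`: it is `z₋₁(x, u)` if `x = 1` and `u < 1`, and `z₀(x, u)` otherwise,
where `z_k(x, u) = 1 + W_k(-x u exp (-u)) / u`. -/
def saddle (x u : ℝ) : ℝ :=
  open Classical in
  if x = 1 ∧ u < 1 then 1 + lambertWm1 (-x * u * Real.exp (-u)) / u
  else 1 + lambertW0 (-x * u * Real.exp (-u)) / u

/-- The region of admissible parameters `(x, u)`. For `x > 1` the boundary curve `u = u₋₁(x)`,
on which the radicand below vanishes, is not included. -/
def admissibleRegion : Set (ℝ × ℝ) :=
  Set.Ioc 0 1 ×ˢ Set.Ioi 0 ∪ {p : ℝ × ℝ | 1 < p.1 ∧ uCrit p.1 < p.2}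

/-- The radicand `1 + (1 - u) (1 - z_s) / z_s`. At `(x, u) = (1, 1)`, the only admissible point
with `z_s = 0`, the expression reads `0 / 0` and stands for its limit as `u → 1` along
`x = 1`, which is `1 / 2`. -/
def radicand (x u : ℝ) : ℝ :=
  open Classical in
  if x = 1 ∧ u = 1 then 1 / 2
  else 1 + (1 - u) * (1 - saddle x u) / saddle x u

/-- The exponent `log x log z_s + Li₂(z_s) + u (1 - z_s) - π² / 6`. For `x = 1` the first term
is zero, also when `z_s ≤ 0`. -/
def exponent (x u : ℝ) : ℝ :=
  Real.log x * Real.log (saddle x u) + dilog (saddle x u) + u * (1 - saddle x u) - Real.pi ^ 2 / 6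

end

/-!
The expansion comes from the saddle point method, applied to one of two contour integrals.

For `x > 0` the Cahen–Mellin integral of `exp (-t q ^ (-k))`, summed against Euler's expansion of
`(z; q)_∞`, gives the Mellin–Barnes representation `qSeries_eq_mellinBarnes`
`F = e ^ t / (2 π i) ∫ t ^ (-s) Γ(s) (x q ^ s; q)_∞ ds` over any line `Re s = a > 0`. Away from the
points with `x = 1`, `u ≤ 1` the Lambert function yields `b = 1 - z_s ∈ (0, 1)` with `u b < 1` and
`b = x exp (-u (1 - b))` (`exists_saddle_eq_one_sub`), and the line through the saddle point is
`a = u (1 - b) / ε`. For `x = 1` and `u ≤ 1` the saddle point is at `z_s ≤ 0`, out of reach of this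
representation. There Mellin inversion in the variable `exp (-t)`, based on the partial fraction
expansion of `(q; q)_∞ / (z; q)_∞`, gives the second representation `qSeries_one_eq_integral`, with
integrand `exp (t (-c + i η)) (q; q)_∞ / (c - i η; q)_∞` on a line with `c ≤ 0`; the choice `c = z_s`
passes through the saddle point.

In both cases the integrand, divided by its value at the saddle point, is a limit of finite products
of elementary factors: `1 / (1 + i τ d_j)`, from `Γ` through Euler's limit formula or from
`1 / (z; q)_∞`, and `1 - b q ^ j e ^ (-i τ)`. Logarithms of moduli and arguments of these products
are sums over `j` of functions of `ε j`, and comparing them with integrals (`antitone_sum_bounds`,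
`eventually_riemann_sum_close`) shows that they are `-κ τ² / (2 ε) + O(τ² + τ⁴ / ε)` and
`O(|τ| + |τ|³ / ε)`. Here the saddle point equation cancels the part of the argument that is linear
in `τ / ε`. The same sums give tail bounds `(1 + k τ²) ^ (-p / ε)`. In `laplace_right`, where the
numerator `(b e ^ (-i τ); q)_∞` competes with the decay of `Γ`, these rest on a comparison of the
integrals of `arctan (τ / a)` for two values of `a` (`arctanIntegral_sub_ge`). The lemma
`laplace_method` turns the two estimates into `∫ = √(2 π ε / κ) (1 + O(ε))`; odd terms drop out
because only the real part of the integrand contributes, so the relative error is `O(ε)` and not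
`O(√ε)`.

The values at the saddle point are evaluated by Stirling's formula (`log_Gamma_stirling`), by the
trapezoidal rule for `log (z; q)_∞` (`qPochInf_asymptotics`) and, for `(q; q)_∞`, by the modular
transformation of Dedekind's eta function (`norm_qPochInf_self_asymptotics`). The reflection formula
of the dilogarithm brings the exponent into the stated form.
-/

/-! ### Comparing sums with integrals -/

lemma antitone_step_bounds {F P : ℝ → ℝ} (hP : ∀ v, 0 ≤ v → HasDerivAt P (F v) v)
    (hF : AntitoneOn F (Set.Ici 0)) {v h : ℝ} (hv : 0 ≤ v) (hh : 0 < h) :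
    h * F (v + h) ≤ P (v + h) - P v ∧ P (v + h) - P v ≤ h * F v := by
  obtain ⟨ξ, hξ, he⟩ := exists_hasDerivAt_eq_slope P F (show v < v + h by linarith)
    (fun y hy => (hP y (hv.trans hy.1)).continuousAt.continuousWithinAt)
    (fun y hy => hP y (hv.trans hy.1.le))
  have he' : P (v + h) - P v = h * F ξ := by
    rw [he, add_sub_cancel_left, mul_div_cancel₀ _ hh.ne']
  have hξ0 : 0 ≤ ξ := hv.trans hξ.1.le
  rw [he']
  exact ⟨mul_le_mul_of_nonneg_left (hF hξ0 (by simp; linarith) hξ.2.le) hh.le,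
    mul_le_mul_of_nonneg_left (hF hv hξ0 hξ.1.le) hh.le⟩

/-- The Riemann sum of an antitone function lies above the increment of an antiderivative, and
exceeds it by at most one step times the total drop. -/
lemma antitone_sum_bounds {F P : ℝ → ℝ} (hP : ∀ v, 0 ≤ v → HasDerivAt P (F v) v)
    (hF : AntitoneOn F (Set.Ici 0)) {ε : ℝ} (hε : 0 < ε) (n : ℕ) :
    P (ε * n) - P 0 ≤ ε * ∑ j ∈ Finset.range n, F (ε * j) ∧
      ε * ∑ j ∈ Finset.range n, F (ε * j) ≤ P (ε * n) - P 0 + ε * (F 0 - F (ε * n)) := by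
  induction n with
  | zero => simp
  | succ n ih =>
    have h := antitone_step_bounds hP hF (v := ε * n) (by positivity) hε
    have e : ε * ((n + 1 : ℕ) : ℝ) = ε * n + ε := by push_cast; ring
    rw [Finset.sum_range_succ, e, mul_add]
    constructor <;> nlinarith [ih.1, ih.2, h.1, h.2]

lemma tendsto_const_mul_natCast_atTop {ε : ℝ} (hε : 0 < ε) :
    Tendsto (fun n : ℕ => ε * (n : ℝ)) atTop atTop :=
  Tendsto.const_mul_atTop hε tendsto_natCast_atTop_atTop

/-- The error bound is uniform in the number `n` of terms, once `n` is large: this is what makes the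
estimates for infinite products uniform in `ε`. -/
lemma eventually_riemann_sum_close {F P : ℝ → ℝ} {L : ℝ}
    (hP : ∀ v, 0 ≤ v → HasDerivAt P (F v) v) (hF : AntitoneOn F (Set.Ici 0))
    (hF0 : ∀ v, 0 ≤ v → 0 ≤ F v) (hL : Tendsto P atTop (𝓝 L)) {ε : ℝ} (hε : 0 < ε) :
    ∀ᶠ n : ℕ in atTop,
      |ε * ∑ j ∈ Finset.range n, F (ε * j) - (L - P 0)| ≤ ε * (F 0 + 1) := by
  have h1 : Tendsto (fun n : ℕ => P (ε * n)) atTop (𝓝 L) :=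
    hL.comp (tendsto_const_mul_natCast_atTop hε)
  filter_upwards [Metric.tendsto_nhds.1 h1 ε hε] with n hn
  rw [Real.dist_eq, abs_lt] at hn
  have h2 := antitone_sum_bounds hP hF hε n
  have h3 : 0 ≤ F (ε * n) := hF0 _ (by positivity)
  have h4 : 0 ≤ F 0 := hF0 _ le_rfl
  rw [abs_le]
  constructor <;> nlinarith [mul_nonneg hε.le h3, mul_nonneg hε.le h4]

lemma trapezoid_step {P f f' : ℝ → ℝ} (hP : ∀ v, 0 ≤ v → HasDerivAt P (f v) v)
    (hf : ∀ v, 0 ≤ v → HasDerivAt f (f' v) v) (hm : MonotoneOn f' (Set.Ici 0))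
    {v h : ℝ} (hv : 0 ≤ v) (hh : 0 < h) :
    |P (v + h) - P v - h * (f v + f (v + h)) / 2| ≤ h ^ 2 / 2 * (f' (v + h) - f' v) := by
  set E : ℝ → ℝ := fun s => P (v + s) - P v - s * (f v + f (v + s)) / 2 with hE
  have hd : ∀ s ∈ Set.Icc 0 h,
      HasDerivWithinAt E ((f (v + s) - f v - s * f' (v + s)) / 2) (Set.Icc 0 h) s := by
    intro s hs
    have h1 : HasDerivAt (fun s => P (v + s)) (f (v + s)) s :=
      (hP (v + s) (by linarith [hs.1])).comp_const_add v s
    have h2 : HasDerivAt (fun s => f (v + s)) (f' (v + s)) s :=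
      (hf (v + s) (by linarith [hs.1])).comp_const_add v s
    have h3 := (h1.sub_const (P v)).sub
      (((hasDerivAt_id s).mul (h2.const_add (f v))).div_const 2)
    refine HasDerivAt.hasDerivWithinAt (h3.congr_deriv ?_)
    simp only [id]
    ring
  have hb : ∀ s ∈ Set.Ico 0 h,
      ‖(f (v + s) - f v - s * f' (v + s)) / 2‖ ≤ h / 2 * (f' (v + h) - f' v) := by
    intro s hs
    have hvh : f' v ≤ f' (v + s) := hm hv (by simp; linarith [hs.1]) (by linarith [hs.1])
    have hsh : f' (v + s) ≤ f' (v + h) :=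
      hm (by simp; linarith [hs.1]) (by simp; linarith) (by linarith [hs.2])
    rcases hs.1.eq_or_lt with h0 | h0
    · rw [← h0]; simp only [add_zero, zero_mul, sub_self, zero_div, norm_zero]
      exact mul_nonneg (by linarith) (by linarith)
    · obtain ⟨ξ, hξ, he⟩ := exists_hasDerivAt_eq_slope f f' (show v < v + s by linarith)
        (fun y hy => (hf y (hv.trans hy.1)).continuousAt.continuousWithinAt)
        (fun y hy => hf y (hv.trans hy.1.le))
      have he' : f (v + s) - f v = s * f' ξ := by
        rw [he, add_sub_cancel_left, mul_div_cancel₀ _ h0.ne']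
      have hξ0 : 0 ≤ ξ := hv.trans hξ.1.le
      have a1 : f' v ≤ f' ξ := hm hv hξ0 hξ.1.le
      have a2 : f' ξ ≤ f' (v + s) := hm hξ0 (by simp; linarith) hξ.2.le
      rw [he', Real.norm_eq_abs, abs_le]
      have := hs.2.le
      constructor <;> nlinarith [mul_nonneg h0.le (sub_nonneg.2 a1),
        mul_nonneg h0.le (sub_nonneg.2 a2), mul_nonneg h0.le (sub_nonneg.2 hsh),
        mul_nonneg (sub_nonneg.2 this) (sub_nonneg.2 (hvh.trans hsh))]
  have := norm_image_sub_le_of_norm_deriv_le_segment' hd hb h (by simp [hh.le])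
  simp only [hE, Real.norm_eq_abs, add_zero, zero_mul, sub_self, zero_div, sub_zero] at this
  calc _ ≤ _ := this
    _ = _ := by ring

/-- The trapezoidal rule for a function with monotone derivative: the error is controlled by the
total increment of the derivative, so it stays `O(ε ^ 2)` over an infinite range. -/
lemma trapezoid_sum {P f f' : ℝ → ℝ} (hP : ∀ v, 0 ≤ v → HasDerivAt P (f v) v)
    (hf : ∀ v, 0 ≤ v → HasDerivAt f (f' v) v) (hm : MonotoneOn f' (Set.Ici 0))
    {ε : ℝ} (hε : 0 < ε) (n : ℕ) :
    |P (ε * n) - P 0 - ε * (∑ j ∈ Finset.range n, f (ε * j) - f 0 / 2 + f (ε * n) / 2)| ≤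
      ε ^ 2 / 2 * (f' (ε * n) - f' 0) := by
  induction n with
  | zero => simp
  | succ n ih =>
    have h := trapezoid_step hP hf hm (v := ε * n) (by positivity) hε
    have e : ε * ((n + 1 : ℕ) : ℝ) = ε * n + ε := by push_cast; ring
    rw [Finset.sum_range_succ, e]
    have := abs_add_le (P (ε * n) - P 0 -
      ε * (∑ j ∈ Finset.range n, f (ε * j) - f 0 / 2 + f (ε * n) / 2))
      (P (ε * n + ε) - P (ε * n) - ε * (f (ε * n) + f (ε * n + ε)) / 2)
    calc _ = |(P (ε * n) - P 0 -
      ε * (∑ j ∈ Finset.range n, f (ε * j) - f 0 / 2 + f (ε * n) / 2)) +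
      (P (ε * n + ε) - P (ε * n) - ε * (f (ε * n) + f (ε * n + ε)) / 2)| := by
          congr 1; ring
      _ ≤ _ := this
      _ ≤ _ := add_le_add ih h
      _ = _ := by ring

/-! ### Elementary inequalities -/

lemma abs_log_one_add_sub_self_le {y : ℝ} (hy : 0 ≤ y) : |Real.log (1 + y) - y| ≤ y ^ 2 / 2 := by
  have h1 := Real.log_le_sub_one_of_pos (show 0 < 1 + y by linarith)
  have h2 := Real.le_log_one_add_of_nonneg hy
  have h3 : y - y ^ 2 / 2 ≤ 2 * y / (y + 2) := by
    rw [le_div_iff₀ (by linarith)]; nlinarith [pow_nonneg hy 3]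
  rw [abs_le]; constructor <;> nlinarith [sq_nonneg y]

lemma arctan_sub_arctan_ge {x y : ℝ} (hx : 0 ≤ x) (hxy : x ≤ y) :
    (y - x) / (1 + y ^ 2) ≤ Real.arctan y - Real.arctan x := by
  rcases hxy.eq_or_lt with rfl | h
  · simp
  obtain ⟨ξ, hξ, he⟩ := exists_hasDerivAt_eq_slope Real.arctan (fun v => 1 / (1 + v ^ 2)) h
    Real.continuous_arctan.continuousOn (fun v _ => Real.hasDerivAt_arctan v)
  have h1 : Real.arctan y - Real.arctan x = (y - x) * (1 / (1 + ξ ^ 2)) := by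
    rw [he, mul_div_cancel₀ _ (by linarith)]
  rw [h1, div_eq_mul_one_div]
  have : ξ ^ 2 ≤ y ^ 2 := by nlinarith [hξ.1, hξ.2]
  exact mul_le_mul_of_nonneg_left (one_div_le_one_div_of_le (by positivity) (by linarith))
    (by linarith)

lemma abs_arctan_le (y : ℝ) : |Real.arctan y| ≤ |y| := by
  have := Convex.norm_image_sub_le_of_norm_hasDerivWithin_le (f := Real.arctan)
    (f' := fun v => 1 / (1 + v ^ 2)) (s := Set.univ) (C := 1) (x := 0) (y := y)
    (fun v _ => (Real.hasDerivAt_arctan v).hasDerivWithinAt)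
    (fun v _ => by
      rw [Real.norm_eq_abs, abs_of_pos (by positivity), div_le_one (by positivity)]
      nlinarith [sq_nonneg v]) convex_univ trivial trivial
  simpa using this

lemma abs_arctan_sub_self_le (y : ℝ) : |Real.arctan y - y| ≤ |y| ^ 3 := by
  wlog hy : 0 ≤ y generalizing y
  · have := this (-y) (by linarith)
    rw [Real.arctan_neg, abs_neg] at this
    rw [← abs_neg]
    convert this using 2
    ring
  have h1 := abs_arctan_le y
  have h2 := arctan_sub_arctan_ge le_rfl hy
  rw [Real.arctan_zero, sub_zero, sub_zero] at h2
  have h3 : y - y ^ 3 ≤ y / (1 + y ^ 2) := by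
    rw [le_div_iff₀ (by positivity)]; nlinarith [pow_nonneg hy 5]
  rw [abs_of_nonneg hy] at *
  rw [abs_le] at *
  constructor <;> nlinarith [pow_nonneg hy 3]

lemma abs_one_sub_cos_sub_le (x : ℝ) : |1 - Real.cos x - x ^ 2 / 2| ≤ x ^ 4 / 2 := by
  have h1 := Real.one_sub_sq_div_two_le_cos (x := x)
  by_cases hx : |x| ≤ 1
  · have h2 := abs_le.1 (Real.cos_bound hx)
    have e : |x| ^ 4 = x ^ 4 := by rw [← abs_pow, abs_of_nonneg (by positivity)]
    rw [e] at h2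
    rw [abs_le]; constructor <;> nlinarith [h2.1, h2.2, sq_nonneg (x ^ 2)]
  · have h3 : 1 ≤ x ^ 2 := by
      rw [← sq_abs]; nlinarith
    have := Real.cos_le_one x
    rw [abs_le]; constructor <;> nlinarith

lemma abs_sin_sub_self_le (x : ℝ) : |Real.sin x - x| ≤ 2 * |x| ^ 3 := by
  wlog hx : 0 ≤ x generalizing x
  · have := this (-x) (by linarith)
    rw [Real.sin_neg, abs_neg] at this
    rw [← abs_neg]
    convert this using 2
    ring
  rw [abs_of_nonneg hx]
  have h1 := Real.sin_le hx
  rcases hx.eq_or_lt with rfl | h0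
  · simp
  have := Real.sin_gt_sub_cube h0
  rw [abs_le]; constructor <;> nlinarith [pow_pos h0 3]

/-- Polar form of a complex number with positive real part. -/
lemma polar_of_re_pos {a : ℝ} (ha : 0 < a) (b : ℝ) :
    (a + b * Complex.I : ℂ) =
      Complex.exp ((Real.log (a ^ 2 + b ^ 2) / 2 : ℝ) + (Real.arctan (b / a) : ℝ) * Complex.I) := by
  have h1 : 0 < a ^ 2 + b ^ 2 := by positivity
  have hs : Real.exp (Real.log (a ^ 2 + b ^ 2) / 2) = a * √(1 + (b / a) ^ 2) := by
    rw [← Real.log_sqrt h1.le, Real.exp_log (Real.sqrt_pos.2 h1)]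
    rw [show a ^ 2 + b ^ 2 = a ^ 2 * (1 + (b / a) ^ 2) by field_simp,
      Real.sqrt_mul (by positivity), Real.sqrt_sq ha.le]
  have hp : √(1 + (b / a) ^ 2) ≠ 0 := (Real.sqrt_pos.2 (by positivity)).ne'
  rw [Complex.exp_add, ← Complex.ofReal_exp, Complex.exp_mul_I, ← Complex.ofReal_cos,
    ← Complex.ofReal_sin, Real.cos_arctan, Real.sin_arctan, hs]
  apply Complex.ext
  · simp; field_simp
  · simp; field_simp

/-- Polar form of `1 / (1 + i w)` for real `w`. -/
lemma polar_inv_one_add_mul_I (w : ℝ) :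
    ((1 + w * Complex.I : ℂ))⁻¹ =
      Complex.exp ((-(Real.log (1 + w ^ 2) / 2) : ℝ) + (-Real.arctan w : ℝ) * Complex.I) := by
  have h := polar_of_re_pos one_pos w
  simp only [Complex.ofReal_one, one_pow, div_one] at h
  rw [h, ← Complex.exp_neg]
  congr 1
  push_cast
  ring

/-! ### Laplace's method -/

/-- The bound is stated in a form that survives limits: a sequence `exp (R n + i Θ n)` with `R n`
close to `-a` and small phases `Θ n` has a limit whose real part is close to `exp (-a)`. -/
lemma abs_re_sub_exp_le_of_tendsto {Gn : ℕ → ℂ} {g : ℂ} {R Θ : ℕ → ℝ} {a E₁ E₂ : ℝ}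
    (hG : ∀ᶠ n in atTop, Gn n = Complex.exp ((R n : ℝ) + (Θ n : ℝ) * Complex.I))
    (hlim : Tendsto Gn atTop (𝓝 g))
    (hR : ∀ᶠ n in atTop, |R n + a| ≤ E₁) (hΘ : ∀ᶠ n in atTop, |Θ n| ≤ E₂) :
    |g.re - Real.exp (-a)| ≤ (E₁ + E₂ ^ 2) * (‖g‖ + Real.exp (-a)) := by
  have h1 : Tendsto (fun n => |(Gn n).re - Real.exp (-a)|) atTop (𝓝 |g.re - Real.exp (-a)|) :=
    (((Complex.continuous_re.tendsto _).comp hlim).sub_const _).abs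
  have h2 : Tendsto (fun n => (E₁ + E₂ ^ 2) * (‖Gn n‖ + Real.exp (-a))) atTop
      (𝓝 ((E₁ + E₂ ^ 2) * (‖g‖ + Real.exp (-a)))) :=
    (hlim.norm.add_const _).const_mul _
  refine le_of_tendsto_of_tendsto h1 h2 ?_
  filter_upwards [hG, hR, hΘ] with n hg hr ht
  have e1 : (Gn n).re = Real.exp (R n) * Real.cos (Θ n) := by
    rw [hg, Complex.exp_re]; simp
  have e2 : ‖Gn n‖ = Real.exp (R n) := by
    rw [hg, Complex.norm_exp]; simp
  rw [e1, e2]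
  have hc1 := Real.cos_le_one (Θ n)
  have hc2 := Real.one_sub_sq_div_two_le_cos (x := Θ n)
  have hsq : Θ n ^ 2 ≤ E₂ ^ 2 := sq_le_sq' (by linarith [(abs_le.1 ht).1]) (abs_le.1 ht).2
  have hp := Real.exp_pos (R n)
  have hq := Real.exp_pos (-a)
  have hE : 0 ≤ E₁ := (abs_nonneg _).trans hr
  have hb1 : Real.exp (R n) - Real.exp (-a) ≤ E₁ * Real.exp (R n) := by
    have := Real.add_one_le_exp (-a - R n)
    have e : Real.exp (-a) = Real.exp (R n) * Real.exp (-a - R n) := by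
      rw [← Real.exp_add]; congr 1; ring
    rw [e]
    nlinarith [(abs_le.1 hr).2]
  have hb2 : Real.exp (-a) - Real.exp (R n) ≤ E₁ * Real.exp (-a) := by
    have := Real.add_one_le_exp (R n + a)
    have e : Real.exp (R n) = Real.exp (-a) * Real.exp (R n + a) := by
      rw [← Real.exp_add]; congr 1; ring
    rw [e]
    nlinarith [(abs_le.1 hr).1]
  have hc : Real.exp (R n) * (1 - Real.cos (Θ n)) ≤ Real.exp (R n) * E₂ ^ 2 :=
    mul_le_mul_of_nonneg_left (by nlinarith [sq_nonneg (Θ n)]) hp.le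
  have hc0 : 0 ≤ Real.exp (R n) * (1 - Real.cos (Θ n)) := mul_nonneg hp.le (by linarith)
  have := mul_nonneg hE hp.le
  have := mul_nonneg hE hq.le
  have := mul_nonneg (sq_nonneg E₂) hq.le
  rw [abs_le]
  constructor <;> nlinarith

/-- A fourth power in the denominator leaves an integrable function after multiplication by the
polynomial of degree six in the error term of `laplace_method`. -/
lemma inv_one_add_pow_four_bound {a : ℝ} (ha : 0 < a) (y : ℝ) :
    (y ^ 2 + y ^ 4 + y ^ 6) * ((1 + a * y ^ 2) ^ 4)⁻¹ ≤ 3 / min 1 a ^ 4 * (1 + y ^ 2)⁻¹ := by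
  have hm : 0 < min 1 a := lt_min one_pos ha
  have h1 : min 1 a * (1 + y ^ 2) ≤ 1 + a * y ^ 2 := by
    nlinarith [min_le_left 1 a, mul_le_mul_of_nonneg_right (min_le_right 1 a) (sq_nonneg y)]
  have h2 : (min 1 a * (1 + y ^ 2)) ^ 4 ≤ (1 + a * y ^ 2) ^ 4 :=
    pow_le_pow_left₀ (by positivity) h1 4
  have h3 : y ^ 2 + y ^ 4 + y ^ 6 ≤ 3 * (1 + y ^ 2) ^ 3 := by
    nlinarith [sq_nonneg y, sq_nonneg (y ^ 2), sq_nonneg (y ^ 3)]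
  calc _ ≤ 3 * (1 + y ^ 2) ^ 3 * ((min 1 a * (1 + y ^ 2)) ^ 4)⁻¹ :=
        mul_le_mul h3 (inv_anti₀ (by positivity) h2) (by positivity) (by positivity)
    _ = _ := by field_simp

/-- A family that is uniformly close to a Gaussian of variance `ε / κ`, and has uniform power
tails, integrates to the Gaussian integral up to a relative error `O(ε)`. -/
theorem laplace_method {G : ℝ → ℝ → ℂ} {κ C D k p ε₀ : ℝ} (hκ : 0 < κ) (hC : 0 ≤ C)
    (hD : 0 ≤ D) (hk : 0 < k) (hp : 0 < p) (hε₀ : 0 < ε₀)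
    (hmeas : ∀ ε ∈ Set.Ioo 0 ε₀, MeasureTheory.AEStronglyMeasurable (G ε))
    (hH : ∀ ε ∈ Set.Ioo 0 ε₀, ∀ τ, |(G ε τ).re - Real.exp (-(κ * τ ^ 2 / (2 * ε)))| ≤
      C * (τ ^ 2 + τ ^ 4 / ε + τ ^ 6 / ε ^ 2) * (‖G ε τ‖ + Real.exp (-(κ * τ ^ 2 / (2 * ε)))))
    (hT : ∀ ε ∈ Set.Ioo 0 ε₀, ∀ τ, ‖G ε τ‖ ≤ D * (1 + k * τ ^ 2) ^ (-(p / ε))) :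
    (∀ᶠ ε in 𝓝[>] (0 : ℝ), MeasureTheory.Integrable (G ε)) ∧
      (fun ε => (∫ τ, (G ε τ).re) / √(2 * Real.pi * ε / κ) - 1) =O[𝓝[>] 0] (fun ε : ℝ => ε) := by
  set ε₁ := min ε₀ (p / 4) with hε₁
  have hε₁0 : 0 < ε₁ := lt_min hε₀ (by positivity)
  have hmem : ∀ᶠ ε in 𝓝[>] (0 : ℝ), ε ∈ Set.Ioo 0 ε₁ := Ioo_mem_nhdsGT hε₁0
  have hint : ∀ ε ∈ Set.Ioo 0 ε₁, MeasureTheory.Integrable (G ε) := by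
    intro ε hε
    have hε' : ε ∈ Set.Ioo 0 ε₀ := ⟨hε.1, hε.2.trans_le (min_le_left _ _)⟩
    have hr : 1 ≤ p / ε := by
      rw [le_div_iff₀ hε.1]; linarith [hε.2.trans_le (min_le_right ε₀ (p / 4))]
    have hb : MeasureTheory.Integrable (fun τ : ℝ => D * (1 + (√k * τ) ^ 2)⁻¹) :=
      (integrable_inv_one_add_sq.comp_mul_left' (Real.sqrt_pos.2 hk).ne').const_mul D
    refine hb.mono' (hmeas ε hε') (.of_forall fun τ => (hT ε hε' τ).trans ?_)
    refine mul_le_mul_of_nonneg_left ?_ hD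
    rw [mul_pow, Real.sq_sqrt hk.le, ← Real.rpow_neg_one]
    exact Real.rpow_le_rpow_of_exponent_le (by nlinarith [mul_nonneg hk.le (sq_nonneg τ)])
      (by linarith)
  refine ⟨hmem.mono hint, ?_⟩
  set a := p * k / 4 with ha
  have ha0 : 0 < a := by positivity
  set B := C * (D * (3 / min 1 a ^ 4) + 3 / min 1 (κ / 8) ^ 4) with hB
  have hB0 : 0 ≤ B := by
    have h1 : 0 < min 1 a := lt_min one_pos ha0
    have h2 : 0 < min 1 (κ / 8) := lt_min one_pos (by positivity)
    positivity
  -- After the rescaling `τ = √ε y` the error is `O(ε)` with an integrable factor.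
  have key : ∀ ε ∈ Set.Ioo 0 ε₁, ∀ y,
      |(G ε (√ε * y)).re - Real.exp (-(κ / 2) * y ^ 2)| ≤ ε * B * (1 + y ^ 2)⁻¹ := by
    intro ε hε y
    have hε' : ε ∈ Set.Ioo 0 ε₀ := ⟨hε.1, hε.2.trans_le (min_le_left _ _)⟩
    have hr : 1 ≤ p / (4 * ε) := by
      rw [le_div_iff₀ (by linarith [hε.1])]
      linarith [hε.2.trans_le (min_le_right ε₀ (p / 4))]
    have hε0 := hε.1
    have hsq : (√ε * y) ^ 2 = ε * y ^ 2 := by rw [mul_pow, Real.sq_sqrt hε0.le]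
    have h := hH ε hε' (√ε * y)
    have e1 : κ * (√ε * y) ^ 2 / (2 * ε) = κ / 2 * y ^ 2 := by
      rw [hsq]; field_simp
    have e2 : (√ε * y) ^ 2 + (√ε * y) ^ 4 / ε + (√ε * y) ^ 6 / ε ^ 2 =
        ε * (y ^ 2 + y ^ 4 + y ^ 6) := by
      rw [show (√ε * y) ^ 4 = ((√ε * y) ^ 2) ^ 2 by ring,
        show (√ε * y) ^ 6 = ((√ε * y) ^ 2) ^ 3 by ring, hsq]
      field_simp
    rw [e1, e2, ← neg_mul] at h
    have hG : ‖G ε (√ε * y)‖ ≤ D * ((1 + a * y ^ 2) ^ 4)⁻¹ := by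
      refine (hT ε hε' _).trans (mul_le_mul_of_nonneg_left ?_ hD)
      rw [hsq, Real.rpow_neg (by positivity)]
      refine inv_anti₀ (by positivity) ?_
      -- Bernoulli's inequality, with exponent `p / (4 ε) ≥ 1`, makes the tails uniform in `ε`.
      have hbern := one_add_mul_self_le_rpow_one_add (s := k * (ε * y ^ 2))
        (by linarith [show 0 ≤ k * (ε * y ^ 2) by positivity]) hr
      have e3 : 1 + p / (4 * ε) * (k * (ε * y ^ 2)) = 1 + a * y ^ 2 := by
        rw [ha]; field_simp
      rw [e3] at hbern
      calc _ ≤ ((1 + k * (ε * y ^ 2)) ^ (p / (4 * ε))) ^ 4 :=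
            pow_le_pow_left₀ (by positivity) hbern 4
        _ = _ := by
            rw [← Real.rpow_natCast, ← Real.rpow_mul (by positivity)]
            congr 1
            push_cast
            field_simp
    have hexp : Real.exp (-(κ / 2) * y ^ 2) ≤ ((1 + κ / 8 * y ^ 2) ^ 4)⁻¹ := by
      rw [neg_mul, Real.exp_neg]
      refine inv_anti₀ (by positivity) ?_
      have := Real.add_one_le_exp (κ / 8 * y ^ 2)
      calc _ ≤ (Real.exp (κ / 8 * y ^ 2)) ^ 4 :=
            pow_le_pow_left₀ (by positivity) (by linarith) 4
        _ = _ := by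
            rw [← Real.exp_nat_mul]; congr 1; push_cast; ring
    refine h.trans ?_
    have hy : 0 ≤ y ^ 2 + y ^ 4 + y ^ 6 := by positivity
    calc _ ≤ C * (ε * (y ^ 2 + y ^ 4 + y ^ 6)) *
          (D * ((1 + a * y ^ 2) ^ 4)⁻¹ + ((1 + κ / 8 * y ^ 2) ^ 4)⁻¹) :=
          mul_le_mul_of_nonneg_left (add_le_add hG hexp) (by positivity)
      _ = C * ε * (D * ((y ^ 2 + y ^ 4 + y ^ 6) * ((1 + a * y ^ 2) ^ 4)⁻¹) +
          (y ^ 2 + y ^ 4 + y ^ 6) * ((1 + κ / 8 * y ^ 2) ^ 4)⁻¹) := by ring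
      _ ≤ C * ε * (D * (3 / min 1 a ^ 4 * (1 + y ^ 2)⁻¹) +
          3 / min 1 (κ / 8) ^ 4 * (1 + y ^ 2)⁻¹) :=
          mul_le_mul_of_nonneg_left (add_le_add
            (mul_le_mul_of_nonneg_left (inv_one_add_pow_four_bound ha0 y) hD)
            (inv_one_add_pow_four_bound (by positivity) y)) (by positivity)
      _ = _ := by rw [hB]; ring
  set S := √(2 * Real.pi / κ) with hS
  have hS0 : 0 < S := Real.sqrt_pos.2 (by positivity)
  refine IsBigO.of_bound (B * Real.pi / S) ?_
  filter_upwards [hmem] with ε hε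
  have hε0 := hε.1
  have hsε : 0 < √ε := Real.sqrt_pos.2 hε0
  have hgauss : MeasureTheory.Integrable (fun y : ℝ => Real.exp (-(κ / 2) * y ^ 2)) :=
    integrable_exp_neg_mul_sq (by positivity)
  have hre : MeasureTheory.Integrable (fun y : ℝ => (G ε (√ε * y)).re) :=
    ((hint ε hε).re).comp_mul_left' hsε.ne'
  have e1 : ∫ τ, (G ε τ).re = √ε * ∫ y, (G ε (√ε * y)).re := by
    rw [MeasureTheory.Measure.integral_comp_mul_left (fun τ => (G ε τ).re) √ε,
      abs_of_pos (inv_pos.2 hsε), smul_eq_mul, mul_inv_cancel_left₀ hsε.ne']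
  have e2 : ∫ y : ℝ, Real.exp (-(κ / 2) * y ^ 2) = S := by
    rw [integral_gaussian, hS]
    congr 1
    field_simp
  have e3 : √(2 * Real.pi * ε / κ) = √ε * S := by
    rw [hS, ← Real.sqrt_mul hε0.le]
    congr 1
    ring
  have hdiff : |(∫ y, (G ε (√ε * y)).re) - S| ≤ ε * B * Real.pi := by
    rw [← e2, ← MeasureTheory.integral_sub hre hgauss, ← integral_univ_inv_one_add_sq,
      ← MeasureTheory.integral_const_mul]
    refine MeasureTheory.abs_integral_le_integral_abs.trans ?_
    exact MeasureTheory.integral_mono (hre.sub hgauss).norm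
      (integrable_inv_one_add_sq.const_mul _) (fun y => key ε hε y)
  rw [e1, e3, mul_div_mul_left _ _ hsε.ne', div_sub_one hS0.ne', Real.norm_eq_abs,
    Real.norm_eq_abs, abs_div, abs_of_pos hS0, abs_of_pos hε0, div_mul_eq_mul_div]
  exact div_le_div_of_nonneg_right (hdiff.trans_eq (by ring)) hS0.le

/-! ### The infinite `q`-shifted factorial and Euler's identities -/

/-- The infinite product `(z; q)_∞ = ∏ (1 - z q ^ j)`, for complex `z`. -/
noncomputable def qPochInf (z : ℂ) (q : ℝ) : ℂ := ∏' j : ℕ, (1 - z * (q : ℂ) ^ j)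

/-- The coefficient `q ^ (k (k - 1) / 2) / (q; q)_k` of Euler's expansion of `(z; q)_∞`. -/
noncomputable def eulerCoeff (q : ℝ) (k : ℕ) : ℝ := q ^ (k.choose 2) / qShiftedFactorial q q k

section
variable {q : ℝ} (hq0 : 0 < q) (hq1 : q < 1)
include hq0 hq1

lemma summable_norm_mul_pow (z : ℂ) : Summable (fun j : ℕ => ‖-(z * (q : ℂ) ^ j)‖) := by
  simp only [norm_neg, norm_mul, norm_pow, Complex.norm_real, Real.norm_eq_abs, abs_of_pos hq0]
  exact (summable_geometric_of_lt_one hq0.le hq1).mul_left _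

lemma tendsto_prod_qPochInf (z : ℂ) :
    Tendsto (fun n => ∏ j ∈ Finset.range n, (1 - z * (q : ℂ) ^ j)) atTop (𝓝 (qPochInf z q)) := by
  have := (multipliable_one_add_of_summable (summable_norm_mul_pow hq0 hq1 z)).hasProd
  simp only [← sub_eq_add_neg] at this
  exact this.tendsto_prod_nat

lemma qShiftedFactorial_pos (k : ℕ) : 0 < qShiftedFactorial q q k :=
  Finset.prod_pos fun i _ => by
    have : q * q ^ i < 1 := by
      rw [← pow_succ']; exact pow_lt_one₀ hq0.le hq1 (by simp)
    linarith

lemma eulerCoeff_pos (k : ℕ) : 0 < eulerCoeff q k :=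
  div_pos (pow_pos hq0 _) (qShiftedFactorial_pos hq0 hq1 k)

lemma eulerCoeff_succ (k : ℕ) :
    eulerCoeff q (k + 1) * (1 - q ^ (k + 1)) = eulerCoeff q k * q ^ k := by
  have h1 := (qShiftedFactorial_pos hq0 hq1 k).ne'
  have h2 := (qShiftedFactorial_pos hq0 hq1 (k + 1)).ne'
  have h3 : qShiftedFactorial q q (k + 1) = qShiftedFactorial q q k * (1 - q ^ (k + 1)) := by
    rw [qShiftedFactorial, Finset.prod_range_succ, pow_succ' q k]; rfl
  have h4 : (k + 1).choose 2 = k.choose 2 + k := by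
    rw [Nat.choose_succ_succ' k 1, Nat.choose_one_right, add_comm]
  rw [eulerCoeff, eulerCoeff, h4, pow_add]
  rw [h3] at h2 ⊢
  have h5 := right_ne_zero_of_mul h2
  field_simp

lemma summable_eulerCoeff_mul_pow {r : ℝ} (hr : 0 < r) :
    Summable (fun k => eulerCoeff q k * r ^ k) := by
  refine summable_of_ratio_test_tendsto_lt_one (l := 0) one_pos
    (.of_forall fun k => (mul_pos (eulerCoeff_pos hq0 hq1 k) (pow_pos hr k)).ne') ?_
  have hlim : Tendsto (fun k : ℕ => q ^ k * r / (1 - q ^ (k + 1))) atTop (𝓝 (0 * r / (1 - 0))) := by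
    have h := tendsto_pow_atTop_nhds_zero_of_lt_one hq0.le hq1
    exact (h.mul_const r).div (((tendsto_add_atTop_iff_nat 1).2 h).const_sub 1) (by simp)
  simp only [zero_mul, zero_div] at hlim
  refine hlim.congr fun k => ?_
  have h1 := eulerCoeff_pos hq0 hq1 k
  have h2 := eulerCoeff_pos hq0 hq1 (k + 1)
  have h3 := eulerCoeff_succ hq0 hq1 k
  have h4 : 0 < 1 - q ^ (k + 1) := sub_pos.2 (pow_lt_one₀ hq0.le hq1 (by simp))
  rw [Real.norm_of_nonneg (by positivity), Real.norm_of_nonneg (by positivity), pow_succ r,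
    div_eq_div_iff h4.ne' (by positivity)]
  linear_combination (-(r ^ k * r)) * h3

lemma summable_norm_euler (z : ℂ) : Summable (fun k => ‖(eulerCoeff q k : ℂ) * (-z) ^ k‖) := by
  refine Summable.of_nonneg_of_le (fun _ => norm_nonneg _) (fun k => ?_)
    (summable_eulerCoeff_mul_pow hq0 hq1 (r := ‖z‖ + 1) (by positivity))
  rw [norm_mul, norm_pow, norm_neg, Complex.norm_real,
    Real.norm_of_nonneg (eulerCoeff_pos hq0 hq1 k).le]
  exact mul_le_mul_of_nonneg_left (pow_le_pow_left₀ (norm_nonneg _) (by linarith) k)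
    (eulerCoeff_pos hq0 hq1 k).le

/-- Iterating the first-order `q`-difference equation that both sides of Euler's identity obey. -/
lemma prod_mul_eq_of_qDifference {f : ℂ → ℂ} {z : ℂ}
    (hf : ∀ n : ℕ, (1 - z * (q : ℂ) ^ n) * f (z * (q : ℂ) ^ n) = f (z * (q : ℂ) ^ (n + 1)))
    {L : ℂ} (hL : Tendsto (fun n : ℕ => f (z * (q : ℂ) ^ n)) atTop (𝓝 L)) :
    qPochInf z q * f z = L := by
  have h : ∀ n : ℕ, (∏ j ∈ Finset.range n, (1 - z * (q : ℂ) ^ j)) * f z = f (z * (q : ℂ) ^ n) := by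
    intro n
    induction n with
    | zero => simp
    | succ n ih => rw [Finset.prod_range_succ, mul_right_comm, ih, mul_comm, hf n]
  exact tendsto_nhds_unique (((tendsto_prod_qPochInf hq0 hq1 z).mul_const _).congr h) hL

lemma tendsto_ofReal_pow_zero (z : ℂ) :
    Tendsto (fun n : ℕ => z * (q : ℂ) ^ n) atTop (𝓝 0) := by
  have h : Tendsto (fun n : ℕ => (q : ℂ) ^ n) atTop (𝓝 0) :=
    tendsto_pow_atTop_nhds_zero_of_norm_lt_one (by simpa [abs_of_pos hq0] using hq1)
  simpa using h.const_mul z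

lemma norm_mul_ofReal_pow_le (z : ℂ) (n : ℕ) : ‖z * (q : ℂ) ^ n‖ ≤ ‖z‖ := by
  rw [norm_mul, norm_pow, Complex.norm_real, Real.norm_of_nonneg hq0.le]
  exact mul_le_of_le_one_right (norm_nonneg _) (pow_le_one₀ hq0.le hq1.le)

/-- Euler's expansion of `(z; q)_∞` in powers of `z`. -/
theorem hasSum_euler (z : ℂ) :
    HasSum (fun k => (eulerCoeff q k : ℂ) * (-z) ^ k) (qPochInf z q) := by
  set E : ℂ → ℂ := fun w => ∑' k, (eulerCoeff q k : ℂ) * (-w) ^ k with hE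
  have hs : ∀ w, Summable (fun k => (eulerCoeff q k : ℂ) * (-w) ^ k) := fun w =>
    (summable_norm_euler hq0 hq1 w).of_norm
  have hfun : ∀ w, E w = (1 - w) * E (w * q) := by
    intro w
    have h1 : E w - E (w * q) =
        ∑' k, (eulerCoeff q k : ℂ) * (1 - (q : ℂ) ^ k) * (-w) ^ k := by
      rw [hE, ← (hs w).tsum_sub (hs (w * q))]
      refine tsum_congr fun k => ?_
      rw [← neg_mul, mul_pow]; ring
    have hs' : Summable fun k => (eulerCoeff q k : ℂ) * (1 - (q : ℂ) ^ k) * (-w) ^ k := by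
      refine ((hs w).sub (hs (w * q))).congr fun k => ?_
      rw [← neg_mul, mul_pow]; ring
    have h2 : ∑' k, (eulerCoeff q k : ℂ) * (1 - (q : ℂ) ^ k) * (-w) ^ k = -w * E (w * q) := by
      rw [hs'.tsum_eq_zero_add, hE, ← tsum_mul_left]
      simp only [pow_zero, sub_self, mul_zero, zero_mul, zero_add]
      refine tsum_congr fun k => ?_
      have h3 : (eulerCoeff q (k + 1) : ℂ) * (1 - (q : ℂ) ^ (k + 1)) =
          eulerCoeff q k * (q : ℂ) ^ k := by
        exact_mod_cast eulerCoeff_succ hq0 hq1 k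
      rw [h3, ← neg_mul, mul_pow]; ring
    linear_combination h1 + h2
  have hlim : Tendsto (fun n : ℕ => E (z * (q : ℂ) ^ n)) atTop (𝓝 (E 0)) := by
    refine tendsto_tsum_of_dominated_convergence (summable_norm_euler hq0 hq1 z) (fun k => ?_)
      (.of_forall fun n k => ?_)
    · exact (((tendsto_ofReal_pow_zero hq0 hq1 z).neg).pow k).const_mul _
    · rw [norm_mul, norm_mul, norm_pow, norm_pow, norm_neg, norm_neg]
      exact mul_le_mul_of_nonneg_left
        (pow_le_pow_left₀ (norm_nonneg _) (norm_mul_ofReal_pow_le hq0 hq1 z n) k) (norm_nonneg _)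
  have h0 : E 0 = 1 := by
    have h0' : E 0 = ∑' k, (eulerCoeff q k : ℂ) * (-0) ^ k := rfl
    rw [h0', tsum_eq_single 0]
    · simp [eulerCoeff, qShiftedFactorial]
    · intro k hk
      simp [hk]
  have hit : ∀ n : ℕ, E z = (∏ j ∈ Finset.range n, (1 - z * (q : ℂ) ^ j)) * E (z * (q : ℂ) ^ n) := by
    intro n
    induction n with
    | zero => simp
    | succ n ih =>
      rw [Finset.prod_range_succ, ih, hfun (z * (q : ℂ) ^ n), pow_succ]; ring_nf
  have hz : E z = qPochInf z q := by
    have := (tendsto_prod_qPochInf hq0 hq1 z).mul hlim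
    rw [h0, mul_one] at this
    exact tendsto_nhds_unique (tendsto_const_nhds.congr hit) this
  rw [← hz]
  exact (hs z).hasSum

omit hq1 in
lemma one_le_norm_one_sub_mul_pow {z : ℂ} (hz : z.re ≤ 0) (k : ℕ) :
    1 ≤ ‖1 - z * (q : ℂ) ^ k‖ := by
  have h1 : (1 - z * (q : ℂ) ^ k).re = 1 - z.re * q ^ k := by
    rw [← Complex.ofReal_pow, Complex.sub_re, Complex.re_mul_ofReal, Complex.one_re]
  have h2 := Complex.re_le_norm (1 - z * (q : ℂ) ^ k)
  rw [h1] at h2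
  nlinarith [mul_nonneg (neg_nonneg.2 hz) (pow_pos hq0 k).le]

omit hq1 in
lemma norm_partialFraction_le {z : ℂ} (hz : z.re ≤ 0) (k : ℕ) :
    ‖(eulerCoeff q k : ℂ) * (-(q : ℂ)) ^ k / (1 - z * (q : ℂ) ^ k)‖ ≤
      ‖(eulerCoeff q k : ℂ) * (-(q : ℂ)) ^ k‖ := by
  rw [norm_div]
  exact div_le_self (norm_nonneg _) (one_le_norm_one_sub_mul_pow hq0 hz k)

/-- The partial fraction expansion of `(q; q)_∞ / (z; q)_∞`, in the closed left half-plane. -/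
theorem qPochInf_mul_tsum_partialFraction {z : ℂ} (hz : z.re ≤ 0) :
    qPochInf z q * ∑' k, (eulerCoeff q k : ℂ) * (-(q : ℂ)) ^ k / (1 - z * (q : ℂ) ^ k) =
      qPochInf q q := by
  set f : ℂ → ℂ := fun w =>
    ∑' k, (eulerCoeff q k : ℂ) * (-(q : ℂ)) ^ k / (1 - w * (q : ℂ) ^ k) with hf
  have hre : ∀ n : ℕ, (z * (q : ℂ) ^ n).re ≤ 0 := fun n => by
    rw [← Complex.ofReal_pow, Complex.re_mul_ofReal]
    exact mul_nonpos_of_nonpos_of_nonneg hz (pow_pos hq0 n).le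
  have hs : ∀ w : ℂ, w.re ≤ 0 →
      Summable fun k => (eulerCoeff q k : ℂ) * (-(q : ℂ)) ^ k / (1 - w * (q : ℂ) ^ k) :=
    fun w hw => Summable.of_norm_bounded (summable_norm_euler hq0 hq1 q)
      (norm_partialFraction_le hq0 hw)
  have hone : qPochInf 1 q = 0 := by
    refine tendsto_nhds_unique (tendsto_prod_qPochInf hq0 hq1 1)
      (tendsto_const_nhds.congr' ?_)
    filter_upwards [eventually_gt_atTop 0] with n hn
    exact (Finset.prod_eq_zero (Finset.mem_range.2 hn) (by simp)).symm
  have hq : (q : ℂ) ≠ 0 := by exact_mod_cast hq0.ne'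
  have hfun : ∀ w : ℂ, w.re ≤ 0 → (1 - w) * f w = f (w * q) := by
    intro w hw
    have hne : ∀ k : ℕ, 1 - w * (q : ℂ) ^ k ≠ 0 := fun k h => by
      have := one_le_norm_one_sub_mul_pow hq0 hw k
      rw [h, norm_zero] at this; linarith
    have h0 := hasSum_euler hq0 hq1 1
    rw [hone] at h0
    -- `1 - w = (1 - q⁻ᵏ) + q⁻ᵏ (1 - w qᵏ)`: the second part sums to `(1; q)_∞ = 0`.
    have h1 : (1 - w) * f w = ∑' k, (((1 - w) *
        ((eulerCoeff q k : ℂ) * (-(q : ℂ)) ^ k / (1 - w * (q : ℂ) ^ k))) -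
          (eulerCoeff q k : ℂ) * (-1) ^ k) := by
      rw [((hs w hw).mul_left (1 - w)).tsum_sub h0.summable, h0.tsum_eq, sub_zero, tsum_mul_left]
    have hs2 := ((hs w hw).mul_left (1 - w)).sub h0.summable
    rw [h1, hs2.tsum_eq_zero_add]
    have e0 : (1 - w) * ((eulerCoeff q 0 : ℂ) * (-(q : ℂ)) ^ 0 / (1 - w * (q : ℂ) ^ 0)) -
          (eulerCoeff q 0 : ℂ) * (-1) ^ 0 = 0 := by
      have := hne 0
      simp only [pow_zero, mul_one] at this ⊢
      field_simp
      ring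
    rw [e0, zero_add]
    refine tsum_congr fun k => ?_
    have h3 : (eulerCoeff q (k + 1) : ℂ) * (1 - (q : ℂ) ^ (k + 1)) =
        eulerCoeff q k * (q : ℂ) ^ k := by
      exact_mod_cast eulerCoeff_succ hq0 hq1 k
    have hk := hne (k + 1)
    have e4 : w * (q : ℂ) * (q : ℂ) ^ k = w * (q : ℂ) ^ (k + 1) := by rw [pow_succ]; ring
    rw [e4, mul_div_assoc', ← sub_eq_zero]
    have e5 : ((1 - w) * ((eulerCoeff q (k + 1) : ℂ) * (-(q : ℂ)) ^ (k + 1)) /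
        (1 - w * (q : ℂ) ^ (k + 1)) - (eulerCoeff q (k + 1) : ℂ) * (-1) ^ (k + 1)) -
        (eulerCoeff q k : ℂ) * (-(q : ℂ)) ^ k / (1 - w * (q : ℂ) ^ (k + 1)) =
        (-1) ^ k * ((eulerCoeff q (k + 1) : ℂ) * (1 - (q : ℂ) ^ (k + 1)) -
        eulerCoeff q k * (q : ℂ) ^ k) / (1 - w * (q : ℂ) ^ (k + 1)) := by
      rw [neg_pow (q : ℂ) (k + 1), neg_pow (q : ℂ) k, pow_succ (-1 : ℂ)]
      field_simp
      ring
    rw [e5, h3, sub_self, mul_zero, zero_div]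
  refine prod_mul_eq_of_qDifference hq0 hq1 (f := f) (fun n => ?_) ?_
  · rw [hfun _ (hre n), pow_succ, mul_assoc]
  · have h0 := (hasSum_euler hq0 hq1 q).tsum_eq
    rw [← h0]
    refine tendsto_tsum_of_dominated_convergence (summable_norm_euler hq0 hq1 q) (fun k => ?_)
      (.of_forall fun n k => norm_partialFraction_le hq0 (hre n) k)
    have h1 : Tendsto (fun n : ℕ => 1 - z * (q : ℂ) ^ n * (q : ℂ) ^ k) atTop
        (𝓝 (1 - 0 * (q : ℂ) ^ k)) :=
      ((tendsto_ofReal_pow_zero hq0 hq1 z).mul_const _).const_sub 1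
    have h2 := (tendsto_const_nhds (x := (eulerCoeff q k : ℂ) * (-(q : ℂ)) ^ k)).div h1 (by simp)
    simpa [Pi.div_def] using h2

end

/-! ### Integral representations of the series -/

lemma measurable_qPochInf {q : ℝ} (hq0 : 0 < q) (hq1 : q < 1) :
    Measurable (fun z : ℂ => qPochInf z q) := by
  refine measurable_of_tendsto_metrizable
    (f := fun n z => ∏ j ∈ Finset.range n, (1 - z * (q : ℂ) ^ j)) (fun n => ?_)
    (tendsto_pi_nhds.2 fun z => tendsto_prod_qPochInf hq0 hq1 z)
  exact (continuous_finsetProd _ fun j _ => by fun_prop).measurable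

lemma qSeries_eq_tsum_eulerCoeff (x t q : ℝ) :
    qSeries x t q = Real.exp t * ∑' k : ℕ, eulerCoeff q k * (-x) ^ k *
      Real.exp (-(t * (q ^ k)⁻¹)) := by
  rw [qSeries, ← tsum_mul_left]
  refine tsum_congr fun k => ?_
  rw [eulerCoeff, mul_sub, mul_one, sub_eq_add_neg, Real.exp_add]
  ring

lemma norm_Gamma_le_Gamma_re {s : ℂ} (hs : 0 < s.re) : ‖Complex.Gamma s‖ ≤ Real.Gamma s.re := by
  rw [Complex.Gamma_eq_integral hs, Complex.GammaIntegral, Real.Gamma_eq_integral hs]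
  refine (MeasureTheory.norm_integral_le_integral_norm _).trans_eq ?_
  refine MeasureTheory.setIntegral_congr_fun measurableSet_Ioi fun x hx => ?_
  have hx' : 0 < x := hx
  simp only [norm_mul, Complex.norm_real, Real.norm_eq_abs, Real.abs_exp,
    Complex.norm_cpow_eq_rpow_re_of_pos hx', Complex.sub_re, Complex.one_re]

lemma continuous_Gamma_vertical {a : ℝ} (ha : 0 < a) :
    Continuous (fun η : ℝ => Complex.Gamma (a + η * Complex.I)) := by
  refine continuous_iff_continuousAt.2 fun η => ?_
  have h : DifferentiableAt ℂ Complex.Gamma (a + η * Complex.I) :=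
    Complex.differentiableAt_Gamma _ fun m h => by
      have := congrArg Complex.re h
      simp at this
      linarith [Nat.cast_nonneg (α := ℝ) m]
  exact ContinuousAt.comp (g := Complex.Gamma) (f := fun η : ℝ => (a + η * Complex.I : ℂ))
    h.continuousAt (by fun_prop)

/-- Two steps of the functional equation give quadratic decay, since `Γ` is bounded on vertical
lines. -/
lemma integrable_Gamma_vertical {a : ℝ} (ha : 0 < a) :
    MeasureTheory.Integrable (fun η : ℝ => Complex.Gamma (a + η * Complex.I)) := by
  have hb : MeasureTheory.Integrable
      (fun η : ℝ => Real.Gamma (a + 2) * ((min 1 a ^ 2)⁻¹ * (1 + η ^ 2)⁻¹)) :=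
    (integrable_inv_one_add_sq.const_mul _).const_mul _
  refine hb.mono' (continuous_Gamma_vertical ha).aestronglyMeasurable (.of_forall fun η => ?_)
  set s : ℂ := a + η * Complex.I with hs
  have hre : s.re = a := by simp [hs]
  have him : s.im = η := by simp [hs]
  have hs0 : s ≠ 0 := fun h => by rw [h] at hre; simp at hre; linarith
  have hs1 : s + 1 ≠ 0 := fun h => by
    have := congrArg Complex.re h
    simp [hre] at this; linarith
  have h1 : Complex.Gamma (s + 2) = (s + 1) * (s * Complex.Gamma s) := by
    rw [← Complex.Gamma_add_one s hs0, ← Complex.Gamma_add_one _ hs1]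
    congr 1; ring
  have h2 : ‖Complex.Gamma (s + 2)‖ ≤ Real.Gamma (a + 2) := by
    have := norm_Gamma_le_Gamma_re (s := s + 2) (by simp [hre]; linarith)
    simpa [hre] using this
  rw [h1, norm_mul, norm_mul, ← mul_assoc] at h2
  have hm : 0 < min 1 a := lt_min one_pos ha
  have hn0 : min 1 a ^ 2 * (1 + η ^ 2) ≤ ‖s‖ ^ 2 := by
    rw [← Complex.normSq_eq_norm_sq, Complex.normSq_apply, hre, him]
    nlinarith [min_le_left 1 a, min_le_right 1 a, sq_nonneg η,
      mul_le_mul (min_le_right 1 a) (min_le_right 1 a) hm.le ha.le,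
      mul_le_mul (min_le_left 1 a) (min_le_left 1 a) hm.le one_pos.le]
  have hn1 : ‖s‖ ≤ ‖s + 1‖ := by
    refine (sq_le_sq₀ (norm_nonneg _) (norm_nonneg _)).1 ?_
    rw [← Complex.normSq_eq_norm_sq, ← Complex.normSq_eq_norm_sq, Complex.normSq_apply,
      Complex.normSq_apply]
    simp [hre, him]; nlinarith
  have hn2 : min 1 a ^ 2 * (1 + η ^ 2) ≤ ‖s + 1‖ * ‖s‖ := by
    nlinarith [norm_nonneg s]
  rw [← mul_inv, ← div_eq_mul_inv, le_div_iff₀ (by positivity), mul_comm]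
  exact (mul_le_mul_of_nonneg_right hn2 (norm_nonneg _)).trans h2

/-- The Cahen--Mellin integral for `exp (-y)`. -/
lemma exp_neg_eq_integral_Gamma {a y : ℝ} (ha : 0 < a) (hy : 0 < y) :
    (Real.exp (-y) : ℂ) = (1 / (2 * Real.pi) : ℝ) *
      ∫ η : ℝ, (y : ℂ) ^ (-(a + η * Complex.I)) * Complex.Gamma (a + η * Complex.I) := by
  have hm : ∀ s : ℂ, 0 < s.re →
      mellin (fun x : ℝ => (Real.exp (-x) : ℂ)) s = Complex.Gamma s := fun s hs => by
    rw [← Complex.GammaIntegral_eq_mellin, Complex.Gamma_eq_integral hs]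
  have hline : ∀ η : ℝ, mellin (fun x : ℝ => (Real.exp (-x) : ℂ)) (a + η * Complex.I) =
      Complex.Gamma (a + η * Complex.I) := fun η => hm _ (by simpa using ha)
  have hconv : MellinConvergent (fun x : ℝ => (Real.exp (-x) : ℂ)) (a : ℂ) := by
    have := Complex.GammaIntegral_convergent (s := a) (by simpa using ha)
    simpa [MellinConvergent, mul_comm] using this
  have := mellinInv_mellin_eq a (fun x : ℝ => (Real.exp (-x) : ℂ)) hy hconv
    (by
      simp only [Complex.VerticalIntegrable, hline]
      exact integrable_Gamma_vertical ha) (by fun_prop)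
  rw [mellinInv] at this
  simp only [hline, smul_eq_mul, Complex.real_smul] at this
  exact this.symm

/-- The Mellin--Barnes representation: summing the Cahen--Mellin integrals of
`exp (-t q ^ (-k))` against Euler's coefficients produces the entire function `(x q ^ s; q)_∞`. -/
theorem qSeries_eq_mellinBarnes {x t ε a : ℝ} (hx : 0 < x) (ht : 0 < t) (hε : 0 < ε) (ha : 0 < a) :
    (qSeries x t (Real.exp (-ε)) : ℂ) = Real.exp t * ((1 / (2 * Real.pi) : ℝ) *
      ∫ η : ℝ, (t : ℂ) ^ (-(a + η * Complex.I)) * Complex.Gamma (a + η * Complex.I) *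
        qPochInf (x * Complex.exp (-ε * (a + η * Complex.I))) (Real.exp (-ε))) := by
  set q := Real.exp (-ε) with hq
  have hq0 : 0 < q := Real.exp_pos _
  have hq1 : q < 1 := by rw [hq, Real.exp_lt_one_iff]; linarith
  have htc : (t : ℂ) ≠ 0 := by exact_mod_cast ht.ne'
  set F : ℕ → ℝ → ℂ := fun k η => (eulerCoeff q k : ℂ) *
    (-(x * Complex.exp (-ε * (a + η * Complex.I)))) ^ k *
    ((t : ℂ) ^ (-(a + η * Complex.I)) * Complex.Gamma (a + η * Complex.I)) with hF
  have hmeas0 : Continuous (fun η : ℝ =>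
      (t : ℂ) ^ (-(a + η * Complex.I)) * Complex.Gamma (a + η * Complex.I)) := by
    refine Continuous.mul ?_ (continuous_Gamma_vertical ha)
    exact Continuous.const_cpow (by fun_prop) (Or.inl htc)
  have hnorm : ∀ k η, ‖F k η‖ = eulerCoeff q k * (x * Real.exp (-ε * a)) ^ k *
      (t ^ (-a) * ‖Complex.Gamma (a + η * Complex.I)‖) := by
    intro k η
    simp only [hF, norm_mul, norm_pow, norm_neg, Complex.norm_real, Complex.norm_exp,
      Complex.norm_cpow_eq_rpow_re_of_pos ht]
    rw [Real.norm_of_nonneg (eulerCoeff_pos hq0 hq1 k).le, Real.norm_of_nonneg hx.le]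
    simp
  have hFint : ∀ k, MeasureTheory.Integrable (F k) := by
    intro k
    have hc : Continuous (F k) := by
      refine Continuous.mul ?_ hmeas0
      fun_prop
    refine MeasureTheory.Integrable.mono' (((integrable_Gamma_vertical ha).norm.const_mul _).const_mul
      (eulerCoeff q k * (x * Real.exp (-ε * a)) ^ k)) hc.aestronglyMeasurable
      (.of_forall fun η => (hnorm k η).le)
  have hsum : Summable fun k => ∫ η, ‖F k η‖ := by
    simp only [hnorm, MeasureTheory.integral_const_mul]
    exact (summable_eulerCoeff_mul_pow hq0 hq1 (by positivity)).mul_right _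
  have h1 := MeasureTheory.hasSum_integral_of_summable_integral_norm hFint hsum
  have h2 : ∀ η : ℝ, ∑' k, F k η = (t : ℂ) ^ (-(a + η * Complex.I)) *
      Complex.Gamma (a + η * Complex.I) *
        qPochInf (x * Complex.exp (-ε * (a + η * Complex.I))) q := by
    intro η
    rw [mul_comm]
    exact ((hasSum_euler hq0 hq1 _).mul_right _).tsum_eq
  simp only [h2] at h1
  have h3 : ∀ k, (1 / (2 * Real.pi) : ℝ) * ∫ η, F k η =
      ((eulerCoeff q k * (-x) ^ k * Real.exp (-(t * (q ^ k)⁻¹)) : ℝ) : ℂ) := by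
    intro k
    have hy : 0 < t * (q ^ k)⁻¹ := by positivity
    have e := exp_neg_eq_integral_Gamma ha hy
    have e2 : ∀ η : ℝ, F k η = ((eulerCoeff q k * (-x) ^ k : ℝ) : ℂ) *
        (((t * (q ^ k)⁻¹ : ℝ) : ℂ) ^ (-(a + η * Complex.I)) *
          Complex.Gamma (a + η * Complex.I)) := by
      intro η
      have hpow : ((t * (q ^ k)⁻¹ : ℝ) : ℂ) ^ (-(a + η * Complex.I)) =
          (t : ℂ) ^ (-(a + η * Complex.I)) * Complex.exp (-ε * (a + η * Complex.I)) ^ k := by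
        rw [Complex.ofReal_mul, Complex.mul_cpow_ofReal_nonneg ht.le (by positivity)]
        congr 1
        rw [Complex.cpow_def_of_ne_zero (by exact_mod_cast (inv_pos.2 (pow_pos hq0 k)).ne'),
          ← Complex.ofReal_log (by positivity), Real.log_inv, Real.log_pow, hq, Real.log_exp,
          ← Complex.exp_nat_mul]
        congr 1
        push_cast
        ring
      simp only [hF]
      rw [hpow, ← neg_mul, mul_pow]
      push_cast
      ring
    simp only [e2, MeasureTheory.integral_const_mul]
    rw [mul_left_comm, ← e]
    push_cast
    ring
  have h4 := (h1.mul_left ((1 / (2 * Real.pi) : ℝ) : ℂ))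
  simp only [h3] at h4
  rw [qSeries_eq_tsum_eulerCoeff, Complex.ofReal_mul, Complex.ofReal_tsum, h4.tsum_eq]

lemma norm_one_sub_mul_pow_ge {q : ℝ} (hq0 : 0 < q) {z : ℂ} (hz : z.re ≤ 0) (k : ℕ) :
    √(1 + (z.im * q ^ k) ^ 2) ≤ ‖1 - z * (q : ℂ) ^ k‖ := by
  refine Real.sqrt_le_iff.2 ⟨norm_nonneg _, ?_⟩
  rw [← Complex.normSq_eq_norm_sq, Complex.normSq_apply, ← Complex.ofReal_pow, Complex.sub_re,
    Complex.sub_im, Complex.re_mul_ofReal, Complex.im_mul_ofReal, Complex.one_re, Complex.one_im]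
  have := mul_nonneg (neg_nonneg.2 hz) (pow_pos hq0 k).le
  nlinarith

/-- The first two factors of the product give quadratic growth in the imaginary direction. -/
lemma one_add_sq_le_norm_qPochInf {q : ℝ} (hq0 : 0 < q) (hq1 : q < 1) {z : ℂ} (hz : z.re ≤ 0) :
    1 + (q * z.im) ^ 2 ≤ ‖qPochInf z q‖ := by
  refine ge_of_tendsto (tendsto_prod_qPochInf hq0 hq1 z).norm ?_
  filter_upwards [eventually_ge_atTop 2] with n hn
  rw [norm_prod]
  have h2 : 1 + (q * z.im) ^ 2 ≤ ∏ j ∈ Finset.range 2, ‖1 - z * (q : ℂ) ^ j‖ := by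
    rw [Finset.prod_range_succ, Finset.prod_range_one]
    have h0 := norm_one_sub_mul_pow_ge hq0 hz 0
    have h1 := norm_one_sub_mul_pow_ge hq0 hz 1
    have h3 : √(1 + (q * z.im) ^ 2) ≤ √(1 + (z.im * q ^ 0) ^ 2) := by
      refine Real.sqrt_le_sqrt ?_
      rw [pow_zero, mul_one, mul_pow]
      nlinarith [sq_nonneg z.im, pow_le_one₀ hq0.le hq1.le (n := 2)]
    rw [pow_one, mul_comm z.im] at h1
    calc _ = √(1 + (q * z.im) ^ 2) * √(1 + (q * z.im) ^ 2) :=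
          (Real.mul_self_sqrt (by positivity)).symm
      _ ≤ _ := mul_le_mul (h3.trans h0) (by simpa using h1) (Real.sqrt_nonneg _) (norm_nonneg _)
  refine h2.trans ?_
  rw [← Finset.prod_range_mul_prod_Ico _ hn]
  exact le_mul_of_one_le_right (Finset.prod_nonneg fun _ _ => norm_nonneg _)
    (by
      rw [← Finset.prod_const_one (s := Finset.Ico 2 n)]
      exact Finset.prod_le_prod (fun _ _ => zero_le_one)
        fun j _ => one_le_norm_one_sub_mul_pow hq0 hz j)

lemma qPochInf_ne_zero_of_re_nonpos {q : ℝ} (hq0 : 0 < q) (hq1 : q < 1) {z : ℂ} (hz : z.re ≤ 0) :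
    qPochInf z q ≠ 0 := by
  have := one_add_sq_le_norm_qPochInf hq0 hq1 hz
  exact norm_pos_iff.1 (by nlinarith [sq_nonneg (q * z.im)])

/-- For `x = 1`, Mellin inversion on a line in the left half-plane: as a function of
`T = exp (-t)`, extended by zero to `T > 1`, the series has Mellin transform
`(q; q)_∞ / (-s; q)_∞`. -/
theorem qSeries_one_eq_integral {t ε c : ℝ} (ht : 0 < t) (hε : 0 < ε) (hc : c ≤ 0) :
    (qSeries 1 t (Real.exp (-ε)) : ℂ) = Real.exp t * ((1 / (2 * Real.pi) : ℝ) *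
      ∫ η : ℝ, Complex.exp (t * (-c + η * Complex.I)) *
        (qPochInf (Real.exp (-ε) : ℝ) (Real.exp (-ε)) /
          qPochInf (c - η * Complex.I) (Real.exp (-ε)))) := by
  set q := Real.exp (-ε) with hq
  have hq0 : 0 < q := Real.exp_pos _
  have hq1 : q < 1 := by rw [hq, Real.exp_lt_one_iff]; linarith
  have hinv : ∀ k : ℕ, 1 ≤ (q ^ k)⁻¹ := fun k =>
    (one_le_inv₀ (pow_pos hq0 k)).2 (pow_le_one₀ hq0.le hq1.le)
  have hsummable : Summable (eulerCoeff q) := by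
    simpa using summable_eulerCoeff_mul_pow hq0 hq1 one_pos
  set h : ℝ → ℂ := fun T => ∑' k, ((eulerCoeff q k * (-1) ^ k : ℝ) : ℂ) *
    (T : ℂ) ^ (((q ^ k)⁻¹ : ℝ) : ℂ) with hh
  set f : ℝ → ℂ := (Set.Ioc 0 1).indicator h with hf
  have hterm : ∀ k, ∀ T ∈ Set.Ioc (0 : ℝ) 1, ‖((eulerCoeff q k * (-1) ^ k : ℝ) : ℂ) *
      (T : ℂ) ^ (((q ^ k)⁻¹ : ℝ) : ℂ)‖ ≤ eulerCoeff q k * T := by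
    intro k T hT
    rw [norm_mul, Complex.norm_real, norm_mul, norm_pow, norm_neg, norm_one, one_pow, mul_one,
      Real.norm_of_nonneg (eulerCoeff_pos hq0 hq1 k).le,
      Complex.norm_cpow_eq_rpow_re_of_pos hT.1, Complex.ofReal_re]
    refine mul_le_mul_of_nonneg_left ?_ (eulerCoeff_pos hq0 hq1 k).le
    calc _ ≤ T ^ (1 : ℝ) := Real.rpow_le_rpow_of_exponent_ge hT.1 hT.2 (hinv k)
      _ = T := Real.rpow_one T
  have hterm1 : ∀ k, ∀ T ∈ Set.Ioc (0 : ℝ) 1, ‖((eulerCoeff q k * (-1) ^ k : ℝ) : ℂ) *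
      (T : ℂ) ^ (((q ^ k)⁻¹ : ℝ) : ℂ)‖ ≤ eulerCoeff q k := fun k T hT =>
    (hterm k T hT).trans (mul_le_of_le_one_right (eulerCoeff_pos hq0 hq1 k).le hT.2)
  have hcont : ContinuousOn h (Set.Ioc 0 1) := by
    refine continuousOn_tsum (fun k => ?_) hsummable hterm1
    intro T hT
    refine ContinuousAt.continuousWithinAt (ContinuousAt.mul continuousAt_const ?_)
    exact ContinuousAt.cpow (by fun_prop) continuousAt_const (Or.inl (by simpa using hT.1))
  have hmellin : ∀ s : ℂ, 0 ≤ s.re →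
      HasMellin f s (qPochInf (q : ℝ) q / qPochInf (-s) q) := by
    intro s hs
    have hcpow : ContinuousOn (fun T : ℝ => (T : ℂ) ^ (s - 1)) (Set.Ioc 0 1) := by
      intro T hT
      exact (ContinuousAt.cpow (by fun_prop) continuousAt_const
        (Or.inl (by simpa using hT.1))).continuousWithinAt
    have hbd : ∀ T ∈ Set.Ioc (0 : ℝ) 1, ‖(T : ℂ) ^ (s - 1)‖ * T ≤ 1 := by
      intro T hT
      rw [Complex.norm_cpow_eq_rpow_re_of_pos hT.1]
      nth_rewrite 2 [← Real.rpow_one T]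
      rw [← Real.rpow_add hT.1]
      exact Real.rpow_le_one hT.1.le hT.2 (by simpa using hs)
    set Φ : ℕ → ℝ → ℂ := fun k => (Set.Ioc (0 : ℝ) 1).indicator fun T => (T : ℂ) ^ (s - 1) *
      (((eulerCoeff q k * (-1) ^ k : ℝ) : ℂ) * (T : ℂ) ^ (((q ^ k)⁻¹ : ℝ) : ℂ)) with hΦ
    have hfΦ : ∀ T : ℝ, (T : ℂ) ^ (s - 1) • f T = (Set.Ioc (0 : ℝ) 1).indicator
        (fun T => (T : ℂ) ^ (s - 1) * h T) T := by
      intro T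
      by_cases hT : T ∈ Set.Ioc (0 : ℝ) 1 <;> simp [hf, hT]
    have hbound : ∀ k T, ‖Φ k T‖ ≤ (Set.Ioc (0 : ℝ) 1).indicator (fun _ => eulerCoeff q k) T := by
      intro k T
      by_cases hT : T ∈ Set.Ioc (0 : ℝ) 1
      · simp only [hΦ, Set.indicator_of_mem hT]
        rw [norm_mul]
        calc _ ≤ ‖(T : ℂ) ^ (s - 1)‖ * (eulerCoeff q k * T) :=
              mul_le_mul_of_nonneg_left (hterm k T hT) (norm_nonneg _)
          _ = eulerCoeff q k * (‖(T : ℂ) ^ (s - 1)‖ * T) := by ring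
          _ ≤ _ := mul_le_of_le_one_right (eulerCoeff_pos hq0 hq1 k).le (hbd T hT)
      · simp [hΦ, hT]
    have hΦmeas : ∀ k, MeasureTheory.AEStronglyMeasurable (Φ k)
        (MeasureTheory.volume.restrict (Set.Ioi 0)) := by
      intro k
      refine MeasureTheory.AEStronglyMeasurable.restrict ?_
      rw [hΦ, aestronglyMeasurable_indicator_iff measurableSet_Ioc]
      refine ContinuousOn.aestronglyMeasurable (hcpow.mul (continuousOn_const.mul ?_))
        measurableSet_Ioc
      intro T hT
      exact (ContinuousAt.cpow (by fun_prop) continuousAt_const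
        (Or.inl (by simpa using hT.1))).continuousWithinAt
    have hlim : ∀ T : ℝ, HasSum (fun k => Φ k T) ((T : ℂ) ^ (s - 1) • f T) := by
      intro T
      rw [hfΦ]
      by_cases hT : T ∈ Set.Ioc (0 : ℝ) 1
      · simp only [hΦ, Set.indicator_of_mem hT]
        exact (Summable.of_norm_bounded hsummable (fun k => hterm1 k T hT)).hasSum.mul_left _
      · simp [hΦ, hT, hasSum_zero]
    have hind : ∀ C : ℝ, MeasureTheory.Integrable ((Set.Ioc (0 : ℝ) 1).indicator fun _ => C)
        (MeasureTheory.volume.restrict (Set.Ioi 0)) := by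
      intro C
      refine MeasureTheory.Integrable.restrict ?_
      rw [MeasureTheory.integrable_indicator_iff measurableSet_Ioc]
      exact MeasureTheory.integrableOn_const (by simp)
    have hsumind : ∀ T, ∑' k, (Set.Ioc (0 : ℝ) 1).indicator (fun _ => eulerCoeff q k) T =
        (Set.Ioc (0 : ℝ) 1).indicator (fun _ => ∑' k, eulerCoeff q k) T := by
      intro T
      by_cases hT : T ∈ Set.Ioc (0 : ℝ) 1 <;> simp [hT]
    have hS := MeasureTheory.hasSum_integral_of_dominated_convergence
      (μ := MeasureTheory.volume.restrict (Set.Ioi (0 : ℝ))) (F := Φ)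
      (f := fun T => (T : ℂ) ^ (s - 1) • f T)
      (fun k T => (Set.Ioc (0 : ℝ) 1).indicator (fun _ => eulerCoeff q k) T) hΦmeas
      (fun k => .of_forall (hbound k))
      (.of_forall fun T => by
        by_cases hT : T ∈ Set.Ioc (0 : ℝ) 1
        · simpa [hT] using hsummable
        · simp [hT, summable_zero])
      (by simp only [hsumind]; exact hind _) (.of_forall hlim)
    have hΦint : ∀ k, ∫ T in Set.Ioi (0 : ℝ), Φ k T =
        (eulerCoeff q k : ℂ) * (-(q : ℂ)) ^ k / (1 - (-s) * (q : ℂ) ^ k) := by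
      intro k
      have hm := (hasMellin_cpow_Ioc (((q ^ k)⁻¹ : ℝ) : ℂ) (s := s)
        (by rw [Complex.ofReal_re]; linarith [hinv k])).2
      rw [mellin] at hm
      have e : ∀ T, Φ k T = ((eulerCoeff q k * (-1) ^ k : ℝ) : ℂ) * ((T : ℂ) ^ (s - 1) •
          (Set.Ioc (0 : ℝ) 1).indicator (fun T : ℝ => (T : ℂ) ^ (((q ^ k)⁻¹ : ℝ) : ℂ)) T) := by
        intro T
        by_cases hT : T ∈ Set.Ioc (0 : ℝ) 1
        · simp only [hΦ, Set.indicator_of_mem hT, smul_eq_mul]; ring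
        · simp [hΦ, hT]
      simp only [e, MeasureTheory.integral_const_mul]
      rw [hm]
      have hqk : (q : ℂ) ^ k ≠ 0 := pow_ne_zero _ (by exact_mod_cast hq0.ne')
      have hne : s + ((q : ℂ) ^ k)⁻¹ ≠ 0 := by
        intro h0
        have := congrArg Complex.re h0
        rw [← Complex.ofReal_pow, ← Complex.ofReal_inv, Complex.add_re, Complex.ofReal_re,
          Complex.zero_re] at this
        linarith [hinv k]
      have hne2 : 1 - (-s) * (q : ℂ) ^ k ≠ 0 := by
        intro h0
        apply hne
        field_simp
        linear_combination h0
      push_cast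
      rw [neg_pow (q : ℂ) k]
      rw [mul_one_div, div_eq_div_iff hne hne2]
      field_simp
      ring
    simp only [hΦint] at hS
    have hP := qPochInf_mul_tsum_partialFraction hq0 hq1 (z := -s) (by simpa using hs)
    refine ⟨?_, ?_⟩
    · rw [MellinConvergent]
      refine MeasureTheory.Integrable.mono' (hind (∑' k, eulerCoeff q k)) ?_ ?_
      · refine MeasureTheory.AEStronglyMeasurable.restrict ?_
        rw [funext hfΦ, aestronglyMeasurable_indicator_iff measurableSet_Ioc]
        exact (hcpow.mul hcont).aestronglyMeasurable measurableSet_Ioc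
      · refine .of_forall fun T => ?_
        rw [← (hlim T).tsum_eq, ← hsumind T]
        refine tsum_of_norm_bounded (Summable.hasSum ?_) (fun k => hbound k T)
        by_cases hT : T ∈ Set.Ioc (0 : ℝ) 1
        · simpa [hT] using hsummable
        · simp [hT, summable_zero]
    · rw [mellin, ← hS.tsum_eq, eq_div_iff (qPochInf_ne_zero_of_re_nonpos hq0 hq1 (by simpa using hs)),
        mul_comm]
      exact hP
  have hline : ∀ η : ℝ, mellin f (((-c : ℝ) : ℂ) + η * Complex.I) =
      qPochInf (q : ℝ) q / qPochInf (c - η * Complex.I) q := by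
    intro η
    rw [(hmellin _ (by simpa using hc)).2]
    congr 2
    push_cast; ring
  have hvert : Complex.VerticalIntegrable (mellin f) (-c) := by
    simp only [Complex.VerticalIntegrable, hline]
    have hb : MeasureTheory.Integrable (fun η : ℝ => ‖qPochInf (q : ℝ) q‖ * (1 + (q * η) ^ 2)⁻¹) :=
      (integrable_inv_one_add_sq.comp_mul_left' hq0.ne').const_mul _
    refine hb.mono' ?_ (.of_forall fun η => ?_)
    · refine Measurable.aestronglyMeasurable (measurable_const.div ?_)
      exact (measurable_qPochInf hq0 hq1).comp (by fun_prop)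
    · rw [norm_div, div_eq_mul_inv]
      refine mul_le_mul_of_nonneg_left (inv_anti₀ (by positivity) ?_) (norm_nonneg _)
      have := one_add_sq_le_norm_qPochInf hq0 hq1 (z := c - η * Complex.I) (by simpa using hc)
      simpa using this
  have hT1 : Real.exp (-t) ∈ Set.Ioo (0 : ℝ) 1 :=
    ⟨Real.exp_pos _, by rw [Real.exp_lt_one_iff]; linarith⟩
  have hcontf : ContinuousAt f (Real.exp (-t)) := by
    have h1 : ContinuousAt h (Real.exp (-t)) := (hcont.mono Set.Ioo_subset_Ioc_self).continuousAt
      (isOpen_Ioo.mem_nhds hT1)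
    refine h1.congr ?_
    filter_upwards [isOpen_Ioo.mem_nhds hT1] with T hT
    rw [hf, Set.indicator_of_mem (Set.Ioo_subset_Ioc_self hT)]
  have hfin := mellinInv_mellin_eq (-c) f hT1.1 (hmellin ((-c : ℝ) : ℂ) (by simpa using hc)).1
    hvert hcontf
  rw [mellinInv] at hfin
  simp only [hline, smul_eq_mul, Complex.real_smul] at hfin
  have hpow : ∀ η : ℝ, ((Real.exp (-t) : ℝ) : ℂ) ^ (-(((-c : ℝ) : ℂ) + η * Complex.I)) =
      Complex.exp (t * (-c + η * Complex.I)) := by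
    intro η
    rw [Complex.cpow_def_of_ne_zero (by exact_mod_cast (Real.exp_pos _).ne'),
      ← Complex.ofReal_log (Real.exp_pos _).le, Real.log_exp]
    congr 1
    push_cast; ring
  simp only [hpow] at hfin
  rw [hfin, qSeries_eq_tsum_eulerCoeff, Complex.ofReal_mul, Complex.ofReal_tsum, hf,
    Set.indicator_of_mem (Set.Ioo_subset_Ioc_self hT1), hh]
  congr 1
  refine tsum_congr fun k => ?_
  rw [Complex.ofReal_mul]
  congr 1
  rw [← Complex.ofReal_cpow (Real.exp_pos _).le, ← Real.exp_mul, neg_mul]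

/-! ### Stirling's formula for the real Gamma function -/

/-- The inequality `y ≤ sinh y` at `y = log (1 + x)`. -/
lemma log_one_add_le_mul_div {x : ℝ} (hx : 0 ≤ x) :
    Real.log (1 + x) ≤ x * (2 + x) / (2 * (1 + x)) := by
  have h := Real.self_le_sinh_iff.2 (Real.log_nonneg (show 1 ≤ 1 + x by linarith))
  rw [Real.sinh_log (by linarith)] at h
  refine h.trans_eq ?_
  field_simp
  ring

/-- Stirling's formula with an explicit error term: the error is a telescoping sum, whose terms are
compared with `1 / (4 s (s + 1))`. -/
theorem log_Gamma_stirling {s : ℝ} (hs : 0 < s) :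
    0 ≤ Real.log (Real.Gamma s) - ((s - 1 / 2) * Real.log s - s + Real.log (2 * Real.pi) / 2) ∧
    Real.log (Real.Gamma s) - ((s - 1 / 2) * Real.log s - s + Real.log (2 * Real.pi) / 2) ≤
      1 / (4 * s) := by
  set f : ℝ → ℝ := fun y =>
    Real.log (Real.Gamma y) - ((y - 1 / 2) * Real.log y - y + Real.log (2 * Real.pi) / 2) with hf
  have hlg : ∀ y, 0 < y → Real.log (Real.Gamma (y + 1)) = Real.log y + Real.log (Real.Gamma y) := by
    intro y hy
    rw [Real.Gamma_add_one hy.ne', Real.log_mul hy.ne' (Real.Gamma_pos_of_pos hy).ne']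
  have hstep : ∀ y, 0 < y → 0 ≤ f y - f (y + 1) ∧
      f y - f (y + 1) ≤ 1 / (4 * y) - 1 / (4 * (y + 1)) := by
    intro y hy
    have e1 : f y - f (y + 1) = (y + 1 / 2) * Real.log (1 + 1 / y) - 1 := by
      have : (1 + 1 / y) = (y + 1) / y := by field_simp
      simp only [hf]
      rw [hlg y hy, this, Real.log_div (by positivity) (by positivity)]
      ring
    have h1 := Real.le_log_one_add_of_nonneg (show 0 ≤ 1 / y by positivity)
    have h2 := log_one_add_le_mul_div (show 0 ≤ 1 / y by positivity)
    have e2 : (y + 1 / 2) * (2 * (1 / y) / (1 / y + 2)) = 1 := by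
      field_simp; ring
    have e3 : (y + 1 / 2) * (1 / y * (2 + 1 / y) / (2 * (1 + 1 / y))) - 1 =
        1 / (4 * y) - 1 / (4 * (y + 1)) := by
      field_simp; ring
    have hy' : 0 ≤ y + 1 / 2 := by positivity
    rw [e1]
    constructor
    · linarith [mul_le_mul_of_nonneg_left h1 hy']
    · linarith [mul_le_mul_of_nonneg_left h2 hy']
  have htel : ∀ n : ℕ, 0 ≤ f s - f (s + n) ∧ f s - f (s + n) ≤ 1 / (4 * s) - 1 / (4 * (s + n)) := by
    intro n
    induction n with
    | zero => simp
    | succ n ih =>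
      have h := hstep (s + n) (by positivity)
      have e : s + ((n + 1 : ℕ) : ℝ) = s + n + 1 := by push_cast; ring
      rw [e]
      constructor <;> linarith [h.1, h.2, ih.1, ih.2]
  have hGamma : ∀ n : ℕ, Real.log (Real.Gamma (s + n)) =
      Real.log (Real.Gamma s) + ∑ m ∈ Finset.range n, Real.log (s + m) := by
    intro n
    induction n with
    | zero => simp
    | succ n ih =>
      have e : s + ((n + 1 : ℕ) : ℝ) = s + n + 1 := by push_cast; ring
      rw [e, hlg _ (by positivity), ih, Finset.sum_range_succ]
      ring
  -- The constant is found by comparing Euler's limit for `log Γ` with Stirling's formula for `n!`.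
  have hlim : Tendsto (fun n : ℕ => f (s + (n + 1 : ℕ))) atTop (𝓝 0) := by
    have h1 := Real.BohrMollerup.tendsto_log_gamma hs
    have h2 : Tendsto (fun n : ℕ => Real.log (Stirling.stirlingSeq n)) atTop
        (𝓝 (Real.log √Real.pi)) :=
      (Real.continuousAt_log (Real.sqrt_pos.2 Real.pi_pos).ne').tendsto.comp
        Stirling.tendsto_stirlingSeq_sqrt_pi
    have h3 : Tendsto (fun n : ℕ => (n : ℝ) * Real.log (1 + (s + 1) / n)) atTop (𝓝 (s + 1)) :=
      (Real.tendsto_mul_log_one_add_div_atTop (s + 1)).comp tendsto_natCast_atTop_atTop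
    have h4 : Tendsto (fun n : ℕ => Real.log (1 + (s + 1) / n)) atTop (𝓝 0) := by
      have : Tendsto (fun n : ℕ => 1 + (s + 1) / (n : ℝ)) atTop (𝓝 (1 + 0)) :=
        (tendsto_const_nhds.div_atTop tendsto_natCast_atTop_atTop).const_add 1
      rw [add_zero] at this
      have h := (Real.continuousAt_log one_ne_zero).tendsto.comp this
      rw [Real.log_one] at h
      exact h
    have h5 := ((((h1.const_sub (Real.log (Real.Gamma s))).add h2).sub h3).sub
      (h4.const_mul (s + 1 / 2))).add_const (s + 1 - Real.log √Real.pi)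
    have e0 : Real.log (Real.Gamma s) - Real.log (Real.Gamma s) + Real.log √Real.pi - (s + 1) -
        (s + 1 / 2) * 0 + (s + 1 - Real.log √Real.pi) = 0 := by ring
    rw [e0] at h5
    refine h5.congr' ?_
    filter_upwards [eventually_gt_atTop 0] with n hn
    have hn' : (0 : ℝ) < n := by exact_mod_cast hn
    have e1 : 1 + (s + 1) / (n : ℝ) = (s + (n + 1 : ℕ)) / n := by push_cast; field_simp; ring
    simp only [hf]
    rw [hGamma, Stirling.log_stirlingSeq_formula, Real.BohrMollerup.logGammaSeq, e1,
      Real.log_div (by positivity) hn'.ne', Real.log_div hn'.ne' (Real.exp_pos 1).ne', Real.log_exp,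
      Real.log_sqrt Real.pi_pos.le, Real.log_mul two_ne_zero hn'.ne',
      Real.log_mul two_ne_zero Real.pi_pos.ne']
    push_cast
    ring
  constructor
  · have := ge_of_tendsto' (hlim.const_sub (f s)) (fun n => (htel (n + 1)).1)
    rw [sub_zero] at this
    exact this
  · have := le_of_tendsto' (hlim.const_sub (f s)) (fun n => ((htel (n + 1)).2.trans
      (sub_le_self _ (by positivity))))
    rw [sub_zero] at this
    exact this

/-! ### The dilogarithm -/

lemma continuousOn_dslope_log :
    ContinuousOn (dslope (fun v : ℝ => Real.log (1 - v)) 0) (Set.Iio 1) := by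
  rw [continuousOn_dslope (Iio_mem_nhds zero_lt_one)]
  constructor
  · exact ContinuousOn.log (by fun_prop) fun v hv => (sub_pos.2 hv).ne'
  · exact DifferentiableAt.log (by fun_prop) (by norm_num)

lemma mul_dslope_log (z : ℝ) : z * dslope (fun v : ℝ => Real.log (1 - v)) 0 z = Real.log (1 - z) := by
  have := sub_smul_dslope (fun v : ℝ => Real.log (1 - v)) 0 z
  simpa using this

lemma dilog_eq_integral_dslope (z : ℝ) :
    dilog z = -∫ v in (0 : ℝ)..z, dslope (fun v : ℝ => Real.log (1 - v)) 0 v := by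
  rw [dilog]
  congr 1
  refine intervalIntegral.integral_congr_ae ?_
  have : ∀ᵐ v : ℝ, v ≠ 0 := by simp [MeasureTheory.ae_iff]
  filter_upwards [this] with v hv _
  rw [div_eq_iff hv, mul_comm, mul_dslope_log]

/-- At `z = 0` the difference quotient stands for the derivative, which removes the
singularity of `log (1 - z) / z`. -/
lemma hasDerivAt_dilog {z : ℝ} (hz : z < 1) :
    HasDerivAt dilog (-dslope (fun v : ℝ => Real.log (1 - v)) 0 z) z := by
  have hc := continuousOn_dslope_log
  rw [funext dilog_eq_integral_dslope]
  refine HasDerivAt.neg (intervalIntegral.integral_hasDerivAt_right ?_ ?_ ?_)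
  · refine (hc.mono fun v hv => ?_).intervalIntegrable
    rw [Set.mem_uIcc] at hv
    rcases hv with h | h
    · exact h.2.trans_lt hz
    · exact h.2.trans_lt one_pos
  · exact hc.stronglyMeasurableAtFilter isOpen_Iio z hz
  · exact hc.continuousAt (Iio_mem_nhds hz)

lemma dilog_zero : dilog 0 = 0 := by simp [dilog]

lemma hasSum_dilog {z : ℝ} (hz0 : 0 ≤ z) (hz1 : z < 1) :
    HasSum (fun n : ℕ => z ^ (n + 1) / ((n : ℝ) + 1) ^ 2) (dilog z) := by
  have hgeo : Summable (fun n : ℕ => z ^ n) := summable_geometric_of_lt_one hz0 hz1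
  have h := intervalIntegral.hasSum_integral_of_dominated_convergence
    (μ := MeasureTheory.volume) (a := 0) (b := z)
    (F := fun (n : ℕ) (v : ℝ) => v ^ n / ((n : ℝ) + 1)) (f := fun v => -(Real.log (1 - v) / v))
    (fun n _ => z ^ n) (fun n => (by fun_prop : Continuous fun v : ℝ =>
      v ^ n / ((n : ℝ) + 1)).aestronglyMeasurable)
    (fun n => .of_forall fun v hv => by
      rw [Set.uIoc_of_le hz0] at hv
      rw [norm_div, norm_pow, Real.norm_of_nonneg hv.1.le, Real.norm_of_nonneg (by positivity)]
      calc _ ≤ v ^ n := div_le_self (pow_nonneg hv.1.le n) (by linarith [Nat.cast_nonneg (α := ℝ) n])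
        _ ≤ _ := pow_le_pow_left₀ hv.1.le hv.2 n)
    (.of_forall fun v _ => hgeo) (by simp)
    (.of_forall fun v hv => by
      rw [Set.uIoc_of_le hz0] at hv
      have := (Real.hasSum_pow_div_log_of_abs_lt_one
        (show |v| < 1 by rw [abs_of_pos hv.1]; exact hv.2.trans_lt hz1)).mul_left v⁻¹
      have e1 : ∀ n : ℕ, v⁻¹ * (v ^ (n + 1) / ((n : ℝ) + 1)) = v ^ n / ((n : ℝ) + 1) := fun n => by
        have := hv.1.ne'
        rw [pow_succ]; field_simp
      have e2 : v⁻¹ * -Real.log (1 - v) = -(Real.log (1 - v) / v) := by ring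
      simp only [e1, e2] at this
      exact this)
  have e1 : ∀ n : ℕ, ∫ v in (0 : ℝ)..z, v ^ n / ((n : ℝ) + 1) =
      z ^ (n + 1) / ((n : ℝ) + 1) ^ 2 := fun n => by
    rw [intervalIntegral.integral_div, integral_pow]
    field_simp
    simp
  have e2 : ∫ v in (0 : ℝ)..z, -(Real.log (1 - v) / v) = dilog z := by
    rw [intervalIntegral.integral_neg]; rfl
  simp only [e1, e2] at h
  exact h

lemma tendsto_dilog_one : Tendsto dilog (𝓝[<] 1) (𝓝 (Real.pi ^ 2 / 6)) := by
  have hs : Summable (fun n : ℕ => 1 / ((n : ℝ) + 1) ^ 2) := by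
    have := (summable_nat_add_iff 1).2 hasSum_zeta_two.summable
    simpa using this
  have hval : ∑' n : ℕ, 1 / ((n : ℝ) + 1) ^ 2 = Real.pi ^ 2 / 6 := by
    have := hasSum_zeta_two.summable.tsum_eq_zero_add
    rw [hasSum_zeta_two.tsum_eq] at this
    simpa using this.symm
  have h : Tendsto (fun z : ℝ => ∑' n : ℕ, z ^ (n + 1) / ((n : ℝ) + 1) ^ 2) (𝓝[<] 1)
      (𝓝 (∑' n : ℕ, 1 / ((n : ℝ) + 1) ^ 2)) := by
    refine tendsto_tsum_of_dominated_convergence hs (fun n => ?_) ?_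
    · have : Tendsto (fun z : ℝ => z ^ (n + 1) / ((n : ℝ) + 1) ^ 2) (𝓝 1)
          (𝓝 (1 ^ (n + 1) / ((n : ℝ) + 1) ^ 2)) :=
        (by fun_prop : Continuous fun z : ℝ => z ^ (n + 1) / ((n : ℝ) + 1) ^ 2).tendsto 1
      rw [one_pow] at this
      exact this.mono_left nhdsWithin_le_nhds
    · filter_upwards [Ioo_mem_nhdsLT zero_lt_one] with z hz n
      rw [Real.norm_of_nonneg (div_nonneg (pow_nonneg hz.1.le _) (by positivity))]
      exact div_le_div_of_nonneg_right (pow_le_one₀ hz.1.le hz.2.le) (by positivity)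
  rw [hval] at h
  refine h.congr' ?_
  filter_upwards [Ioo_mem_nhdsLT zero_lt_one] with z hz
  exact (hasSum_dilog hz.1.le hz.2).tsum_eq

/-- Euler's reflection formula for the dilogarithm. -/
theorem dilog_add_dilog_one_sub {z : ℝ} (hz : z ∈ Set.Ioo (0 : ℝ) 1) :
    dilog z + dilog (1 - z) = Real.pi ^ 2 / 6 - Real.log z * Real.log (1 - z) := by
  set R : ℝ → ℝ := fun y => dilog y + dilog (1 - y) + Real.log y * Real.log (1 - y) with hR
  have hd : ∀ y ∈ Set.Ioo (0 : ℝ) 1, HasDerivAt R 0 y := by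
    intro y hy
    have hy0 : y ≠ 0 := hy.1.ne'
    have hy1 : 1 - y ≠ 0 := (sub_pos.2 hy.2).ne'
    have hs : HasDerivAt (fun y : ℝ => 1 - y) (-1) y := by
      simpa using (hasDerivAt_id y).const_sub 1
    have h1 := hasDerivAt_dilog hy.2
    have h2 := (hasDerivAt_dilog (z := 1 - y) (by linarith [hy.1])).comp y hs
    have h3 := (Real.hasDerivAt_log hy0).mul (hs.log hy1)
    have e1 : dslope (fun v : ℝ => Real.log (1 - v)) 0 y = Real.log (1 - y) / y := by
      rw [eq_div_iff hy0, mul_comm, mul_dslope_log]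
    have e2 : dslope (fun v : ℝ => Real.log (1 - v)) 0 (1 - y) = Real.log y / (1 - y) := by
      rw [eq_div_iff hy1, mul_comm, mul_dslope_log, sub_sub_cancel]
    refine ((h1.add h2).add h3).congr_deriv ?_
    rw [e1, e2]
    field_simp
    ring
  obtain ⟨K, hK⟩ := isOpen_Ioo.exists_is_const_of_deriv_eq_zero (isPreconnected_Ioo)
    (fun y hy => (hd y hy).differentiableAt.differentiableWithinAt)
    (fun y hy => (hd y hy).deriv)
  have hlim : Tendsto R (𝓝[>] 0) (𝓝 (0 + Real.pi ^ 2 / 6 + 0)) := by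
    refine (Tendsto.add ?_ ?_).add ?_
    · have := (hasDerivAt_dilog zero_lt_one).continuousAt.tendsto
      rw [dilog_zero] at this
      exact this.mono_left nhdsWithin_le_nhds
    · refine tendsto_dilog_one.comp (tendsto_nhdsWithin_iff.2 ⟨?_, ?_⟩)
      · have : Tendsto (fun y : ℝ => 1 - y) (𝓝 0) (𝓝 (1 - 0)) :=
          (by fun_prop : Continuous fun y : ℝ => 1 - y).tendsto 0
        rw [sub_zero] at this
        exact this.mono_left nhdsWithin_le_nhds
      · filter_upwards [self_mem_nhdsWithin] with y hy
        have : (0 : ℝ) < y := hy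
        simpa using this
    · have h1 : Tendsto (fun y : ℝ => Real.log y * y) (𝓝[>] 0) (𝓝 0) :=
        by simpa only [Real.rpow_one] using tendsto_log_mul_rpow_nhdsGT_zero zero_lt_one
      have h2 := (continuousOn_dslope_log.continuousAt (Iio_mem_nhds zero_lt_one)).tendsto.mono_left
        (nhdsWithin_le_nhds (s := Set.Ioi 0))
      have h3 := h1.mul h2
      rw [zero_mul] at h3
      refine h3.congr fun y => ?_
      rw [mul_assoc, mul_dslope_log]
  have hKval : K = Real.pi ^ 2 / 6 := by
    refine tendsto_nhds_unique (tendsto_const_nhds.congr' ?_) (by simpa using hlim)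
    filter_upwards [Ioo_mem_nhdsGT zero_lt_one] with y hy
    exact (hK y hy).symm
  have := hK z hz
  simp only [hR] at this
  linarith

/-! ### Asymptotics of the infinite products as `q → 1` -/

lemma tendsto_exp_neg_mul_natCast {ε : ℝ} (hε : 0 < ε) :
    Tendsto (fun n : ℕ => Real.exp (-(ε * n))) atTop (𝓝 0) :=
  (Real.tendsto_exp_neg_atTop_nhds_zero).comp (tendsto_const_mul_natCast_atTop hε)

lemma one_sub_mul_exp_neg_pos {z v : ℝ} (hz : z < 1) (hv : 0 ≤ v) : 0 < 1 - z * Real.exp (-v) := by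
  have h1 := Real.exp_pos (-v)
  have h2 : Real.exp (-v) ≤ 1 := Real.exp_le_one_iff.2 (by linarith)
  rcases le_total z 0 with h | h <;> nlinarith

lemma exp_neg_pow (ε : ℝ) (j : ℕ) : Real.exp (-ε) ^ j = Real.exp (-(ε * j)) := by
  rw [← Real.exp_nat_mul]; congr 1; ring

/-- The trapezoidal rule for `log (1 - z exp (-v))`, whose antiderivative is
`dilog (z exp (-v))`. -/
lemma trapezoid_log_one_sub {z ε : ℝ} (hz : z < 1) (hε : 0 < ε) (n : ℕ) :
    |dilog (z * Real.exp (-(ε * n))) - dilog z -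
      ε * (∑ j ∈ Finset.range n, Real.log (1 - z * Real.exp (-(ε * j))) - Real.log (1 - z) / 2 +
        Real.log (1 - z * Real.exp (-(ε * n))) / 2)| ≤ ε ^ 2 / 2 * (|z| / (1 - z)) := by
  set P : ℝ → ℝ := fun v => dilog (z * Real.exp (-v)) with hPdef
  set f : ℝ → ℝ := fun v => Real.log (1 - z * Real.exp (-v)) with hfdef
  set f' : ℝ → ℝ := fun v => z * Real.exp (-v) / (1 - z * Real.exp (-v)) with hf'def
  have hexp : ∀ v : ℝ, HasDerivAt (fun v : ℝ => z * Real.exp (-v)) (-(z * Real.exp (-v))) v := by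
    intro v
    have := ((hasDerivAt_neg v).exp).const_mul z
    exact this.congr_deriv (by ring)
  have hP : ∀ v, 0 ≤ v → HasDerivAt P (f v) v := by
    intro v hv
    have h1 := one_sub_mul_exp_neg_pos hz hv
    refine ((hasDerivAt_dilog (z := z * Real.exp (-v)) (by linarith)).comp v (hexp v)).congr_deriv ?_
    rw [neg_mul_neg, mul_comm, mul_dslope_log]
  have hf : ∀ v, 0 ≤ v → HasDerivAt f (f' v) v := by
    intro v hv
    have h1 := one_sub_mul_exp_neg_pos hz hv
    refine (((hexp v).const_sub 1).log h1.ne').congr_deriv ?_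
    rw [neg_neg]
  have hmono : ∀ a b, 0 ≤ a → a ≤ b → Real.exp (-b) ≤ Real.exp (-a) := fun a b _ hab =>
    Real.exp_le_exp.2 (by linarith)
  have hf'0 : f' 0 = z / (1 - z) := by simp [hf'def]
  have hz1 : 0 < 1 - z := by linarith
  have hεn : 0 ≤ ε * n := by positivity
  have hdn := one_sub_mul_exp_neg_pos hz hεn
  have hP0 : P 0 = dilog z := by simp [hPdef]
  have hf0 : f 0 = Real.log (1 - z) := by simp [hfdef]
  rcases le_total z 0 with h | h
  · have hm : MonotoneOn f' (Set.Ici 0) := by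
      intro a ha b hb hab
      have h1 := one_sub_mul_exp_neg_pos hz ha
      have h2 := one_sub_mul_exp_neg_pos hz hb
      simp only [hf'def]
      rw [div_le_div_iff₀ h1 h2]
      nlinarith [hmono a b ha hab]
    have := trapezoid_sum hP hf hm hε n
    rw [hP0, hf0] at this
    refine this.trans (mul_le_mul_of_nonneg_left ?_ (by positivity))
    rw [hf'0, abs_of_nonpos h]
    have : f' (ε * n) ≤ 0 :=
      div_nonpos_of_nonpos_of_nonneg (mul_nonpos_of_nonpos_of_nonneg h (Real.exp_pos _).le) hdn.le
    rw [neg_div]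
    linarith
  · have hm : MonotoneOn (fun v => -f' v) (Set.Ici 0) := by
      intro a ha b hb hab
      have h1 := one_sub_mul_exp_neg_pos hz ha
      have h2 := one_sub_mul_exp_neg_pos hz hb
      simp only [hf'def, neg_le_neg_iff]
      rw [div_le_div_iff₀ h2 h1]
      nlinarith [hmono a b ha hab]
    have := trapezoid_sum (P := fun v => -P v) (f := fun v => -f v) (f' := fun v => -f' v)
      (fun v hv => (hP v hv).neg) (fun v hv => (hf v hv).neg) hm hε n
    rw [hP0, hf0] at this
    rw [← abs_neg]
    refine Eq.trans_le ?_ (this.trans (mul_le_mul_of_nonneg_left ?_ (by positivity)))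
    · congr 1
      rw [Finset.sum_neg_distrib]
      ring
    · rw [hf'0, abs_of_nonneg h]
      have : 0 ≤ f' (ε * n) := div_nonneg (mul_nonneg h (Real.exp_pos _).le) hdn.le
      linarith

/-- Asymptotics of `(z; q)_∞` for `q = exp (-ε)` and fixed real `z < 1`. -/
theorem qPochInf_asymptotics {z : ℝ} (hz : z < 1) {ε : ℝ} (hε : 0 < ε) :
    ∃ δ : ℝ, |δ| ≤ |z| / (2 * (1 - z)) * ε ∧
      qPochInf z (Real.exp (-ε)) =
        ((Real.exp (-(dilog z / ε)) * √(1 - z) * Real.exp δ : ℝ) : ℂ) := by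
  set q := Real.exp (-ε) with hq
  have hq0 : 0 < q := Real.exp_pos _
  have hq1 : q < 1 := by rw [hq, Real.exp_lt_one_iff]; linarith
  have hz1 : 0 < 1 - z := by linarith
  set S : ℕ → ℝ := fun n => ∑ j ∈ Finset.range n, Real.log (1 - z * Real.exp (-(ε * j))) with hS
  have hprod : ∀ n, ∏ j ∈ Finset.range n, (1 - (z : ℂ) * (q : ℂ) ^ j) = (Real.exp (S n) : ℝ) := by
    intro n
    rw [hS, Real.exp_sum]
    push_cast
    refine Finset.prod_congr rfl fun j _ => ?_
    rw [← Complex.ofReal_exp, Real.exp_log (one_sub_mul_exp_neg_pos hz (by positivity)),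
      ← exp_neg_pow, hq]
    push_cast
    rfl
  have hlimC := tendsto_prod_qPochInf hq0 hq1 (z : ℂ)
  simp only [hprod] at hlimC
  have hlim : Tendsto (fun n => Real.exp (S n)) atTop (𝓝 (qPochInf z q).re) := by
    have := (Complex.continuous_re.tendsto _).comp hlimC
    simpa [Function.comp_def, Complex.exp_ofReal_re] using this
  have hre : qPochInf z q = ((qPochInf z q).re : ℂ) :=
    tendsto_nhds_unique hlimC ((Complex.continuous_ofReal.tendsto _).comp hlim)
  -- The trapezoidal rule, with the two vanishing boundary terms collected in `e n`.
  set e : ℕ → ℝ := fun n => dilog (z * Real.exp (-(ε * n))) / ε -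
    Real.log (1 - z * Real.exp (-(ε * n))) / 2 with he
  have hbd : ∀ n, |e n - (S n + dilog z / ε - Real.log (1 - z) / 2)| ≤
      |z| / (2 * (1 - z)) * ε := by
    intro n
    have h1 := trapezoid_log_one_sub hz hε n
    have h2 : e n - (S n + dilog z / ε - Real.log (1 - z) / 2) =
      (dilog (z * Real.exp (-(ε * n))) - dilog z -
      ε * (∑ j ∈ Finset.range n, Real.log (1 - z * Real.exp (-(ε * j))) - Real.log (1 - z) / 2 +
        Real.log (1 - z * Real.exp (-(ε * n))) / 2)) / ε := by
      simp only [he, hS]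
      field_simp
      ring
    rw [h2, abs_div, abs_of_pos hε, div_le_iff₀ hε]
    refine h1.trans_eq ?_
    field_simp
  have hzq : Tendsto (fun n : ℕ => z * Real.exp (-(ε * n))) atTop (𝓝 0) := by
    simpa using (tendsto_exp_neg_mul_natCast hε).const_mul z
  have helim : Tendsto e atTop (𝓝 0) := by
    have h1 : Tendsto (fun n : ℕ => dilog (z * Real.exp (-(ε * n)))) atTop (𝓝 0) := by
      have := (hasDerivAt_dilog zero_lt_one).continuousAt.tendsto
      rw [dilog_zero] at this
      exact this.comp hzq
    have h2 : Tendsto (fun n : ℕ => Real.log (1 - z * Real.exp (-(ε * n)))) atTop (𝓝 0) := by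
      have h := hzq.const_sub 1
      rw [sub_zero] at h
      have := (Real.continuousAt_log one_ne_zero).tendsto.comp h
      rw [Real.log_one] at this
      exact this
    simpa using (h1.div_const ε).sub (h2.div_const 2)
  -- The logarithms `S n` are bounded below, so that the limit of the products is not zero.
  have hpos : 0 < (qPochInf z q).re := by
    obtain ⟨B, hB⟩ := helim.bddBelow_range
    have hlow : ∀ n, Real.exp (B - (dilog z / ε - Real.log (1 - z) / 2) -
        |z| / (2 * (1 - z)) * ε) ≤ Real.exp (S n) := by
      intro n
      refine Real.exp_le_exp.2 ?_
      have h1 := (abs_le.1 (hbd n)).2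
      have h2 : B ≤ e n := hB ⟨n, rfl⟩
      linarith
    exact (Real.exp_pos _).trans_le (ge_of_tendsto' hlim hlow)
  have hSlim : Tendsto S atTop (𝓝 (Real.log (qPochInf z q).re)) := by
    have := (Real.continuousAt_log hpos.ne').tendsto.comp hlim
    simpa [Function.comp_def] using this
  refine ⟨Real.log (qPochInf z q).re + dilog z / ε - Real.log (1 - z) / 2, ?_, ?_⟩
  · have := (helim.sub ((hSlim.add_const (dilog z / ε)).sub_const (Real.log (1 - z) / 2))).abs
    rw [zero_sub, abs_neg] at this
    exact le_of_tendsto' this hbd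
  · rw [hre]
    congr 1
    rw [Complex.ofReal_re, ← Real.exp_log (Real.sqrt_pos.2 hz1), ← Real.exp_add, ← Real.exp_add,
      Real.log_sqrt hz1.le]
    nth_rewrite 1 [← Real.exp_log hpos]
    congr 1
    ring

lemma one_sub_two_mul_le_prod {p : ℝ} (hp0 : 0 < p) (hp1 : p ≤ 1 / 2) (n : ℕ) :
    1 - 2 * p + p ^ (n + 1) ≤ ∏ j ∈ Finset.range n, (1 - p * p ^ j) := by
  induction n with
  | zero => simp; linarith
  | succ n ih =>
    rw [Finset.prod_range_succ]
    have h1 : 0 < p ^ (n + 1) := pow_pos hp0 _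
    have h2 : p ^ (n + 1) ≤ p := by
      rw [pow_succ]; exact mul_le_of_le_one_left hp0.le (pow_le_one₀ hp0.le (by linarith))
    have h3 : p * p ^ n = p ^ (n + 1) := by rw [pow_succ, mul_comm]
    have h4 : p ^ (n + 1 + 1) = p * p ^ (n + 1) := by rw [pow_succ, mul_comm]
    rw [h3, h4]
    have h5 : 0 ≤ 1 - p ^ (n + 1) := by linarith
    nlinarith [mul_le_mul_of_nonneg_right ih h5, mul_pos hp0 h1]

/-- After the modular transformation this is needed for the tiny nome `exp (-4 π² / ε)` only. -/
lemma norm_qPochInf_self_mem {p : ℝ} (hp0 : 0 < p) (hp1 : p ≤ 1 / 2) :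
    1 - 2 * p ≤ ‖qPochInf p p‖ ∧ ‖qPochInf p p‖ ≤ 1 := by
  have hlim := (tendsto_prod_qPochInf hp0 (by linarith) (p : ℂ)).norm
  have hfac : ∀ j : ℕ, 0 ≤ 1 - p * p ^ j ∧ 1 - p * p ^ j ≤ 1 := fun j => by
    have h1 : p ^ j ≤ 1 := pow_le_one₀ hp0.le (by linarith)
    have h2 : 0 < p ^ j := pow_pos hp0 j
    constructor <;> nlinarith
  have hn : ∀ n, ‖∏ j ∈ Finset.range n, (1 - (p : ℂ) * (p : ℂ) ^ j)‖ =
      ∏ j ∈ Finset.range n, (1 - p * p ^ j) := by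
    intro n
    rw [norm_prod]
    refine Finset.prod_congr rfl fun j _ => ?_
    rw [← Complex.ofReal_pow, ← Complex.ofReal_mul, ← Complex.ofReal_one, ← Complex.ofReal_sub,
      Complex.norm_real, Real.norm_of_nonneg (hfac j).1]
  simp only [hn] at hlim
  constructor
  · refine ge_of_tendsto' hlim fun n => (le_trans ?_ (one_sub_two_mul_le_prod hp0 hp1 n))
    linarith [pow_pos hp0 (n + 1)]
  · exact le_of_tendsto' hlim fun n =>
      Finset.prod_le_one (fun j _ => (hfac j).1) fun j _ => (hfac j).2

lemma norm_eta_mul_I (ε : ℝ) :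
    ‖ModularForm.eta ((ε / (2 * Real.pi) : ℝ) * Complex.I)‖ =
      Real.exp (-(ε / 24)) * ‖qPochInf (Real.exp (-ε) : ℝ) (Real.exp (-ε))‖ := by
  rw [ModularForm.eta, norm_mul, Function.Periodic.qParam, Complex.norm_exp]
  have hpi : (Real.pi : ℂ) ≠ 0 := by exact_mod_cast Real.pi_ne_zero
  congr 2
  · have : 2 * (Real.pi : ℂ) * Complex.I * ((ε / (2 * Real.pi) : ℝ) * Complex.I) / (24 : ℝ) =
        ((-(ε / 24) : ℝ) : ℂ) := by
      push_cast
      field_simp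
      linear_combination (ε : ℂ) * Complex.I_sq
    rw [this, Complex.ofReal_re]
  · rw [qPochInf]
    refine tprod_congr fun j => ?_
    rw [ModularForm.eta_q_eq_pow, ← pow_succ']
    congr 2
    rw [Complex.ofReal_exp]
    congr 1
    push_cast
    field_simp
    linear_combination (ε : ℂ) * Complex.I_sq

/-- Asymptotics of `(q; q)_∞` for `q = exp (-ε)`, from the modular transformation of Dedekind's
eta function, which exchanges `ε` and `4 π² / ε`. -/
theorem norm_qPochInf_self_asymptotics {ε : ℝ} (hε : 0 < ε) (hε1 : ε ≤ 1) :
    ∃ δ : ℝ, |δ| ≤ ε ∧ ‖qPochInf (Real.exp (-ε) : ℝ) (Real.exp (-ε))‖ =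
      √(2 * Real.pi / ε) * Real.exp (-(Real.pi ^ 2 / (6 * ε))) * Real.exp δ := by
  have hpi := Real.pi_gt_three
  set ε' := 4 * Real.pi ^ 2 / ε with hε'
  have hε'0 : 0 < ε' := by positivity
  set z : ℂ := (ε / (2 * Real.pi) : ℝ) * Complex.I with hz
  have hzim : z ∈ UpperHalfPlane.upperHalfPlaneSet := by
    show 0 < z.im
    rw [hz, Complex.im_ofReal_mul, Complex.I_im, mul_one]
    positivity
  have htr := ModularForm.eta_comp_eq_csqrt_I_inv hzim
  have hinv : -1 / z = (ε' / (2 * Real.pi) : ℝ) * Complex.I := by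
    have h1 : (ε : ℂ) ≠ 0 := by exact_mod_cast hε.ne'
    have h2 : (Real.pi : ℂ) ≠ 0 := by exact_mod_cast Real.pi_ne_zero
    rw [hz, hε']
    push_cast
    field_simp
    linear_combination (-4 : ℂ) * Complex.I_sq
  have hnorm := congrArg norm htr
  simp only [Function.comp_apply, Pi.smul_apply, Pi.mul_apply, smul_eq_mul, norm_mul, norm_inv,
    hinv] at hnorm
  have hs1 : ‖Complex.sqrt Complex.I‖ = 1 := by
    rw [Complex.sqrt, show (2⁻¹ : ℂ) = ((2⁻¹ : ℝ) : ℂ) by push_cast; rfl, Complex.norm_cpow_real]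
    simp
  have hs2 : ‖Complex.sqrt z‖ = √(ε / (2 * Real.pi)) := by
    rw [Complex.sqrt, show (2⁻¹ : ℂ) = ((2⁻¹ : ℝ) : ℂ) by push_cast; rfl, Complex.norm_cpow_real,
      Real.sqrt_eq_rpow, hz, norm_mul, Complex.norm_I, mul_one, Complex.norm_real,
      Real.norm_of_nonneg (by positivity), one_div]
  rw [hs1, hs2, norm_eta_mul_I ε', hz, norm_eta_mul_I ε, inv_one, one_mul] at hnorm
  set p := Real.exp (-ε') with hp
  have hp0 : 0 < p := Real.exp_pos _
  have hpε : p ≤ ε / 4 ^ 2 := by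
    have h1 := Real.add_one_le_exp ε'
    rw [hp, Real.exp_neg, inv_le_comm₀ (Real.exp_pos _) (by positivity)]
    have : (ε / 4 ^ 2)⁻¹ ≤ ε' := by
      rw [hε', inv_div]
      exact div_le_div_of_nonneg_right (by nlinarith) hε.le
    linarith
  obtain ⟨hlo, hhi⟩ := norm_qPochInf_self_mem hp0 (by linarith)
  set w := ‖qPochInf (p : ℝ) p‖ with hw
  have hw0 : 0 < w := by linarith
  refine ⟨ε / 24 + Real.log w, ?_, ?_⟩
  · have h1 : Real.log w ≤ 0 := Real.log_nonpos hw0.le hhi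
    have h2 := Real.one_sub_inv_le_log_of_pos hw0
    have h3 : w⁻¹ ≤ 1 + 4 * p := by
      rw [inv_le_iff_one_le_mul₀ hw0]
      nlinarith
    rw [abs_le]
    constructor <;> linarith
  · have hsq : √(2 * Real.pi / ε) * √(ε / (2 * Real.pi)) = 1 := by
      rw [← Real.sqrt_mul (by positivity)]
      rw [← Real.sqrt_one]
      congr 1
      field_simp
    have he : Real.exp (-(ε' / 24)) = Real.exp (-(Real.pi ^ 2 / (6 * ε))) := by
      congr 2
      rw [hε']; field_simp; norm_num
    rw [he] at hnorm
    rw [Real.exp_add, Real.exp_log hw0]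
    have h24 : Real.exp (ε / 24) * Real.exp (-(ε / 24)) = 1 := by
      rw [← Real.exp_add]; simp
    calc _ = (√(2 * Real.pi / ε) * √(ε / (2 * Real.pi))) *
          (Real.exp (ε / 24) * Real.exp (-(ε / 24))) *
          ‖qPochInf (Real.exp (-ε) : ℝ) (Real.exp (-ε))‖ := by rw [hsq, h24]; ring
      _ = √(2 * Real.pi / ε) * Real.exp (ε / 24) * (√(ε / (2 * Real.pi)) *
          (Real.exp (-(ε / 24)) * ‖qPochInf (Real.exp (-ε) : ℝ) (Real.exp (-ε))‖)) := by ring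
      _ = _ := by rw [← hnorm]; ring

/-! ### Gaussian approximation of products of factors `1 / (1 + i τ d)` -/

/-- The bound `abs_re_sub_exp_le_of_tendsto`, with the errors that arise from a product of about
`1 / ε` factors: quadratic and linear terms from replacing sums by integrals, and terms of order
`τ⁴ / ε` and `τ³ / ε` from expanding the logarithm of each factor. -/
lemma gaussian_approx_of_log_bounds {Gn : ℕ → ℂ} {g : ℂ} {R Θ : ℕ → ℝ} {κ C ε τ : ℝ}
    (hC : 0 ≤ C) (hε : 0 < ε)
    (hG : ∀ᶠ n in atTop, Gn n = Complex.exp ((R n : ℝ) + (Θ n : ℝ) * Complex.I))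
    (hlim : Tendsto Gn atTop (𝓝 g))
    (hR : ∀ᶠ n in atTop, |R n + κ * τ ^ 2 / (2 * ε)| ≤ C * (τ ^ 2 + τ ^ 4 / ε))
    (hΘ : ∀ᶠ n in atTop, |Θ n| ≤ C * (|τ| + |τ| ^ 3 / ε)) :
    |g.re - Real.exp (-(κ * τ ^ 2 / (2 * ε)))| ≤
      (C + 2 * C ^ 2) * (τ ^ 2 + τ ^ 4 / ε + τ ^ 6 / ε ^ 2) *
        (‖g‖ + Real.exp (-(κ * τ ^ 2 / (2 * ε)))) := by
  refine (abs_re_sub_exp_le_of_tendsto hG hlim hR hΘ).trans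
    (mul_le_mul_of_nonneg_right ?_ (by positivity))
  have h1 : (|τ| + |τ| ^ 3 / ε) ^ 2 ≤ 2 * (τ ^ 2 + τ ^ 6 / ε ^ 2) := by
    have e1 : |τ| ^ 2 = τ ^ 2 := sq_abs τ
    have e2 : (|τ| ^ 3 / ε) ^ 2 = τ ^ 6 / ε ^ 2 := by
      rw [div_pow, ← pow_mul, show 3 * 2 = 2 * 3 by rfl, pow_mul, e1, ← pow_mul]
    rw [← e1, ← e2]
    nlinarith [sq_nonneg (|τ| - |τ| ^ 3 / ε)]
  have h2 : 0 ≤ τ ^ 4 / ε := by positivity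
  have h3 : 0 ≤ τ ^ 6 / ε ^ 2 := by positivity
  have h4 : 0 ≤ τ ^ 2 := by positivity
  have h5 := mul_le_mul_of_nonneg_left h1 (sq_nonneg C)
  rw [mul_pow]
  nlinarith [mul_nonneg (sq_nonneg C) h2, mul_nonneg hC h3]

lemma prod_inv_one_add_mul_I (τ : ℝ) (d : ℕ → ℝ) (n : ℕ) :
    ∏ j ∈ Finset.range n, ((1 + (τ * d j : ℝ) * Complex.I : ℂ))⁻¹ =
      Complex.exp ((-(∑ j ∈ Finset.range n, Real.log (1 + (τ * d j) ^ 2) / 2) : ℝ) +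
        (-(∑ j ∈ Finset.range n, Real.arctan (τ * d j)) : ℝ) * Complex.I) := by
  simp only [polar_inv_one_add_mul_I, ← Complex.exp_sum]
  congr 1
  rw [Finset.sum_add_distrib, ← Finset.sum_mul]
  push_cast
  simp only [Finset.sum_neg_distrib]

lemma abs_sum_log_sub_le {d : ℕ → ℝ} {M : ℝ} (hd0 : ∀ j, 0 ≤ d j) (hdM : ∀ j, d j ≤ M)
    (τ : ℝ) (n : ℕ) :
    |∑ j ∈ Finset.range n, Real.log (1 + (τ * d j) ^ 2) / 2 -
      τ ^ 2 / 2 * ∑ j ∈ Finset.range n, d j ^ 2| ≤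
      τ ^ 4 * M ^ 2 * ∑ j ∈ Finset.range n, d j ^ 2 := by
  rw [Finset.mul_sum, Finset.mul_sum, ← Finset.sum_sub_distrib]
  refine (Finset.abs_sum_le_sum_abs _ _).trans (Finset.sum_le_sum fun j _ => ?_)
  have h1 := abs_log_one_add_sub_self_le (sq_nonneg (τ * d j))
  have h2 : d j ^ 2 ≤ M ^ 2 := pow_le_pow_left₀ (hd0 j) (hdM j) 2
  have e : Real.log (1 + (τ * d j) ^ 2) / 2 - τ ^ 2 / 2 * d j ^ 2 =
      (Real.log (1 + (τ * d j) ^ 2) - (τ * d j) ^ 2) / 2 := by ring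
  rw [e, abs_div, abs_two]
  have h3 : ((τ * d j) ^ 2) ^ 2 ≤ τ ^ 4 * M ^ 2 * d j ^ 2 := by
    have := mul_le_mul_of_nonneg_left h2 (show 0 ≤ τ ^ 4 * d j ^ 2 by positivity)
    nlinarith
  have h4 : 0 ≤ ((τ * d j) ^ 2) ^ 2 := by positivity
  linarith

lemma abs_sum_arctan_sub_le {d : ℕ → ℝ} {M : ℝ} (hd0 : ∀ j, 0 ≤ d j) (hdM : ∀ j, d j ≤ M)
    (τ : ℝ) (n : ℕ) :
    |∑ j ∈ Finset.range n, Real.arctan (τ * d j) - τ * ∑ j ∈ Finset.range n, d j| ≤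
      |τ| ^ 3 * M * ∑ j ∈ Finset.range n, d j ^ 2 := by
  rw [Finset.mul_sum, Finset.mul_sum, ← Finset.sum_sub_distrib]
  refine (Finset.abs_sum_le_sum_abs _ _).trans (Finset.sum_le_sum fun j _ => ?_)
  refine (abs_arctan_sub_self_le _).trans ?_
  rw [abs_mul, abs_of_nonneg (hd0 j)]
  have := mul_le_mul_of_nonneg_left (hdM j) (show 0 ≤ |τ| ^ 3 * d j ^ 2 by positivity)
  nlinarith

/-! ### The saddle point on or to the left of the imaginary axis -/

lemma antitoneOn_exp_div {c : ℝ} (hc : c ≤ 0) :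
    AntitoneOn (fun v => Real.exp (-v) / (1 - c * Real.exp (-v))) (Set.Ici 0) := by
  intro a ha b hb hab
  have h1 := one_sub_mul_exp_neg_pos (z := c) (by linarith) (Set.mem_Ici.1 ha)
  have h2 := one_sub_mul_exp_neg_pos (z := c) (by linarith) (Set.mem_Ici.1 hb)
  have h3 : Real.exp (-b) ≤ Real.exp (-a) := Real.exp_le_exp.2 (by linarith)
  rw [div_le_div_iff₀ h2 h1]
  nlinarith

lemma exp_div_nonneg {c v : ℝ} (hc : c ≤ 0) (hv : 0 ≤ v) :
    0 ≤ Real.exp (-v) / (1 - c * Real.exp (-v)) :=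
  div_nonneg (Real.exp_pos _).le (one_sub_mul_exp_neg_pos (by linarith) hv).le

/-- Laplace's method for `∫ exp (t (-c + i η)) / (c - i η; q)_∞ dη`, normalized to be `1` at
`η = 0`. The antiderivatives `P₁` and `P₂` encode the saddle point equation and the second
derivative `κ` of the phase. -/
theorem laplace_left {c u κ : ℝ} (hc : c ≤ 0) (hκ : 0 < κ) {P₁ P₂ : ℝ → ℝ} {L₁ L₂ : ℝ}
    (hP₁ : ∀ v, 0 ≤ v → HasDerivAt P₁ (Real.exp (-v) / (1 - c * Real.exp (-v))) v)
    (hP₂ : ∀ v, 0 ≤ v → HasDerivAt P₂ ((Real.exp (-v) / (1 - c * Real.exp (-v))) ^ 2) v)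
    (hL₁ : Tendsto P₁ atTop (𝓝 L₁)) (hL₂ : Tendsto P₂ atTop (𝓝 L₂))
    (hu : L₁ - P₁ 0 = u) (hk : L₂ - P₂ 0 = κ) :
    (∀ᶠ ε in 𝓝[>] (0 : ℝ), MeasureTheory.Integrable (fun η : ℝ =>
      Complex.exp ((u / ε * η : ℝ) * Complex.I) * (qPochInf c (Real.exp (-ε)) /
        qPochInf (c - η * Complex.I) (Real.exp (-ε))))) ∧
    (fun ε => (∫ η : ℝ, (Complex.exp ((u / ε * η : ℝ) * Complex.I) *
      (qPochInf c (Real.exp (-ε)) / qPochInf (c - η * Complex.I) (Real.exp (-ε)))).re) /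
        √(2 * Real.pi * ε / κ) - 1) =O[𝓝[>] 0] (fun ε : ℝ => ε) := by
  set D : ℝ → ℝ := fun v => Real.exp (-v) / (1 - c * Real.exp (-v)) with hD
  have hDanti : AntitoneOn D (Set.Ici 0) := antitoneOn_exp_div hc
  have hD0 : ∀ v, 0 ≤ v → 0 ≤ D v := fun v hv => exp_div_nonneg hc hv
  have hD2anti : AntitoneOn (fun v => D v ^ 2) (Set.Ici 0) := fun a ha b hb hab =>
    pow_le_pow_left₀ (hD0 b hb) (hDanti ha hb hab) 2
  set M := D 0 with hM
  have hM0 : 0 ≤ M := hD0 0 le_rfl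
  set C := (M ^ 2 + 1) + (M + 1) + (M ^ 2 + M) * (κ + (M ^ 2 + 1)) with hC
  have hC0 : 0 ≤ C := by positivity
  set G : ℝ → ℝ → ℂ := fun ε η => Complex.exp ((u / ε * η : ℝ) * Complex.I) *
    (qPochInf c (Real.exp (-ε)) / qPochInf (c - η * Complex.I) (Real.exp (-ε))) with hG
  set k := (D 1) ^ 2 with hkdef
  have hk0 : 0 < k := by
    have := one_sub_mul_exp_neg_pos (z := c) (by linarith) zero_le_one
    have h2 := Real.exp_pos (-1)
    positivity
  have hq : ∀ ε ∈ Set.Ioo (0 : ℝ) 1, 0 < Real.exp (-ε) ∧ Real.exp (-ε) < 1 := fun ε hε =>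
    ⟨Real.exp_pos _, by rw [Real.exp_lt_one_iff]; linarith [hε.1]⟩
  set R : ℝ → ℝ → ℕ → ℝ := fun ε η n =>
    -(∑ j ∈ Finset.range n, Real.log (1 + (η * D (ε * j)) ^ 2) / 2) with hR
  set Θ : ℝ → ℝ → ℕ → ℝ := fun ε η n =>
    u / ε * η - ∑ j ∈ Finset.range n, Real.arctan (η * D (ε * j)) with hΘ
  have hlim : ∀ ε ∈ Set.Ioo (0 : ℝ) 1, ∀ η : ℝ, Tendsto
      (fun n => Complex.exp ((R ε η n : ℝ) + (Θ ε η n : ℝ) * Complex.I)) atTop (𝓝 (G ε η)) := by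
    intro ε hε η
    obtain ⟨hq0, hq1⟩ := hq ε hε
    have hne : qPochInf (c - η * Complex.I) (Real.exp (-ε)) ≠ 0 :=
      qPochInf_ne_zero_of_re_nonpos hq0 hq1 (by simpa using hc)
    have h1 := ((tendsto_prod_qPochInf hq0 hq1 (c : ℂ)).div
      (tendsto_prod_qPochInf hq0 hq1 (c - η * Complex.I)) hne).const_mul
        (Complex.exp ((u / ε * η : ℝ) * Complex.I))
    refine h1.congr fun n => ?_
    have hfac : ∀ j : ℕ, (1 - (c : ℂ) * (Real.exp (-ε) : ℂ) ^ j) /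
        (1 - (c - η * Complex.I) * (Real.exp (-ε) : ℂ) ^ j) =
        ((1 + (η * D (ε * j) : ℝ) * Complex.I : ℂ))⁻¹ := by
      intro j
      have hpos := one_sub_mul_exp_neg_pos (z := c) (v := ε * j) (by linarith)
        (mul_nonneg hε.1.le (Nat.cast_nonneg j))
      have hposC : (1 - (c : ℂ) * (Real.exp (-(ε * j)) : ℝ)) ≠ 0 := by exact_mod_cast hpos.ne'
      rw [← Complex.ofReal_pow, exp_neg_pow]
      have e : (1 - (c - η * Complex.I) * (Real.exp (-(ε * j)) : ℝ) : ℂ) =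
          (1 - (c : ℂ) * (Real.exp (-(ε * j)) : ℝ)) * (1 + (η * D (ε * j) : ℝ) * Complex.I) := by
        have : (D (ε * j) : ℂ) * (1 - (c : ℂ) * (Real.exp (-(ε * j)) : ℝ)) =
            (Real.exp (-(ε * j)) : ℝ) := by
          simp only [hD]
          push_cast
          exact div_mul_cancel₀ _ (by exact_mod_cast hpos.ne')
        rw [Complex.ofReal_mul]
        linear_combination (-(η : ℂ) * Complex.I) * this
      rw [e, div_mul_eq_div_div, div_self hposC, one_div]
    simp only [Pi.div_apply, ← Finset.prod_div_distrib, hfac]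
    rw [prod_inv_one_add_mul_I, ← Complex.exp_add]
    congr 1
    simp only [hR, hΘ]
    push_cast
    ring
  have hS2 : ∀ ε ∈ Set.Ioo (0 : ℝ) 1, ∀ᶠ n : ℕ in atTop,
      |ε * ∑ j ∈ Finset.range n, D (ε * j) ^ 2 - κ| ≤ ε * (M ^ 2 + 1) := fun ε hε => by
    rw [← hk]
    exact eventually_riemann_sum_close hP₂ hD2anti (fun v _ => sq_nonneg _) hL₂ hε.1
  have hS1 : ∀ ε ∈ Set.Ioo (0 : ℝ) 1, ∀ᶠ n : ℕ in atTop,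
      |ε * ∑ j ∈ Finset.range n, D (ε * j) - u| ≤ ε * (M + 1) := fun ε hε => by
    rw [← hu]
    exact eventually_riemann_sum_close hP₁ hDanti hD0 hL₁ hε.1
  have hdj0 : ∀ ε ∈ Set.Ioo (0 : ℝ) 1, ∀ j : ℕ, 0 ≤ D (ε * j) := fun ε hε j =>
    hD0 _ (mul_nonneg hε.1.le (Nat.cast_nonneg j))
  have hdjM : ∀ ε ∈ Set.Ioo (0 : ℝ) 1, ∀ j : ℕ, D (ε * j) ≤ M := fun ε hε j => by
    have h := mul_nonneg hε.1.le (Nat.cast_nonneg j)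
    exact hDanti (Set.mem_Ici.2 le_rfl) h h
  have hsum2 : ∀ ε ∈ Set.Ioo (0 : ℝ) 1, ∀ n : ℕ,
      |ε * ∑ j ∈ Finset.range n, D (ε * j) ^ 2 - κ| ≤ ε * (M ^ 2 + 1) →
      ∑ j ∈ Finset.range n, D (ε * j) ^ 2 ≤ (κ + (M ^ 2 + 1)) / ε := by
    intro ε hε n h
    rw [le_div_iff₀ hε.1]
    have h1 := (abs_le.1 h).2
    nlinarith [hε.1, hε.2, sq_nonneg M]
  refine laplace_method (G := G) hκ (C := C + 2 * C ^ 2) (D := 1) (k := k) (p := 1 / 2) (ε₀ := 1)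
    (by positivity) zero_le_one hk0 (by norm_num) one_pos ?_ ?_ ?_
  · intro ε hε
    obtain ⟨hq0, hq1⟩ := hq ε hε
    refine Measurable.aestronglyMeasurable (Measurable.mul (by fun_prop)
      (measurable_const.div ?_))
    exact (measurable_qPochInf hq0 hq1).comp (by fun_prop)
  · intro ε hε τ
    have hε0 := hε.1
    refine gaussian_approx_of_log_bounds hC0 hε.1 (.of_forall fun n => rfl) (hlim ε hε τ) ?_ ?_
    · filter_upwards [hS2 ε hε] with n hn
      have h1 := abs_sum_log_sub_le (hdj0 ε hε) (hdjM ε hε) τ n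
      have h2 := hsum2 ε hε n hn
      have e : R ε τ n + κ * τ ^ 2 / (2 * ε) =
          -(∑ j ∈ Finset.range n, Real.log (1 + (τ * D (ε * j)) ^ 2) / 2 -
            τ ^ 2 / 2 * ∑ j ∈ Finset.range n, D (ε * j) ^ 2) -
          τ ^ 2 / (2 * ε) * (ε * ∑ j ∈ Finset.range n, D (ε * j) ^ 2 - κ) := by
        simp only [hR]; field_simp; ring
      rw [e]
      refine (abs_sub _ _).trans ?_
      rw [abs_neg, abs_mul, abs_of_nonneg (show 0 ≤ τ ^ 2 / (2 * ε) by positivity)]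
      calc _ ≤ τ ^ 4 * M ^ 2 * ((κ + (M ^ 2 + 1)) / ε) + τ ^ 2 / (2 * ε) * (ε * (M ^ 2 + 1)) :=
            add_le_add (h1.trans (mul_le_mul_of_nonneg_left h2 (by positivity)))
              (mul_le_mul_of_nonneg_left hn (by positivity))
        _ = (M ^ 2 + 1) / 2 * τ ^ 2 + M ^ 2 * (κ + (M ^ 2 + 1)) * (τ ^ 4 / ε) := by
            field_simp; ring
        _ ≤ C * τ ^ 2 + C * (τ ^ 4 / ε) := by
            have hA : 0 ≤ M * (κ + (M ^ 2 + 1)) := by positivity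
            have hB : 0 ≤ M ^ 2 * (κ + (M ^ 2 + 1)) := by positivity
            refine add_le_add (mul_le_mul_of_nonneg_right ?_ (by positivity))
              (mul_le_mul_of_nonneg_right ?_ (by positivity)) <;> rw [hC] <;>
              nlinarith [sq_nonneg M]
        _ = _ := by ring
    · filter_upwards [hS2 ε hε, hS1 ε hε] with n hn hn1
      have h1 := abs_sum_arctan_sub_le (hdj0 ε hε) (hdjM ε hε) τ n
      have h2 := hsum2 ε hε n hn
      have e : Θ ε τ n = -(∑ j ∈ Finset.range n, Real.arctan (τ * D (ε * j)) -
            τ * ∑ j ∈ Finset.range n, D (ε * j)) -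
          τ / ε * (ε * ∑ j ∈ Finset.range n, D (ε * j) - u) := by
        simp only [hΘ]; field_simp; ring
      rw [e]
      refine (abs_sub _ _).trans ?_
      rw [abs_neg, abs_mul, abs_div, abs_of_pos hε0]
      calc _ ≤ |τ| ^ 3 * M * ((κ + (M ^ 2 + 1)) / ε) + |τ| / ε * (ε * (M + 1)) :=
            add_le_add (h1.trans (mul_le_mul_of_nonneg_left h2 (by positivity)))
              (mul_le_mul_of_nonneg_left hn1 (by positivity))
        _ = (M + 1) * |τ| + M * (κ + (M ^ 2 + 1)) * (|τ| ^ 3 / ε) := by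
            field_simp; ring
        _ ≤ C * |τ| + C * (|τ| ^ 3 / ε) := by
            have hA : 0 ≤ M * (κ + (M ^ 2 + 1)) := by positivity
            have hB : 0 ≤ M ^ 2 * (κ + (M ^ 2 + 1)) := by positivity
            refine add_le_add (mul_le_mul_of_nonneg_right ?_ (by positivity))
              (mul_le_mul_of_nonneg_right ?_ (by positivity)) <;> rw [hC] <;>
              nlinarith [sq_nonneg M]
        _ = _ := by ring
  · intro ε hε τ
    rw [one_mul]
    refine le_of_tendsto (hlim ε hε τ).norm ?_
    -- At least `1 / ε` of the factors have `ε j ≤ 1`.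
    filter_upwards [eventually_ge_atTop (⌊1 / ε⌋₊ + 1)] with n hn
    have hpos : 0 < 1 + k * τ ^ 2 := by positivity
    have e : ‖Complex.exp ((R ε τ n : ℝ) + (Θ ε τ n : ℝ) * Complex.I)‖ = Real.exp (R ε τ n) := by
      rw [Complex.norm_exp]; simp
    rw [e, Real.rpow_def_of_pos hpos]
    refine Real.exp_le_exp.2 ?_
    have hlog0 : 0 ≤ Real.log (1 + k * τ ^ 2) :=
      Real.log_nonneg (by nlinarith [mul_nonneg hk0.le (sq_nonneg τ)])
    have h1 : ∑ j ∈ Finset.range (⌊1 / ε⌋₊ + 1), Real.log (1 + k * τ ^ 2) / 2 ≤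
        ∑ j ∈ Finset.range n, Real.log (1 + (τ * D (ε * j)) ^ 2) / 2 := by
      refine (Finset.sum_le_sum (fun j hj => ?_)).trans (Finset.sum_le_sum_of_subset_of_nonneg
        (Finset.range_mono hn) (fun j _ _ => ?_))
      · have hj1 : ε * j ≤ 1 := by
          have : (j : ℝ) ≤ 1 / ε := (Nat.cast_le.2 (Nat.lt_succ_iff.1 (Finset.mem_range.1 hj))).trans
            (Nat.floor_le (by have := hε.1; positivity))
          rw [le_div_iff₀ hε.1] at this
          linarith
        have hDj : D 1 ≤ D (ε * j) :=
          hDanti (mul_nonneg hε.1.le (Nat.cast_nonneg j)) (Set.mem_Ici.2 zero_le_one) hj1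
        have := pow_le_pow_left₀ (hD0 1 zero_le_one) hDj 2
        have h5 : Real.log (1 + k * τ ^ 2) ≤ Real.log (1 + (τ * D (ε * j)) ^ 2) := by
          refine Real.log_le_log hpos ?_
          rw [mul_pow]
          nlinarith [mul_le_mul_of_nonneg_right this (sq_nonneg τ)]
        linarith
      · have : 0 ≤ Real.log (1 + (τ * D (ε * j)) ^ 2) :=
          Real.log_nonneg (by nlinarith [sq_nonneg (τ * D (ε * j))])
        linarith
    rw [Finset.sum_const, Finset.card_range, nsmul_eq_mul] at h1
    have h2 : 1 / ε ≤ ((⌊1 / ε⌋₊ + 1 : ℕ) : ℝ) := by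
      push_cast; exact (Nat.lt_floor_add_one _).le
    have h3 := mul_le_mul_of_nonneg_right h2 (show 0 ≤ Real.log (1 + k * τ ^ 2) / 2 by linarith)
    have e2 : Real.log (1 + k * τ ^ 2) * -(1 / 2 / ε) = -(1 / ε * (Real.log (1 + k * τ ^ 2) / 2)) := by
      ring
    rw [e2]
    simp only [hR]
    linarith

/-! ### The saddle point to the right of the imaginary axis -/

/-- The estimates for the tails are proved by comparing derivatives in `τ`. -/
lemma nonneg_of_hasDerivAt_nonneg {f f' : ℝ → ℝ} (h0 : f 0 = 0)
    (hd : ∀ τ, 0 ≤ τ → HasDerivAt f (f' τ) τ) (hf' : ∀ τ, 0 ≤ τ → 0 ≤ f' τ) {τ : ℝ} (hτ : 0 ≤ τ) :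
    0 ≤ f τ := by
  have hm : MonotoneOn f (Set.Ici 0) := by
    refine monotoneOn_of_deriv_nonneg (convex_Ici 0)
      (fun x hx => (hd x hx).continuousAt.continuousWithinAt) (fun x hx => ?_) (fun x hx => ?_)
    · rw [interior_Ici] at hx
      exact (hd x hx.le).differentiableAt.differentiableWithinAt
    · rw [interior_Ici] at hx
      rw [(hd x hx.le).deriv]
      exact hf' x hx.le
  rw [← h0]
  exact hm (Set.mem_Ici.2 le_rfl) hτ hτ

/-- The integral `∫₀^τ arctan (s / a) ds`, in closed form. -/
noncomputable def arctanIntegral (a τ : ℝ) : ℝ :=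
  τ * Real.arctan (τ / a) - a / 2 * Real.log (1 + (τ / a) ^ 2)

lemma arctanIntegral_zero (a : ℝ) : arctanIntegral a 0 = 0 := by simp [arctanIntegral]

lemma hasDerivAt_arctanIntegral {a : ℝ} (ha : 0 < a) (τ : ℝ) :
    HasDerivAt (arctanIntegral a) (Real.arctan (τ / a)) τ := by
  have h1 : HasDerivAt (fun τ : ℝ => τ / a) (1 / a) τ := (hasDerivAt_id τ).div_const a
  have h2 := (hasDerivAt_id τ).mul h1.arctan
  have h3 : HasDerivAt (fun τ : ℝ => 1 + (τ / a) ^ 2) (2 * (τ / a) * (1 / a)) τ := by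
    simpa using (h1.pow 2).const_add 1
  have h4 := (h3.log (by positivity)).const_mul (a / 2)
  refine (h2.sub h4).congr_deriv ?_
  have : (1 : ℝ) + (τ / a) ^ 2 ≠ 0 := by positivity
  simp only [id, one_div]
  field_simp
  ring

lemma arctanIntegral_le_sq_div {a τ : ℝ} (ha : 0 < a) (hτ : 0 ≤ τ) :
    arctanIntegral a τ ≤ τ ^ 2 / a := by
  have h1 : 0 ≤ Real.log (1 + (τ / a) ^ 2) := Real.log_nonneg (by nlinarith [sq_nonneg (τ / a)])
  have h2 : Real.arctan (τ / a) ≤ τ / a := by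
    have := (le_abs_self _).trans (abs_arctan_le (τ / a))
    rwa [abs_of_nonneg (by positivity)] at this
  have h3 := mul_le_mul_of_nonneg_left h2 hτ
  rw [arctanIntegral]
  have e : τ * (τ / a) = τ ^ 2 / a := by ring
  nlinarith [mul_nonneg ha.le h1]

/-- The net decay of the integrand: `s` stands for the Gamma factor, `a` for the competing
`q`-shifted factorial, and `1 / s - 1 / a` will be the second derivative `κ` at the saddle point. -/
lemma arctanIntegral_sub_ge {s a τ : ℝ} (hs : 0 < s) (hsa : s ≤ a) (hτ : 0 ≤ τ) :
    (1 / s - 1 / a) * s ^ 2 / 2 * Real.log (1 + (τ / s) ^ 2) ≤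
      arctanIntegral s τ - arctanIntegral a τ := by
  have ha : 0 < a := hs.trans_le hsa
  have hd : ∀ τ, 0 ≤ τ → HasDerivAt (fun τ => arctanIntegral s τ - arctanIntegral a τ -
      (1 / s - 1 / a) * s ^ 2 / 2 * Real.log (1 + (τ / s) ^ 2))
      (Real.arctan (τ / s) - Real.arctan (τ / a) -
        (τ / s - τ / a) / (1 + (τ / s) ^ 2)) τ := by
    intro τ _
    have h1 : HasDerivAt (fun τ : ℝ => τ / s) (1 / s) τ := (hasDerivAt_id τ).div_const s
    have h3 : HasDerivAt (fun τ : ℝ => 1 + (τ / s) ^ 2) (2 * (τ / s) * (1 / s)) τ := by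
      simpa using (h1.pow 2).const_add 1
    have h4 := (h3.log (by positivity)).const_mul ((1 / s - 1 / a) * s ^ 2 / 2)
    refine (((hasDerivAt_arctanIntegral hs τ).sub (hasDerivAt_arctanIntegral ha τ)).sub
      h4).congr_deriv ?_
    have : (1 : ℝ) + (τ / s) ^ 2 ≠ 0 := by positivity
    congr 1
    field_simp
  have := nonneg_of_hasDerivAt_nonneg (by simp [arctanIntegral]) hd (fun τ hτ => by
    have := arctan_sub_arctan_ge (x := τ / a) (y := τ / s) (by positivity)
      (div_le_div_of_nonneg_left hτ hs hsa)
    linarith) hτ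
  linarith

/-- Bound for the modulus of the first `n` factors `1 / (1 + i τ / (s + ε j))`, which make up a
quotient of Gamma functions. -/
lemma arctanIntegral_le_sum_log {s ε τ : ℝ} (hs : 0 < s) (hε : 0 < ε) (hτ : 0 ≤ τ) (n : ℕ) :
    (arctanIntegral s τ - arctanIntegral (s + ε * n) τ) / ε ≤
      ∑ j ∈ Finset.range n, Real.log (1 + (τ * (1 / (s + ε * j))) ^ 2) / 2 := by
  have hsj : ∀ j : ℕ, 0 < s + ε * j := fun j => by positivity
  set f' : ℝ → ℝ := fun τ => ∑ j ∈ Finset.range n, τ / ((s + ε * j) ^ 2 + τ ^ 2) -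
    (Real.arctan (τ / s) - Real.arctan (τ / (s + ε * n))) / ε with hf'
  have hd : ∀ τ, 0 ≤ τ → HasDerivAt (fun τ =>
      ∑ j ∈ Finset.range n, Real.log (1 + (τ * (1 / (s + ε * j))) ^ 2) / 2 -
      (arctanIntegral s τ - arctanIntegral (s + ε * n) τ) / ε) (f' τ) τ := by
    intro τ _
    refine HasDerivAt.sub (HasDerivAt.fun_sum fun j _ => ?_)
      (((hasDerivAt_arctanIntegral hs τ).sub (hasDerivAt_arctanIntegral (hsj n) τ)).div_const ε)
    have h1 : HasDerivAt (fun τ : ℝ => 1 + (τ * (1 / (s + ε * j))) ^ 2)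
        (2 * (τ * (1 / (s + ε * j))) * (1 / (s + ε * j))) τ := by
      simpa using (((hasDerivAt_id τ).mul_const (1 / (s + ε * j))).pow 2).const_add 1
    have h2 := (h1.log (by positivity)).div_const 2
    refine h2.congr_deriv ?_
    have h3 := (hsj j).ne'
    have h4 : (s + ε * j) ^ 2 + τ ^ 2 ≠ 0 := by have := hsj j; positivity
    have h5 : (1 : ℝ) + (τ * (1 / (s + ε * j))) ^ 2 ≠ 0 := by positivity
    have h6 : (1 : ℝ) + (τ * (1 / (s + ε * j))) ^ 2 = ((s + ε * j) ^ 2 + τ ^ 2) / (s + ε * j) ^ 2 := by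
      field_simp
    rw [h6]
    field_simp
  have := nonneg_of_hasDerivAt_nonneg (by simp [arctanIntegral_zero]) hd (fun τ hτ => ?_) hτ
  · linarith
  · -- The summands telescope against `-arctan (τ / (s + v))`.
    have hP : ∀ v, 0 ≤ v → HasDerivAt (fun v => -Real.arctan (τ / (s + v)))
        (τ / ((s + v) ^ 2 + τ ^ 2)) v := by
      intro v hv
      have hsv : s + v ≠ 0 := by positivity
      have h1 : HasDerivAt (fun v : ℝ => τ / (s + v)) (-τ / (s + v) ^ 2) v := by
        have h2 := (hasDerivAt_const v τ).fun_div ((hasDerivAt_id' v).const_add s) hsv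
        exact h2.congr_deriv (by ring)
      refine h1.arctan.neg.congr_deriv ?_
      have h4 : (s + v) ^ 2 + τ ^ 2 ≠ 0 := by positivity
      have h5 : (1 : ℝ) + (τ / (s + v)) ^ 2 ≠ 0 := by positivity
      have h6 : (1 : ℝ) + (τ / (s + v)) ^ 2 = ((s + v) ^ 2 + τ ^ 2) / (s + v) ^ 2 := by
        field_simp
      rw [h6]
      field_simp
    have hF : AntitoneOn (fun v => τ / ((s + v) ^ 2 + τ ^ 2)) (Set.Ici 0) := by
      intro a ha b hb hab
      have ha' : 0 ≤ a := ha
      refine div_le_div_of_nonneg_left hτ (by positivity) ?_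
      nlinarith
    have h := (antitone_sum_bounds hP hF hε n).1
    simp only [add_zero] at h
    simp only [hf', sub_nonneg]
    rw [div_le_iff₀ hε]
    linarith

/-- The variance `b e^{-v} / (1 - b e^{-v})²` of the geometric distribution with ratio `b e^{-v}`. The
function `(1 - b e^{-v} e^{-iτ}) / (1 - b e^{-v})` has squared modulus
`1 + 2 (1 - cos τ) * geomVar b v`. -/
noncomputable def geomVar (b v : ℝ) : ℝ := b * Real.exp (-v) / (1 - b * Real.exp (-v)) ^ 2

lemma geomVar_nonneg {b v : ℝ} (hb : 0 < b) : 0 ≤ geomVar b v := by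
  unfold geomVar; have := Real.exp_pos (-v); positivity

lemma mul_exp_neg_anti {b a v : ℝ} (hb : 0 < b) (hav : a ≤ v) :
    b * Real.exp (-v) ≤ b * Real.exp (-a) :=
  mul_le_mul_of_nonneg_left (Real.exp_le_exp.2 (by linarith)) hb.le

lemma antitoneOn_geomVar {b : ℝ} (hb0 : 0 < b) (hb1 : b < 1) :
    AntitoneOn (geomVar b) (Set.Ici 0) := by
  intro a ha v hv hav
  have h1 := one_sub_mul_exp_neg_pos hb1 (Set.mem_Ici.1 ha)
  have h3 := mul_exp_neg_anti hb0 hav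
  have h4 := Real.exp_pos (-a)
  exact div_le_div₀ (by positivity) h3 (by positivity) (pow_le_pow_left₀ h1.le (by linarith) 2)

/-- Upper bound for the modulus of the product of the factors `1 - b q ^ j e^{-iτ}` with `j ≥ 1`;
the factor with `j = 0` is bounded and is left out, so that the sum is below the integral. -/
lemma sum_log_le_arctanIntegral {b ε τ : ℝ} (hb0 : 0 < b) (hb1 : b < 1) (hε : 0 < ε) (hτ : 0 ≤ τ)
    (n : ℕ) :
    ∑ j ∈ Finset.range n,
      Real.log (1 + 2 * (1 - Real.cos τ) * geomVar b (ε * (j + 1 : ℕ))) / 2 ≤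
      arctanIntegral ((1 - b) / b) τ / ε := by
  have ha : 0 < (1 - b) / b := div_pos (by linarith) hb0
  have hpos : ∀ (τ v : ℝ), 0 < 1 + 2 * (1 - Real.cos τ) * geomVar b v := fun τ v => by
    have := Real.cos_le_one τ
    have := geomVar_nonneg (v := v) hb0
    nlinarith [mul_nonneg (sub_nonneg.2 (Real.cos_le_one τ)) this]
  have hden : ∀ (τ v : ℝ), 0 ≤ v →
      0 < 1 - 2 * (b * Real.exp (-v)) * Real.cos τ + (b * Real.exp (-v)) ^ 2 := fun τ v hv => by
    have h1 := one_sub_mul_exp_neg_pos hb1 hv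
    have h2 : 0 < b * Real.exp (-v) := by have := Real.exp_pos (-v); positivity
    nlinarith [mul_nonneg h2.le (sub_nonneg.2 (Real.cos_le_one τ)), mul_pos h1 h1]
  set F : ℝ → ℝ → ℝ := fun τ v => b * Real.exp (-v) /
    (1 - 2 * (b * Real.exp (-v)) * Real.cos τ + (b * Real.exp (-v)) ^ 2) with hF
  have hd : ∀ τ, 0 ≤ τ → HasDerivAt (fun τ => arctanIntegral ((1 - b) / b) τ / ε -
      ∑ j ∈ Finset.range n,
        Real.log (1 + 2 * (1 - Real.cos τ) * geomVar b (ε * (j + 1 : ℕ))) / 2)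
      (Real.arctan (τ / ((1 - b) / b)) / ε -
        ∑ j ∈ Finset.range n, Real.sin τ * F τ (ε * (j + 1 : ℕ))) τ := by
    intro τ _
    refine HasDerivAt.sub ((hasDerivAt_arctanIntegral ha τ).div_const ε)
      (HasDerivAt.fun_sum fun j _ => ?_)
    set v := ε * ((j + 1 : ℕ) : ℝ) with hv
    have hv0 : 0 ≤ v := by positivity
    have h1 : HasDerivAt (fun τ : ℝ => 1 + 2 * (1 - Real.cos τ) * geomVar b v)
        (2 * Real.sin τ * geomVar b v) τ := by
      have := ((((Real.hasDerivAt_cos τ).const_sub 1).const_mul 2).mul_const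
        (geomVar b v)).const_add 1
      exact this.congr_deriv (by ring)
    refine ((h1.log (hpos τ v).ne').div_const 2).congr_deriv ?_
    have h2 := (one_sub_mul_exp_neg_pos hb1 hv0).ne'
    have h3 := (hden τ v hv0).ne'
    have h4 := (hpos τ v).ne'
    have h5 : 1 + 2 * (1 - Real.cos τ) * geomVar b v =
        (1 - 2 * (b * Real.exp (-v)) * Real.cos τ + (b * Real.exp (-v)) ^ 2) /
          (1 - b * Real.exp (-v)) ^ 2 := by
      simp only [geomVar]
      field_simp
      ring
    rw [h5]
    simp only [hF, geomVar]
    field_simp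
  have := nonneg_of_hasDerivAt_nonneg (by simp [arctanIntegral_zero]) hd (fun τ hτ => ?_) hτ
  · linarith
  · set s := |Real.sin τ| with hs
    have hs0 : 0 ≤ s := abs_nonneg _
    have hF0 : ∀ v, 0 ≤ v → 0 ≤ F τ v := fun v hv => by
      have := hden τ v hv
      have := Real.exp_pos (-v)
      simp only [hF]
      positivity
    have hcos : ∀ v, 0 ≤ v → 0 < 1 - b * Real.exp (-v) * Real.cos τ := fun v hv => by
      have h1 := one_sub_mul_exp_neg_pos hb1 hv
      have h2 : 0 < b * Real.exp (-v) := by have := Real.exp_pos (-v); positivity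
      nlinarith [mul_nonneg h2.le (sub_nonneg.2 (Real.cos_le_one τ))]
    have hP : ∀ v, 0 ≤ v → HasDerivAt
        (fun v => -Real.arctan (b * Real.exp (-v) * s / (1 - b * Real.exp (-v) * Real.cos τ)))
        (s * F τ v) v := by
      intro v hv
      have hexp : HasDerivAt (fun v : ℝ => b * Real.exp (-v)) (-(b * Real.exp (-v))) v := by
        have := ((hasDerivAt_neg v).exp).const_mul b
        exact this.congr_deriv (by ring)
      have h1 := (hexp.mul_const s).fun_div ((hexp.mul_const (Real.cos τ)).const_sub 1)
        (hcos v hv).ne'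
      refine h1.arctan.neg.congr_deriv ?_
      have hsq : s ^ 2 + Real.cos τ ^ 2 = 1 := by rw [hs, sq_abs, Real.sin_sq_add_cos_sq]
      set β := b * Real.exp (-v) with hβ
      have h2 := (hcos v hv).ne'
      have h3 := (hden τ v hv).ne'
      rw [← hβ] at h2 h3
      have h4 : 1 + (β * s / (1 - β * Real.cos τ)) ^ 2 =
          (1 - 2 * β * Real.cos τ + β ^ 2) / (1 - β * Real.cos τ) ^ 2 := by
        field_simp
        linear_combination β ^ 2 * hsq
      rw [h4]
      simp only [hF]
      rw [← hβ]
      field_simp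
      ring
    have hanti : AntitoneOn (fun v => s * F τ v) (Set.Ici 0) := by
      intro x hx y hy hxy
      refine mul_le_mul_of_nonneg_left ?_ hs0
      simp only [hF]
      rw [div_le_div_iff₀ (hden τ y hy) (hden τ x hx)]
      have h1 := one_sub_mul_exp_neg_pos hb1 (Set.mem_Ici.1 hx)
      have h2 := one_sub_mul_exp_neg_pos hb1 (Set.mem_Ici.1 hy)
      have h3 := mul_exp_neg_anti hb0 hxy
      have h4 : 0 < b * Real.exp (-y) := by have := Real.exp_pos (-y); positivity
      have h5 : 0 < b * Real.exp (-x) := by have := Real.exp_pos (-x); positivity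
      have h6 : b * Real.exp (-x) * (b * Real.exp (-y)) ≤ 1 := by nlinarith
      nlinarith [mul_nonneg (sub_nonneg.2 h3) (sub_nonneg.2 h6)]
    have htel : ε * ∑ j ∈ Finset.range n, s * F τ (ε * (j + 1 : ℕ)) ≤
        Real.arctan (τ / ((1 - b) / b)) := by
      have h1 := (antitone_sum_bounds hP hanti hε n).2
      have h2 : ∑ j ∈ Finset.range n, s * F τ (ε * (j + 1 : ℕ)) =
          ∑ j ∈ Finset.range n, s * F τ (ε * j) - s * F τ 0 + s * F τ (ε * n) := by
        have h3 := Finset.sum_range_succ (fun j : ℕ => s * F τ (ε * j)) n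
        have h4 := Finset.sum_range_succ' (fun j : ℕ => s * F τ (ε * j)) n
        simp only [Nat.cast_zero, mul_zero] at h4
        linarith
      have h5 : 0 ≤ Real.arctan (b * Real.exp (-(ε * n)) * s /
          (1 - b * Real.exp (-(ε * n)) * Real.cos τ)) := by
        refine Real.arctan_nonneg.2 (div_nonneg ?_ (hcos _ (by positivity)).le)
        have := Real.exp_pos (-(ε * n))
        positivity
      have h6 : Real.arctan (b * Real.exp (-0) * s / (1 - b * Real.exp (-0) * Real.cos τ)) ≤
          Real.arctan (τ / ((1 - b) / b)) := by
        refine Real.arctan_mono ?_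
        have h7 := hcos 0 le_rfl
        simp only [neg_zero, Real.exp_zero, mul_one] at h7 ⊢
        have h8 : s ≤ τ := by
          have := Real.abs_sin_le_abs (x := τ)
          rwa [abs_of_nonneg hτ] at this
        have h9 : τ / ((1 - b) / b) = b * τ / (1 - b) := by field_simp
        rw [h9]
        refine div_le_div₀ (by positivity) (mul_le_mul_of_nonneg_left h8 hb0.le) (by linarith) ?_
        nlinarith [Real.cos_le_one τ]
      rw [h2]
      linarith
    rw [sub_nonneg, le_div_iff₀ hε, mul_comm]
    refine le_trans (mul_le_mul_of_nonneg_left (Finset.sum_le_sum fun j _ => ?_) hε.le) htel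
    exact mul_le_mul_of_nonneg_right (le_abs_self _) (hF0 _ (by positivity))

/-- The mean `b e^{-v} / (1 - b e^{-v})` of the geometric distribution with ratio `b e^{-v}`;
its variance is `geomVar b v`. -/
noncomputable def geomMean (b v : ℝ) : ℝ := b * Real.exp (-v) / (1 - b * Real.exp (-v))

lemma geomMean_nonneg {b v : ℝ} (hb0 : 0 < b) (hb1 : b < 1) (hv : 0 ≤ v) : 0 ≤ geomMean b v := by
  have := one_sub_mul_exp_neg_pos hb1 hv
  unfold geomMean
  have := Real.exp_pos (-v)
  positivity

lemma geomVar_eq {b v : ℝ} (hb1 : b < 1) (hv : 0 ≤ v) :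
    geomVar b v = geomMean b v + geomMean b v ^ 2 := by
  have := (one_sub_mul_exp_neg_pos hb1 hv).ne'
  unfold geomVar geomMean
  field_simp
  ring

lemma antitoneOn_geomMean {b : ℝ} (hb0 : 0 < b) (hb1 : b < 1) :
    AntitoneOn (geomMean b) (Set.Ici 0) := by
  intro a ha v hv hav
  have h1 := one_sub_mul_exp_neg_pos hb1 (Set.mem_Ici.1 ha)
  have h3 := mul_exp_neg_anti hb0 hav
  have h4 := Real.exp_pos (-a)
  exact div_le_div₀ (by positivity) h3 (by positivity) (by linarith)

lemma hasDerivAt_log_one_sub_mul_exp {b v : ℝ} (hb1 : b < 1) (hv : 0 ≤ v) :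
    HasDerivAt (fun v => Real.log (1 - b * Real.exp (-v))) (geomMean b v) v := by
  have h0 := (one_sub_mul_exp_neg_pos hb1 hv).ne'
  have h1 := (((hasDerivAt_neg v).exp).const_mul b).const_sub 1
  refine (h1.log h0).congr_deriv ?_
  unfold geomMean
  ring

lemma hasDerivAt_neg_inv_one_sub_mul_exp {b v : ℝ} (hb1 : b < 1) (hv : 0 ≤ v) :
    HasDerivAt (fun v => -(1 - b * Real.exp (-v))⁻¹) (geomVar b v) v := by
  have h0 := (one_sub_mul_exp_neg_pos hb1 hv).ne'
  have h1 := (((hasDerivAt_neg v).exp).const_mul b).const_sub 1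
  refine (h1.fun_inv h0).neg.congr_deriv ?_
  unfold geomVar
  ring

lemma tendsto_one_sub_mul_exp_neg (b : ℝ) :
    Tendsto (fun v => 1 - b * Real.exp (-v)) atTop (𝓝 1) := by
  have := (Real.tendsto_exp_neg_atTop_nhds_zero.const_mul b).const_sub 1
  simpa using this

/-- With `m = geomMean b v` the left-hand side is `(1 - b e^{-v} e^{-iτ}) / (1 - b e^{-v})`. -/
lemma geomFactor_polar {m : ℝ} (hm : 0 ≤ m) (τ : ℝ) :
    (1 + m * (1 - Complex.exp (-(τ * Complex.I))) : ℂ) =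
      Complex.exp ((Real.log (1 + 2 * (1 - Real.cos τ) * (m + m ^ 2)) / 2 : ℝ) +
        (Real.arctan (m * Real.sin τ / (1 + m * (1 - Real.cos τ))) : ℝ) * Complex.I) := by
  have h1 : 0 < 1 + m * (1 - Real.cos τ) := by
    have := mul_nonneg hm (sub_nonneg.2 (Real.cos_le_one τ)); linarith
  have h2 := polar_of_re_pos h1 (m * Real.sin τ)
  have e : (1 + m * (1 - Real.cos τ)) ^ 2 + (m * Real.sin τ) ^ 2 =
      1 + 2 * (1 - Real.cos τ) * (m + m ^ 2) := by
    linear_combination m ^ 2 * Real.sin_sq_add_cos_sq τ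
  rw [e] at h2
  rw [← h2, ← neg_mul, Complex.exp_mul_I, Complex.cos_neg, Complex.sin_neg]
  push_cast
  ring

lemma two_mul_one_sub_cos_le_sq (τ : ℝ) : 2 * (1 - Real.cos τ) ≤ τ ^ 2 := by
  have := Real.one_sub_sq_div_two_le_cos (x := τ)
  linarith

lemma abs_sum_log_cos_sub_le {V : ℕ → ℝ} {M : ℝ} (hV0 : ∀ j, 0 ≤ V j) (hVM : ∀ j, V j ≤ M)
    (τ : ℝ) (n : ℕ) :
    |∑ j ∈ Finset.range n, Real.log (1 + 2 * (1 - Real.cos τ) * V j) / 2 -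
      τ ^ 2 / 2 * ∑ j ∈ Finset.range n, V j| ≤ τ ^ 4 * (M + 1) * ∑ j ∈ Finset.range n, V j := by
  rw [Finset.mul_sum, Finset.mul_sum, ← Finset.sum_sub_distrib]
  refine (Finset.abs_sum_le_sum_abs _ _).trans (Finset.sum_le_sum fun j _ => ?_)
  have hc := two_mul_one_sub_cos_le_sq τ
  have hc0 := Real.cos_le_one τ
  have hV := hV0 j
  have hy : 0 ≤ 2 * (1 - Real.cos τ) * V j := mul_nonneg (by linarith) hV
  have h1 := abs_log_one_add_sub_self_le hy
  have h2 := abs_one_sub_cos_sub_le τ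
  have e : Real.log (1 + 2 * (1 - Real.cos τ) * V j) / 2 - τ ^ 2 / 2 * V j =
      (Real.log (1 + 2 * (1 - Real.cos τ) * V j) - 2 * (1 - Real.cos τ) * V j) / 2 +
        (1 - Real.cos τ - τ ^ 2 / 2) * V j := by ring
  rw [e]
  refine (abs_add_le _ _).trans ?_
  rw [abs_div, abs_two, abs_mul, abs_of_nonneg hV]
  have h3 : (2 * (1 - Real.cos τ) * V j) ^ 2 ≤ τ ^ 4 * (V j * M) := by
    have h4 : (2 * (1 - Real.cos τ)) ^ 2 ≤ (τ ^ 2) ^ 2 := pow_le_pow_left₀ (by linarith) hc 2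
    have h5 : V j ^ 2 ≤ V j * M := by
      rw [sq]; exact mul_le_mul_of_nonneg_left (hVM j) hV
    calc _ = (2 * (1 - Real.cos τ)) ^ 2 * V j ^ 2 := by ring
      _ ≤ (τ ^ 2) ^ 2 * (V j * M) := mul_le_mul h4 h5 (by positivity) (by positivity)
      _ = _ := by ring
  have h6 := mul_le_mul_of_nonneg_right h2 hV
  have h7 : 0 ≤ τ ^ 4 * (V j * M) := by
    have := hV.trans (hVM j); positivity
  have h8 : 0 ≤ τ ^ 4 * V j := by positivity
  nlinarith

lemma abs_sum_arg_sub_le {m : ℕ → ℝ} {M : ℝ} (hm0 : ∀ j, 0 ≤ m j) (hmM : ∀ j, m j ≤ M)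
    (τ : ℝ) (n : ℕ) :
    |∑ j ∈ Finset.range n, Real.arctan (m j * Real.sin τ / (1 + m j * (1 - Real.cos τ))) -
      τ * ∑ j ∈ Finset.range n, m j| ≤
      |τ| ^ 3 * (M ^ 2 + M + 2) * ∑ j ∈ Finset.range n, m j := by
  rw [Finset.mul_sum, Finset.mul_sum, ← Finset.sum_sub_distrib]
  refine (Finset.abs_sum_le_sum_abs _ _).trans (Finset.sum_le_sum fun j _ => ?_)
  have hc := two_mul_one_sub_cos_le_sq τ
  have hc0 := Real.cos_le_one τ
  have hm := hm0 j
  have hM : 0 ≤ M := hm.trans (hmM j)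
  set a := m j with ha
  have hden : 1 ≤ 1 + a * (1 - Real.cos τ) := by
    have := mul_nonneg hm (sub_nonneg.2 hc0); linarith
  have hden0 : 0 < 1 + a * (1 - Real.cos τ) := by linarith
  have hsin : |Real.sin τ| ≤ |τ| := Real.abs_sin_le_abs
  set w := a * Real.sin τ / (1 + a * (1 - Real.cos τ)) with hw
  have hw1 : |w| ≤ a * |τ| := by
    rw [hw, abs_div, abs_mul, abs_of_nonneg hm, abs_of_pos hden0]
    exact (div_le_self (by positivity) hden).trans (mul_le_mul_of_nonneg_left hsin hm)
  have h1 : |Real.arctan w - w| ≤ |τ| ^ 3 * M ^ 2 * a := by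
    refine (abs_arctan_sub_self_le w).trans ((pow_le_pow_left₀ (abs_nonneg _) hw1 3).trans ?_)
    have : a ^ 2 ≤ M ^ 2 := pow_le_pow_left₀ hm (hmM j) 2
    calc (a * |τ|) ^ 3 = |τ| ^ 3 * a ^ 2 * a := by ring
      _ ≤ _ := by gcongr
  have h2 : |w - a * Real.sin τ| ≤ |τ| ^ 3 * M * a := by
    have e : w - a * Real.sin τ = -(w * (a * (1 - Real.cos τ))) := by
      rw [hw]; field_simp; ring
    rw [e, abs_neg, abs_mul, abs_of_nonneg (mul_nonneg hm (sub_nonneg.2 hc0))]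
    have h3 : 1 - Real.cos τ ≤ |τ| ^ 2 := by
      rw [sq_abs]; nlinarith [sq_nonneg τ]
    calc |w| * (a * (1 - Real.cos τ)) ≤ (a * |τ|) * (M * |τ| ^ 2) := by
          refine mul_le_mul hw1 (mul_le_mul (hmM j) h3 (sub_nonneg.2 hc0) hM)
            (mul_nonneg hm (sub_nonneg.2 hc0)) (by positivity)
      _ = _ := by ring
  have h3 : |a * Real.sin τ - τ * a| ≤ |τ| ^ 3 * 2 * a := by
    have e : a * Real.sin τ - τ * a = a * (Real.sin τ - τ) := by ring
    rw [e, abs_mul, abs_of_nonneg hm]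
    have := mul_le_mul_of_nonneg_left (abs_sin_sub_self_le τ) hm
    linarith
  have e : Real.arctan w - τ * a =
      (Real.arctan w - w) + (w - a * Real.sin τ) + (a * Real.sin τ - τ * a) := by ring
  rw [e]
  have := abs_add_three (Real.arctan w - w) (w - a * Real.sin τ) (a * Real.sin τ - τ * a)
  linarith

/-- Euler's limit formula, for the quotient of the values of `Γ` at two points with the same
real part. -/
lemma tendsto_Gamma_div_Gamma {σ ε : ℝ} (hσ : 0 < σ) (hε : 0 < ε) (τ : ℝ) :
    Tendsto (fun n : ℕ => Complex.exp ((τ / ε * Real.log n : ℝ) * Complex.I) *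
      ∏ j ∈ Finset.range (n + 1), ((1 + (τ * (1 / (σ + ε * j)) : ℝ) * Complex.I : ℂ))⁻¹) atTop
      (𝓝 (Complex.Gamma ((σ / ε : ℝ) + (τ / ε : ℝ) * Complex.I) / Complex.Gamma (σ / ε : ℝ))) := by
  have hne : Complex.Gamma (σ / ε : ℝ) ≠ 0 :=
    Complex.Gamma_ne_zero_of_re_pos (by rw [Complex.ofReal_re]; positivity)
  refine ((Complex.GammaSeq_tendsto_Gamma _).div (Complex.GammaSeq_tendsto_Gamma _) hne).congr' ?_
  filter_upwards [eventually_ge_atTop 1] with n hn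
  have hn0 : (n : ℂ) ≠ 0 := by exact_mod_cast (by omega : n ≠ 0)
  have hfac : (n.factorial : ℂ) ≠ 0 := by exact_mod_cast n.factorial_ne_zero
  simp only [Pi.div_apply, Complex.GammaSeq]
  have hprod : ∏ j ∈ Finset.range (n + 1), (((σ / ε : ℝ) : ℂ) + (j : ℂ)) ≠ 0 :=
    Finset.prod_ne_zero_iff.2 fun j _ => by
      have : (0 : ℝ) < σ / ε + j := by positivity
      exact_mod_cast this.ne'
  have hcp : ((n : ℂ) ^ ((σ / ε : ℝ) : ℂ)) ≠ 0 := by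
    rw [Complex.cpow_def_of_ne_zero hn0]; exact Complex.exp_ne_zero _
  have e1 : ∏ j ∈ Finset.range (n + 1), (((σ / ε : ℝ) : ℂ) + (τ / ε : ℝ) * Complex.I + (j : ℂ)) =
      (∏ j ∈ Finset.range (n + 1), (((σ / ε : ℝ) : ℂ) + (j : ℂ))) *
        ∏ j ∈ Finset.range (n + 1), (1 + (τ * (1 / (σ + ε * j)) : ℝ) * Complex.I : ℂ) := by
    rw [← Finset.prod_mul_distrib]
    refine Finset.prod_congr rfl fun j _ => ?_
    have h1 : (0 : ℝ) < σ + ε * j := by positivity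
    have h2 : ((σ : ℂ) + ε * j) ≠ 0 := by exact_mod_cast h1.ne'
    have h3 : (ε : ℂ) ≠ 0 := by exact_mod_cast hε.ne'
    push_cast
    field_simp
    ring
  have e2 : (n : ℂ) ^ (((σ / ε : ℝ) : ℂ) + (τ / ε : ℝ) * Complex.I) =
      (n : ℂ) ^ ((σ / ε : ℝ) : ℂ) * Complex.exp ((τ / ε * Real.log n : ℝ) * Complex.I) := by
    rw [Complex.cpow_add _ _ hn0, Complex.cpow_def_of_ne_zero hn0 ((τ / ε : ℝ) * Complex.I),
      ← Complex.natCast_log]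
    congr 2
    push_cast
    ring
  rw [e1, e2, Finset.prod_inv_distrib]
  have hprod2 : ∏ j ∈ Finset.range (n + 1), (1 + (τ * (1 / (σ + ε * j)) : ℝ) * Complex.I : ℂ) ≠ 0 :=
    Finset.prod_ne_zero_iff.2 fun j _ h => by
      have := congrArg Complex.re h
      simp at this
  field_simp

lemma tendsto_log_mul_sub_log_add {σ ε : ℝ} (hσ : 0 < σ) (hε : 0 < ε) :
    Tendsto (fun n : ℕ => Real.log (ε * n) - Real.log (σ + ε * (n + 1 : ℕ))) atTop (𝓝 0) := by
  have h1 : Tendsto (fun n : ℕ => 1 + (σ + ε) / (ε * n)) atTop (𝓝 (1 + 0)) :=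
    (tendsto_const_nhds.div_atTop (tendsto_const_mul_natCast_atTop hε)).const_add 1
  have h2 := ((Real.continuousAt_log (show (1 + 0 : ℝ) ≠ 0 by norm_num)).tendsto.comp h1).neg
  simp only [add_zero, Real.log_one, neg_zero] at h2
  refine h2.congr' ?_
  filter_upwards [eventually_ge_atTop 1] with n hn
  have hn0 : (0 : ℝ) < n := by exact_mod_cast hn
  rw [← Real.log_div (by positivity) (by positivity), Function.comp, ← Real.log_inv]
  congr 1
  push_cast
  field_simp
  ring

lemma le_div_of_abs_mul_sub_le {S L c ε : ℝ} (hε0 : 0 < ε) (hε1 : ε ≤ 1) (hc : 0 ≤ c)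
    (h : |ε * S - L| ≤ ε * c) : S ≤ (L + c) / ε := by
  rw [le_div_iff₀ hε0]
  have h1 := (abs_le.1 h).2
  have h2 := mul_le_mul_of_nonneg_right hε1 hc
  linarith

/-- Laplace's method for the Mellin–Barnes integral, normalized to be `1` at `τ = 0`. The
saddle point equation is the relation `σ = u (1 - b)`, and `κ` is the second derivative of the
phase. -/
theorem laplace_right {u b σ κ : ℝ} (hu : 0 < u) (hb0 : 0 < b) (hb1 : b < 1)
    (hσ : σ = u * (1 - b)) (hκ0 : 0 < κ) (hκ : κ = 1 / σ - b / (1 - b)) :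
    (∀ᶠ ε in 𝓝[>] (0 : ℝ), MeasureTheory.Integrable (fun τ : ℝ =>
      Complex.exp ((-(τ / ε * Real.log (u / ε)) : ℝ) * Complex.I) *
      (Complex.Gamma ((σ / ε : ℝ) + (τ / ε : ℝ) * Complex.I) / Complex.Gamma (σ / ε : ℝ)) *
      (qPochInf (b * Complex.exp (-(τ * Complex.I))) (Real.exp (-ε)) /
        qPochInf b (Real.exp (-ε))))) ∧
    (fun ε => (∫ τ : ℝ, (Complex.exp ((-(τ / ε * Real.log (u / ε)) : ℝ) * Complex.I) *
      (Complex.Gamma ((σ / ε : ℝ) + (τ / ε : ℝ) * Complex.I) / Complex.Gamma (σ / ε : ℝ)) *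
      (qPochInf (b * Complex.exp (-(τ * Complex.I))) (Real.exp (-ε)) /
        qPochInf b (Real.exp (-ε)))).re) /
        √(2 * Real.pi * ε / κ) - 1) =O[𝓝[>] 0] (fun ε : ℝ => ε) := by
  have hb1' : 0 < 1 - b := by linarith
  have hσ0 : 0 < σ := by rw [hσ]; positivity
  set m₀ := geomMean b 0 with hm₀
  set V₀ := geomVar b 0 with hV₀
  have hm₀0 : 0 ≤ m₀ := geomMean_nonneg hb0 hb1 le_rfl
  have hV₀0 : 0 ≤ V₀ := geomVar_nonneg hb0
  have hlogb : 0 ≤ -Real.log (1 - b) := by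
    have := Real.log_nonpos hb1'.le (by linarith); linarith
  set K₁ := 1 / σ + (1 / σ ^ 2 + 1) with hK₁
  set K₂ := b / (1 - b) + (V₀ + 1) with hK₂
  set K₃ := -Real.log (1 - b) + (m₀ + 1) with hK₃
  have hK₁0 : 0 < K₁ := by positivity
  have hK₂0 : 0 < K₂ := by positivity
  have hK₃0 : 0 < K₃ := by positivity
  set A₁ := (1 / σ ^ 2 + 1) / 2 + (V₀ + 1) / 2 with hA₁
  set B₁ := (1 / σ) ^ 2 * K₁ + (V₀ + 1) * K₂ with hB₁
  set A₂ := 1 + 1 / σ + (m₀ + 1) with hA₂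
  set B₂ := (1 / σ) * K₁ + (m₀ ^ 2 + m₀ + 2) * K₃ with hB₂
  have hA₁0 : 0 ≤ A₁ := by positivity
  have hB₁0 : 0 ≤ B₁ := by positivity
  have hA₂0 : 0 ≤ A₂ := by positivity
  have hB₂0 : 0 ≤ B₂ := by positivity
  set C := A₁ + B₁ + A₂ + B₂ with hC
  have hC0 : 0 ≤ C := by positivity
  set G : ℝ → ℝ → ℂ := fun ε τ => Complex.exp ((-(τ / ε * Real.log (u / ε)) : ℝ) * Complex.I) *
      (Complex.Gamma ((σ / ε : ℝ) + (τ / ε : ℝ) * Complex.I) / Complex.Gamma (σ / ε : ℝ)) *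
      (qPochInf (b * Complex.exp (-(τ * Complex.I))) (Real.exp (-ε)) /
        qPochInf b (Real.exp (-ε))) with hG
  have hq : ∀ ε ∈ Set.Ioo (0 : ℝ) 1, 0 < Real.exp (-ε) ∧ Real.exp (-ε) < 1 := fun ε hε =>
    ⟨Real.exp_pos _, by rw [Real.exp_lt_one_iff]; linarith [hε.1]⟩
  set d : ℝ → ℕ → ℝ := fun ε j => 1 / (σ + ε * j) with hd
  set V : ℝ → ℕ → ℝ := fun ε j => geomVar b (ε * j) with hV
  set m : ℝ → ℕ → ℝ := fun ε j => geomMean b (ε * j) with hm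
  have hεj : ∀ ε ∈ Set.Ioo (0 : ℝ) 1, ∀ j : ℕ, 0 ≤ ε * j := fun ε hε j =>
    mul_nonneg hε.1.le (Nat.cast_nonneg j)
  have hd0 : ∀ ε ∈ Set.Ioo (0 : ℝ) 1, ∀ j : ℕ, 0 ≤ d ε j := fun ε hε j => by
    have := hεj ε hε j
    simp only [hd]; positivity
  have hdM : ∀ ε ∈ Set.Ioo (0 : ℝ) 1, ∀ j : ℕ, d ε j ≤ 1 / σ := fun ε hε j => by
    have := hεj ε hε j
    exact one_div_le_one_div_of_le hσ0 (by linarith)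
  have hV0 : ∀ ε ∈ Set.Ioo (0 : ℝ) 1, ∀ j : ℕ, 0 ≤ V ε j := fun ε hε j => geomVar_nonneg hb0
  have hVM : ∀ ε ∈ Set.Ioo (0 : ℝ) 1, ∀ j : ℕ, V ε j ≤ V₀ := fun ε hε j =>
    antitoneOn_geomVar hb0 hb1 (Set.mem_Ici.2 le_rfl) (hεj ε hε j) (hεj ε hε j)
  have hm0 : ∀ ε ∈ Set.Ioo (0 : ℝ) 1, ∀ j : ℕ, 0 ≤ m ε j := fun ε hε j =>
    geomMean_nonneg hb0 hb1 (hεj ε hε j)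
  have hmM : ∀ ε ∈ Set.Ioo (0 : ℝ) 1, ∀ j : ℕ, m ε j ≤ m₀ := fun ε hε j =>
    antitoneOn_geomMean hb0 hb1 (Set.mem_Ici.2 le_rfl) (hεj ε hε j) (hεj ε hε j)
  set R : ℝ → ℝ → ℕ → ℝ := fun ε τ n =>
    -(∑ j ∈ Finset.range (n + 1), Real.log (1 + (τ * d ε j) ^ 2) / 2) +
      ∑ j ∈ Finset.range n, Real.log (1 + 2 * (1 - Real.cos τ) * V ε j) / 2 with hR
  set Θ : ℝ → ℝ → ℕ → ℝ := fun ε τ n =>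
    τ / ε * (Real.log n - Real.log (u / ε)) -
      ∑ j ∈ Finset.range (n + 1), Real.arctan (τ * d ε j) +
      ∑ j ∈ Finset.range n,
        Real.arctan (m ε j * Real.sin τ / (1 + m ε j * (1 - Real.cos τ))) with hΘ
  have hlim : ∀ ε ∈ Set.Ioo (0 : ℝ) 1, ∀ τ : ℝ, Tendsto
      (fun n => Complex.exp ((R ε τ n : ℝ) + (Θ ε τ n : ℝ) * Complex.I)) atTop (𝓝 (G ε τ)) := by
    intro ε hε τ
    obtain ⟨hq0, hq1⟩ := hq ε hε
    have hne : qPochInf b (Real.exp (-ε)) ≠ 0 := by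
      obtain ⟨δ, -, h⟩ := qPochInf_asymptotics hb1 hε.1
      rw [h]
      have : 0 < Real.exp (-(dilog b / ε)) * √(1 - b) * Real.exp δ := by positivity
      exact_mod_cast this.ne'
    have h1 := (((tendsto_Gamma_div_Gamma hσ0 hε.1 τ).const_mul
      (Complex.exp ((-(τ / ε * Real.log (u / ε)) : ℝ) * Complex.I))).mul
      ((tendsto_prod_qPochInf hq0 hq1 (b * Complex.exp (-(τ * Complex.I)))).div
      (tendsto_prod_qPochInf hq0 hq1 (b : ℂ)) hne))
    refine h1.congr fun n => ?_
    have hfac : ∀ j : ℕ,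
        (1 - (b * Complex.exp (-(τ * Complex.I)) : ℂ) * (Real.exp (-ε) : ℂ) ^ j) /
        (1 - (b : ℂ) * (Real.exp (-ε) : ℂ) ^ j) =
        Complex.exp ((Real.log (1 + 2 * (1 - Real.cos τ) * V ε j) / 2 : ℝ) +
        (Real.arctan (m ε j * Real.sin τ / (1 + m ε j * (1 - Real.cos τ))) : ℝ) * Complex.I) := by
      intro j
      simp only [hV, hm]
      rw [geomVar_eq hb1 (hεj ε hε j), ← geomFactor_polar (hm0 ε hε j)]
      have hpos := one_sub_mul_exp_neg_pos hb1 (hεj ε hε j)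
      have hposC : (1 - (b : ℂ) * (Real.exp (-(ε * j)) : ℝ)) ≠ 0 := by exact_mod_cast hpos.ne'
      have hmC : (geomMean b (ε * j) : ℂ) * (1 - (b : ℂ) * (Real.exp (-(ε * j)) : ℝ)) =
          b * (Real.exp (-(ε * j)) : ℝ) := by
        have : geomMean b (ε * j) * (1 - b * Real.exp (-(ε * j))) = b * Real.exp (-(ε * j)) :=
          div_mul_cancel₀ _ hpos.ne'
        exact_mod_cast this
      rw [← Complex.ofReal_pow, exp_neg_pow, div_eq_iff hposC]
      linear_combination (Complex.exp (-(τ * Complex.I)) - 1) * hmC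
    simp only [Pi.div_apply, ← Finset.prod_div_distrib, hfac]
    rw [prod_inv_one_add_mul_I, ← Complex.exp_sum, ← Complex.exp_add, ← Complex.exp_add,
      ← Complex.exp_add]
    congr 1
    rw [Finset.sum_add_distrib, ← Finset.sum_mul]
    simp only [hR, hΘ, hd]
    push_cast
    ring
  have hS1 : ∀ ε ∈ Set.Ioo (0 : ℝ) 1, ∀ᶠ n : ℕ in atTop,
      |ε * ∑ j ∈ Finset.range (n + 1), d ε j ^ 2 - 1 / σ| ≤ ε * (1 / σ ^ 2 + 1) := fun ε hε => by
    have hP : ∀ v, 0 ≤ v → HasDerivAt (fun v => -(σ + v)⁻¹) (1 / (σ + v) ^ 2) v := by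
      intro v hv
      have hne : σ + v ≠ 0 := by positivity
      exact (((hasDerivAt_id' v).const_add σ).fun_inv hne).neg.congr_deriv (by ring)
    have hanti : AntitoneOn (fun v => 1 / (σ + v) ^ 2) (Set.Ici 0) := fun a ha v hv hav => by
      have ha' : 0 ≤ a := ha
      exact one_div_le_one_div_of_le (by positivity)
        (pow_le_pow_left₀ (by positivity) (by linarith) 2)
    have hL : Tendsto (fun v => -(σ + v)⁻¹) atTop (𝓝 (-0)) :=
      (tendsto_inv_atTop_zero.comp (tendsto_atTop_add_const_left _ σ tendsto_id)).neg
    have h := (tendsto_add_atTop_nat 1).eventually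
      (eventually_riemann_sum_close hP hanti (fun v _ => by positivity) hL hε.1)
    refine h.mono fun n hn => ?_
    simp only [add_zero, neg_zero, sub_neg_eq_add, zero_add] at hn
    simp only [hd, one_div, inv_pow] at hn ⊢
    exact hn
  have hS2 : ∀ ε ∈ Set.Ioo (0 : ℝ) 1, ∀ᶠ n : ℕ in atTop,
      |ε * ∑ j ∈ Finset.range n, V ε j - b / (1 - b)| ≤ ε * (V₀ + 1) := fun ε hε => by
    have hL := ((tendsto_one_sub_mul_exp_neg b).inv₀ one_ne_zero).neg
    have h := eventually_riemann_sum_close (fun v hv => hasDerivAt_neg_inv_one_sub_mul_exp hb1 hv)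
      (antitoneOn_geomVar hb0 hb1) (fun v _ => geomVar_nonneg hb0) hL hε.1
    have e : -(1 : ℝ)⁻¹ - -(1 - b * Real.exp (-0))⁻¹ = b / (1 - b) := by
      rw [neg_zero, Real.exp_zero, mul_one]; field_simp; ring
    rw [e] at h
    exact h
  have hS3 : ∀ ε ∈ Set.Ioo (0 : ℝ) 1, ∀ᶠ n : ℕ in atTop,
      |ε * ∑ j ∈ Finset.range n, m ε j - -Real.log (1 - b)| ≤ ε * (m₀ + 1) := fun ε hε => by
    have hL := (Real.continuousAt_log one_ne_zero).tendsto.comp (tendsto_one_sub_mul_exp_neg b)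
    have h := eventually_riemann_sum_close (fun v hv => hasDerivAt_log_one_sub_mul_exp hb1 hv)
      (antitoneOn_geomMean hb0 hb1) (fun v hv => geomMean_nonneg hb0 hb1 hv) hL hε.1
    have e : Real.log 1 - Real.log (1 - b * Real.exp (-0)) = -Real.log (1 - b) := by simp
    rw [e] at h
    exact h
  have hS4 : ∀ ε ∈ Set.Ioo (0 : ℝ) 1, ∀ n : ℕ,
      |ε * ∑ j ∈ Finset.range (n + 1), d ε j -
        (Real.log (σ + ε * (n + 1 : ℕ)) - Real.log σ)| ≤ ε * (1 / σ) := fun ε hε n => by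
    have hP : ∀ v, 0 ≤ v → HasDerivAt (fun v => Real.log (σ + v)) (1 / (σ + v)) v := by
      intro v hv
      have hne : σ + v ≠ 0 := by positivity
      exact ((hasDerivAt_id' v).const_add σ).log hne
    have hanti : AntitoneOn (fun v => 1 / (σ + v)) (Set.Ici 0) := fun a ha v hv hav => by
      have ha' : 0 ≤ a := ha
      exact one_div_le_one_div_of_le (by positivity) (by linarith)
    have h := antitone_sum_bounds hP hanti hε.1 (n + 1)
    simp only [add_zero] at h
    have hpos : 0 ≤ ε * (1 / (σ + ε * (n + 1 : ℕ))) := by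
      have := hε.1; positivity
    rw [mul_sub] at h
    have hpos2 : 0 ≤ ε * (1 / σ) := by have := hε.1; positivity
    rw [abs_le]
    constructor <;> linarith [h.1, h.2]
  refine laplace_method (G := G) hκ0 (C := C + 2 * C ^ 2) (D := Real.exp (2 * V₀))
    (k := 1 / σ ^ 2) (p := κ * σ ^ 2 / 2) (ε₀ := 1)
    (by positivity) (Real.exp_pos _).le (by positivity) (by positivity) one_pos ?_ ?_ ?_
  · intro ε hε
    have hε0 := hε.1
    obtain ⟨hq0, hq1⟩ := hq ε hε
    have hΓ : Continuous (fun τ : ℝ => Complex.Gamma ((σ / ε : ℝ) + (τ / ε : ℝ) * Complex.I)) :=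
      (continuous_Gamma_vertical (a := σ / ε) (by positivity)).comp (by fun_prop : Continuous
        fun τ : ℝ => τ / ε)
    refine Measurable.aestronglyMeasurable (Measurable.mul (Measurable.mul ?_ ?_) ?_)
    · exact Continuous.measurable (by fun_prop)
    · exact (hΓ.measurable).div_const _
    · refine Measurable.div_const ?_ _
      exact (measurable_qPochInf hq0 hq1).comp (Continuous.measurable (by fun_prop))
  · intro ε hε τ
    have hε0 := hε.1
    refine gaussian_approx_of_log_bounds hC0 hε.1 (.of_forall fun n => rfl) (hlim ε hε τ) ?_ ?_
    · filter_upwards [hS1 ε hε, hS2 ε hε] with n hn1 hn2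
      have h1 := abs_sum_log_sub_le (hd0 ε hε) (hdM ε hε) τ (n + 1)
      have h2 := abs_sum_log_cos_sub_le (hV0 ε hε) (hVM ε hε) τ n
      have b1 : ∑ j ∈ Finset.range (n + 1), d ε j ^ 2 ≤ K₁ / ε :=
        le_div_of_abs_mul_sub_le hε0 hε.2.le (by positivity) hn1
      have b2 : ∑ j ∈ Finset.range n, V ε j ≤ K₂ / ε :=
        le_div_of_abs_mul_sub_le hε0 hε.2.le (by positivity) hn2
      set S₁ := ∑ j ∈ Finset.range (n + 1), d ε j ^ 2
      set S₂ := ∑ j ∈ Finset.range n, V ε j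
      set T₁ := ∑ j ∈ Finset.range (n + 1), Real.log (1 + (τ * d ε j) ^ 2) / 2 with hT₁
      set T₂ := ∑ j ∈ Finset.range n, Real.log (1 + 2 * (1 - Real.cos τ) * V ε j) / 2 with hT₂
      have e : R ε τ n + κ * τ ^ 2 / (2 * ε) = -(T₁ - τ ^ 2 / 2 * S₁) + (T₂ - τ ^ 2 / 2 * S₂) +
          -(τ ^ 2 / (2 * ε) * (ε * S₁ - 1 / σ)) + τ ^ 2 / (2 * ε) * (ε * S₂ - b / (1 - b)) := by
        simp only [hR, ← hT₁, ← hT₂, hκ]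
        have : ε ≠ 0 := hε0.ne'
        generalize 1 / σ = s, b / (1 - b) = t
        field_simp; ring
      rw [e]
      have hpos : 0 ≤ τ ^ 2 / (2 * ε) := by positivity
      have t1 := abs_add_le (-(T₁ - τ ^ 2 / 2 * S₁) + (T₂ - τ ^ 2 / 2 * S₂) +
          -(τ ^ 2 / (2 * ε) * (ε * S₁ - 1 / σ))) (τ ^ 2 / (2 * ε) * (ε * S₂ - b / (1 - b)))
      have t2 := abs_add_three (-(T₁ - τ ^ 2 / 2 * S₁)) (T₂ - τ ^ 2 / 2 * S₂)
          (-(τ ^ 2 / (2 * ε) * (ε * S₁ - 1 / σ)))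
      rw [abs_neg, abs_neg] at t2
      have c3 : |τ ^ 2 / (2 * ε) * (ε * S₁ - 1 / σ)| ≤ (1 / σ ^ 2 + 1) / 2 * τ ^ 2 := by
        rw [abs_mul, abs_of_nonneg hpos]
        refine (mul_le_mul_of_nonneg_left hn1 hpos).trans (le_of_eq ?_)
        generalize 1 / σ ^ 2 + 1 = s
        field_simp
      have c4 : |τ ^ 2 / (2 * ε) * (ε * S₂ - b / (1 - b))| ≤ (V₀ + 1) / 2 * τ ^ 2 := by
        rw [abs_mul, abs_of_nonneg hpos]
        refine (mul_le_mul_of_nonneg_left hn2 hpos).trans (le_of_eq ?_)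
        field_simp
      have c1 := h1.trans (mul_le_mul_of_nonneg_left b1 (by positivity))
      have c2 := h2.trans (mul_le_mul_of_nonneg_left b2 (by positivity))
      have e1 : τ ^ 4 * (1 / σ) ^ 2 * (K₁ / ε) + τ ^ 4 * (V₀ + 1) * (K₂ / ε) = B₁ * (τ ^ 4 / ε) := by
        rw [hB₁]; ring
      have e2 : (1 / σ ^ 2 + 1) / 2 * τ ^ 2 + (V₀ + 1) / 2 * τ ^ 2 = A₁ * τ ^ 2 := by
        rw [hA₁]; ring
      have p1 : A₁ * τ ^ 2 ≤ C * τ ^ 2 :=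
        mul_le_mul_of_nonneg_right (by linarith) (by positivity)
      have p2 : B₁ * (τ ^ 4 / ε) ≤ C * (τ ^ 4 / ε) :=
        mul_le_mul_of_nonneg_right (by linarith) (by positivity)
      rw [mul_add C]
      linarith
    · have hlog : ∀ᶠ n : ℕ in atTop,
          |Real.log (ε * n) - Real.log (σ + ε * (n + 1 : ℕ))| ≤ ε := by
        have := (tendsto_log_mul_sub_log_add hσ0 hε0).abs
        rw [abs_zero] at this
        exact this.eventually_le_const hε0
      filter_upwards [hS1 ε hε, hS3 ε hε, hlog, eventually_ge_atTop 1] with n hn1 hn3 hn5 hn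
      have hn4 := hS4 ε hε n
      have h1 := abs_sum_arctan_sub_le (hd0 ε hε) (hdM ε hε) τ (n + 1)
      have h2 := abs_sum_arg_sub_le (hm0 ε hε) (hmM ε hε) τ n
      have b1 : ∑ j ∈ Finset.range (n + 1), d ε j ^ 2 ≤ K₁ / ε :=
        le_div_of_abs_mul_sub_le hε0 hε.2.le (by positivity) hn1
      have b3 : ∑ j ∈ Finset.range n, m ε j ≤ K₃ / ε :=
        le_div_of_abs_mul_sub_le hε0 hε.2.le (by positivity) hn3
      set S₁ := ∑ j ∈ Finset.range (n + 1), d ε j ^ 2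
      set S₃ := ∑ j ∈ Finset.range n, m ε j
      set S₄ := ∑ j ∈ Finset.range (n + 1), d ε j
      set T₁ := ∑ j ∈ Finset.range (n + 1), Real.arctan (τ * d ε j) with hT₁
      set T₂ := ∑ j ∈ Finset.range n,
        Real.arctan (m ε j * Real.sin τ / (1 + m ε j * (1 - Real.cos τ))) with hT₂
      have hnpos : (0 : ℝ) < n := by exact_mod_cast hn
      -- The main terms of the three sums cancel, as `log σ = log u + log (1 - b)`.
      have e : Θ ε τ n = -(T₁ - τ * S₄) + (T₂ - τ * S₃) +
          τ / ε * ((Real.log (ε * n) - Real.log (σ + ε * (n + 1 : ℕ))) +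
            -(ε * S₄ - (Real.log (σ + ε * (n + 1 : ℕ)) - Real.log σ)) +
            (ε * S₃ - -Real.log (1 - b))) := by
        simp only [hΘ, ← hT₁, ← hT₂]
        rw [Real.log_div hu.ne' hε0.ne', Real.log_mul hε0.ne' hnpos.ne', hσ,
          Real.log_mul hu.ne' hb1'.ne', ← hσ]
        have : ε ≠ 0 := hε0.ne'
        field_simp; ring
      rw [e]
      have hpos : 0 ≤ |τ| / ε := by positivity
      have t1 := abs_add_three (Real.log (ε * n) - Real.log (σ + ε * (n + 1 : ℕ)))
            (-(ε * S₄ - (Real.log (σ + ε * (n + 1 : ℕ)) - Real.log σ)))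
            (ε * S₃ - -Real.log (1 - b))
      rw [abs_neg] at t1
      set Q := (Real.log (ε * n) - Real.log (σ + ε * (n + 1 : ℕ))) +
            -(ε * S₄ - (Real.log (σ + ε * (n + 1 : ℕ)) - Real.log σ)) +
            (ε * S₃ - -Real.log (1 - b))
      have hQ : |Q| ≤ ε * A₂ := by rw [hA₂]; linarith
      have t2 := abs_add_three (-(T₁ - τ * S₄)) (T₂ - τ * S₃) (τ / ε * Q)
      rw [abs_neg] at t2
      have c3 : |τ / ε * Q| ≤ A₂ * |τ| := by
        rw [abs_mul, abs_div, abs_of_pos hε0]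
        refine (mul_le_mul_of_nonneg_left hQ hpos).trans (le_of_eq ?_)
        field_simp
      have c1 := h1.trans (mul_le_mul_of_nonneg_left b1 (by positivity))
      have c2 := h2.trans (mul_le_mul_of_nonneg_left b3 (by positivity))
      have e1 : |τ| ^ 3 * (1 / σ) * (K₁ / ε) + |τ| ^ 3 * (m₀ ^ 2 + m₀ + 2) * (K₃ / ε) =
          B₂ * (|τ| ^ 3 / ε) := by
        rw [hB₂]; ring
      have p1 : A₂ * |τ| ≤ C * |τ| :=
        mul_le_mul_of_nonneg_right (by linarith) (by positivity)
      have p2 : B₂ * (|τ| ^ 3 / ε) ≤ C * (|τ| ^ 3 / ε) :=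
        mul_le_mul_of_nonneg_right (by linarith) (by positivity)
      rw [mul_add C]
      linarith
  · intro ε hε τ
    have hε0 := hε.1
    have hpos : 0 < 1 + 1 / σ ^ 2 * τ ^ 2 := by positivity
    set a := (1 - b) / b with ha
    have ha0 : 0 < a := by positivity
    have hinv : 1 / a = b / (1 - b) := by rw [ha, one_div_div]
    have hσa : σ ≤ a := by
      refine (one_div_le_one_div ha0 hσ0).1 ?_
      rw [hinv]; linarith
    set y := |τ| with hy
    have hy0 : 0 ≤ y := abs_nonneg τ
    -- The factor `2 * V₀` bounds the term `j = 0` of the numerator, and the last summand tends to `0`.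
    have hbound : ∀ᶠ n : ℕ in atTop,
        ‖Complex.exp ((R ε τ n : ℝ) + (Θ ε τ n : ℝ) * Complex.I)‖ ≤
        Real.exp (-((arctanIntegral σ y - arctanIntegral a y) / ε) + 2 * V₀ +
          y ^ 2 / (σ + ε * (n + 1 : ℕ)) / ε) := by
      filter_upwards [eventually_ge_atTop 1] with n hn
      have e : ‖Complex.exp ((R ε τ n : ℝ) + (Θ ε τ n : ℝ) * Complex.I)‖ = Real.exp (R ε τ n) := by
        rw [Complex.norm_exp]; simp
      rw [e]
      refine Real.exp_le_exp.2 ?_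
      have h1 := arctanIntegral_le_sum_log hσ0 hε0 hy0 (n + 1)
      have h2 := arctanIntegral_le_sq_div (a := σ + ε * (n + 1 : ℕ)) (by positivity) hy0
      obtain ⟨k, rfl⟩ : ∃ k, n = k + 1 := ⟨n - 1, by omega⟩
      have h3 := sum_log_le_arctanIntegral hb0 hb1 hε0 hy0 k
      rw [hy, Real.cos_abs, ← hy] at h3
      simp only [hR]
      rw [Finset.sum_range_succ' _ k]
      have h4 : Real.log (1 + 2 * (1 - Real.cos τ) * V ε 0) / 2 ≤ 2 * V₀ := by
        have hc := Real.neg_one_le_cos τ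
        have hc1 := Real.cos_le_one τ
        have e0 : V ε 0 = V₀ := by simp [hV, hV₀]
        rw [e0]
        have h5 : 0 ≤ 2 * (1 - Real.cos τ) * V₀ := mul_nonneg (by linarith) hV₀0
        have h6 := Real.log_le_sub_one_of_pos (show 0 < 1 + 2 * (1 - Real.cos τ) * V₀ by linarith)
        have h7 : 0 ≤ (1 + Real.cos τ) * V₀ := mul_nonneg (by linarith) hV₀0
        linarith
      have e1 : ∀ j, (τ * d ε j) ^ 2 = (y * (1 / (σ + ε * j))) ^ 2 := fun j => by
        rw [mul_pow, mul_pow, hy, sq_abs]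
      simp only [e1]
      have h7 := div_le_div_of_nonneg_right h2 hε0.le
      rw [sub_div] at h1 ⊢
      simp only [hV] at h4 ⊢
      linarith
    have hlim2 : Tendsto (fun n : ℕ => Real.exp (-((arctanIntegral σ y - arctanIntegral a y) / ε) +
        2 * V₀ + y ^ 2 / (σ + ε * (n + 1 : ℕ)) / ε)) atTop
        (𝓝 (Real.exp (-((arctanIntegral σ y - arctanIntegral a y) / ε) + 2 * V₀ + 0 / ε))) := by
      refine (Real.continuous_exp.tendsto _).comp (Tendsto.const_add _ (Tendsto.div_const ?_ _))
      refine tendsto_const_nhds.div_atTop (tendsto_atTop_add_const_left _ σ ?_)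
      exact (tendsto_const_mul_natCast_atTop hε0).comp (tendsto_add_atTop_nat 1)
    refine (le_of_tendsto_of_tendsto (hlim ε hε τ).norm hlim2 hbound).trans ?_
    rw [Real.rpow_def_of_pos hpos, ← Real.exp_add]
    refine Real.exp_le_exp.2 ?_
    have h1 := arctanIntegral_sub_ge hσ0 hσa hy0
    rw [hinv, ← hκ, div_pow, hy, sq_abs, ← hy] at h1
    have h2 := div_le_div_of_nonneg_right h1 hε0.le
    have e : 1 / σ ^ 2 * τ ^ 2 = τ ^ 2 / σ ^ 2 := by ring
    rw [e]
    have e2 : Real.log (1 + τ ^ 2 / σ ^ 2) * -(κ * σ ^ 2 / 2 / ε) =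
        -(κ * σ ^ 2 / 2 * Real.log (1 + τ ^ 2 / σ ^ 2) / ε) := by ring
    rw [e2]
    linarith [zero_div ε]

/-! ### The branches of the Lambert function and the saddle point -/

/-- The function `u ↦ u exp (-u)` increases on `[0, 1]` and decreases on `[1, ∞)`: the condition
`(u - y) * (1 - y) ≤ 0` says that `y = 1`, or that `u` is at least as far from `1` as `y`, on the same side. -/
lemma mul_exp_neg_lt {y u : ℝ} (hy : 0 < y) (hne : u ≠ y) (h : (u - y) * (1 - y) ≤ 0) :
    u * Real.exp (-u) < y * Real.exp (-y) := by
  have h1 := Real.add_one_lt_exp (sub_ne_zero.2 hne)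
  have h2 : u ≤ y * (u - y + 1) := by nlinarith
  have h3 : u < y * Real.exp (u - y) := h2.trans_lt (mul_lt_mul_of_pos_left h1 hy)
  have h4 := mul_lt_mul_of_pos_right h3 (Real.exp_pos (-u))
  rwa [mul_assoc, ← Real.exp_add, show u - y + -u = -y by ring] at h4

lemma mul_exp_neg_lt_exp_neg_one {u : ℝ} (hne : u ≠ 1) : u * Real.exp (-u) < Real.exp (-1) := by
  simpa using mul_exp_neg_lt one_pos hne (by simp)

lemma exists_mul_exp_eq_of_neg_exp_le {h : ℝ} (hh : -Real.exp (-1) ≤ h) :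
    ∃ w ∈ Set.Ici (-1 : ℝ), w * Real.exp w = h := by
  have hM : (0 : ℝ) ≤ |h| := abs_nonneg h
  have hc : ContinuousOn (fun w : ℝ => w * Real.exp w) (Set.Icc (-1) |h|) := by fun_prop
  obtain ⟨w, hw, e⟩ := intermediate_value_Icc (by linarith) hc (show h ∈ Set.Icc _ _ by
    refine ⟨by simpa using hh, (le_abs_self h).trans ?_⟩
    exact le_mul_of_one_le_right hM (Real.one_le_exp hM))
  exact ⟨w, hw.1, e⟩

lemma exists_mul_exp_eq_of_neg {h : ℝ} (hh : -Real.exp (-1) ≤ h) (h0 : h < 0) :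
    ∃ w ∈ Set.Iic (-1 : ℝ), w * Real.exp w = h := by
  -- At `w = -y` the value is at least `h`, because `exp y ≥ y ^ 2 / 2`.
  set y := max 1 (2 / -h) with hy
  have hy1 : 1 ≤ y := le_max_left _ _
  have hy2 : 2 ≤ -h * y := by
    have : 2 / -h ≤ y := le_max_right _ _
    rw [div_le_iff₀ (by linarith)] at this
    linarith
  have hc : ContinuousOn (fun w : ℝ => w * Real.exp w) (Set.Icc (-y) (-1)) := by fun_prop
  obtain ⟨w, hw, e⟩ := intermediate_value_Icc' (by linarith) hc (show h ∈ Set.Icc _ _ by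
    refine ⟨by simpa using hh, ?_⟩
    have h1 := Real.quadratic_le_exp_of_nonneg (show 0 ≤ y by linarith)
    have h2 : y ≤ -h * Real.exp y := by
      have := mul_le_mul_of_nonneg_left h1 (show 0 ≤ -h by linarith)
      nlinarith
    have h3 := mul_le_mul_of_nonneg_right h2 (Real.exp_pos (-y)).le
    rw [mul_assoc, ← Real.exp_add, add_neg_cancel, Real.exp_zero, mul_one] at h3
    linarith)
  exact ⟨w, hw.2, e⟩

lemma lambertW0_spec {h : ℝ} (hh : -Real.exp (-1) ≤ h) :
    -1 ≤ lambertW0 h ∧ lambertW0 h * Real.exp (lambertW0 h) = h :=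
  ⟨Function.invFunOn_mem (exists_mul_exp_eq_of_neg_exp_le hh),
    Function.invFunOn_eq (exists_mul_exp_eq_of_neg_exp_le hh)⟩

lemma lambertWm1_spec {h : ℝ} (hh : -Real.exp (-1) ≤ h) (h0 : h < 0) :
    lambertWm1 h ≤ -1 ∧ lambertWm1 h * Real.exp (lambertWm1 h) = h :=
  ⟨Function.invFunOn_mem (exists_mul_exp_eq_of_neg hh h0),
    Function.invFunOn_eq (exists_mul_exp_eq_of_neg hh h0)⟩

lemma uCrit_spec {x : ℝ} (hx : 1 < x) :
    1 ≤ uCrit x ∧ x * (uCrit x * Real.exp (-uCrit x)) = Real.exp (-1) := by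
  have hx0 : 0 < x := by linarith
  have e : -1 / (Real.exp 1 * x) = -(Real.exp (-1) / x) := by
    rw [Real.exp_neg]; field_simp
  have h := lambertWm1_spec (h := -1 / (Real.exp 1 * x)) (by
    rw [e, neg_le_neg_iff]; exact div_le_self (Real.exp_pos _).le hx.le) (by
    rw [e, neg_lt_zero]; positivity)
  refine ⟨by rw [uCrit]; linarith [h.1], ?_⟩
  rw [uCrit, neg_neg, neg_mul, h.2, e, neg_neg]
  field_simp

/-- Away from `x = 1`, `u ≤ 1`, the saddle point is `1 - b` with `0 < b < 1`. -/
lemma exists_saddle_eq_one_sub {x u : ℝ} (hxu : (x, u) ∈ admissibleRegion)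
    (h1 : ¬ (x = 1 ∧ u ≤ 1)) :
    0 < x ∧ 0 < u ∧ ∃ b, 0 < b ∧ b < 1 ∧ u * b < 1 ∧ saddle x u = 1 - b ∧
      b = x * Real.exp (-(u * (1 - b))) := by
  -- The region is such that `-x u exp (-u) > -1 / e`, so that `W₀` is not at its branch point.
  have hcases : 0 < x ∧ 0 < u ∧ (x < 1 ∨ 1 < u) ∧ x * (u * Real.exp (-u)) < Real.exp (-1) := by
    rcases hxu with ⟨⟨hx0, hx1⟩, hu⟩ | ⟨hx, hu⟩
    · simp only [Set.mem_Ioi] at hx0 hx1 hu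
      have hpos : 0 < u * Real.exp (-u) := mul_pos hu (Real.exp_pos _)
      rcases hx1.lt_or_eq with hx | rfl
      · refine ⟨hx0, hu, .inl hx, (mul_lt_of_lt_one_left hpos hx).trans_le ?_⟩
        by_cases h : u = 1
        · simp [h]
        · exact (mul_exp_neg_lt_exp_neg_one h).le
      · have hu1 : 1 < u := by by_contra h; exact h1 ⟨rfl, not_lt.1 h⟩
        refine ⟨hx0, hu, .inr hu1, ?_⟩
        rw [one_mul]
        exact mul_exp_neg_lt_exp_neg_one hu1.ne'
    · simp only at hx hu
      obtain ⟨hv1, hv⟩ := uCrit_spec hx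
      refine ⟨by linarith, by linarith, .inr (by linarith), ?_⟩
      rw [← hv]
      refine mul_lt_mul_of_pos_left (mul_exp_neg_lt (by linarith) hu.ne' ?_) (by linarith)
      exact mul_nonpos_of_nonneg_of_nonpos (by linarith) (by linarith)
  obtain ⟨hx0, hu0, hor, hlt⟩ := hcases
  refine ⟨hx0, hu0, ?_⟩
  have hsad : saddle x u = 1 + lambertW0 (-x * u * Real.exp (-u)) / u := by
    rw [saddle, if_neg]
    exact fun h => h1 ⟨h.1, h.2.le⟩
  set h := -x * u * Real.exp (-u) with hh
  have hneg : h = -(x * (u * Real.exp (-u))) := by rw [hh]; ring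
  have hh0 : h < 0 := by
    rw [hneg, neg_lt_zero]
    have := Real.exp_pos (-u)
    positivity
  obtain ⟨hw1, hw⟩ := lambertW0_spec (h := h) (by rw [hneg]; linarith)
  set w := lambertW0 h
  have hw0 : w < 0 := by
    by_contra hcon
    have := mul_nonneg (not_lt.1 hcon) (Real.exp_pos w).le
    linarith
  have hw1' : -1 < w := by
    refine lt_of_le_of_ne hw1 fun he => ?_
    rw [← he] at hw
    linarith
  -- For `x < 1`, monotonicity of `y exp (-y)` on `[0, 1]` excludes `u ≤ -w`; for `u > 1`, `-w < 1`
  -- suffices.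
  have hwu : -w < u := by
    rcases hor with hx | hu
    · by_contra hcon
      have hle : u * Real.exp (-u) ≤ -w * Real.exp (- -w) := by
        rcases (not_lt.1 hcon).eq_or_lt with he | hlt'
        · rw [← he]
        · exact (mul_exp_neg_lt (by linarith) hlt'.ne
            (mul_nonpos_of_nonpos_of_nonneg (by linarith) (by linarith))).le
      rw [neg_neg, neg_mul, hw, hneg, neg_neg] at hle
      have : 0 < u * Real.exp (-u) := mul_pos hu0 (Real.exp_pos _)
      nlinarith
    · linarith
  have hub : u * (-w / u) = -w := by field_simp
  refine ⟨-w / u, div_pos (by linarith) hu0, (div_lt_one hu0).2 hwu, by linarith, ?_, ?_⟩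
  · rw [hsad]; ring
  · have e : -(u * (1 - -w / u)) = -u + -w := by rw [mul_sub, hub]; ring
    rw [e, Real.exp_add, Real.exp_neg w]
    have := Real.exp_pos w
    field_simp
    linarith

/-- For `x = 1` and `u < 1` the saddle point `c` is a negative solution of `1 - c = exp (-u c)`. -/
lemma saddle_one_of_lt {u : ℝ} (hu0 : 0 < u) (hu1 : u < 1) :
    saddle 1 u < 0 ∧ 1 < u * (1 - saddle 1 u) ∧
      Real.log (1 - saddle 1 u) = -(u * saddle 1 u) := by
  have hlt := mul_exp_neg_lt_exp_neg_one hu1.ne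
  have hpos : 0 < u * Real.exp (-u) := mul_pos hu0 (Real.exp_pos _)
  have hsad : saddle 1 u = 1 + lambertWm1 (-1 * u * Real.exp (-u)) / u := by
    rw [saddle, if_pos ⟨rfl, hu1⟩]
  obtain ⟨hw1, hw⟩ := lambertWm1_spec (h := -1 * u * Real.exp (-u)) (by linarith) (by linarith)
  set w := lambertWm1 (-1 * u * Real.exp (-u))
  have hw1' : w < -1 := by
    refine lt_of_le_of_ne hw1 fun he => ?_
    rw [he] at hw
    linarith
  have huc : u * saddle 1 u = u + w := by rw [hsad]; field_simp
  refine ⟨?_, by linarith, ?_⟩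
  · by_contra hcon
    have := mul_nonneg hu0.le (not_lt.1 hcon)
    linarith
  · have e : 1 - saddle 1 u = Real.exp (-(u * saddle 1 u)) := by
      rw [huc, neg_add, Real.exp_add, Real.exp_neg w, hsad]
      have := Real.exp_pos w
      field_simp
      linarith
    rw [e, Real.log_exp]

lemma saddle_one_one : saddle 1 1 = 0 := by
  rw [saddle, if_neg (by simp)]
  obtain ⟨-, hw⟩ := lambertW0_spec (h := -1 * 1 * Real.exp (-1)) (by linarith)
  set w := lambertW0 (-1 * 1 * Real.exp (-1))
  have : -w = 1 := by
    by_contra h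
    have := mul_exp_neg_lt_exp_neg_one h
    rw [neg_neg] at this
    linarith
  linarith

/-! ### Combining relative errors -/

/-- The factor `exp δ` collects the relative errors of the prefactors, for which only a bound is
known, and `1 + ρ` is the relative error of the integral. -/
lemma exists_relative_error {F M ρ : ℝ → ℝ} {C : ℝ} (hM : ∀ ε, 0 < M ε)
    (hρ : ρ =O[𝓝[>] 0] (fun ε : ℝ => ε))
    (h : ∀ᶠ ε in 𝓝[>] (0 : ℝ), ∃ δ, |δ| ≤ C * ε ∧ F ε = M ε * (Real.exp δ * (1 + ρ ε))) :
    ∃ r : ℝ → ℝ, r =O[𝓝[>] 0] (fun ε : ℝ => ε) ∧ ∀ᶠ ε in 𝓝[>] (0 : ℝ), F ε = M ε * (1 + r ε) := by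
  refine ⟨fun ε => F ε / M ε - 1, ?_, .of_forall fun ε => ?_⟩
  · obtain ⟨K, hK0, hK⟩ := hρ.exists_pos
    rw [IsBigOWith] at hK
    have hsmall : ∀ᶠ ε in 𝓝[>] (0 : ℝ), |C| * ε < 1 ∧ K * ε < 1 := by
      have h1 : Tendsto (fun ε : ℝ => |C| * ε) (𝓝[>] 0) (𝓝 (|C| * 0)) :=
        (tendsto_id.const_mul _).mono_left nhdsWithin_le_nhds
      have h2 : Tendsto (fun ε : ℝ => K * ε) (𝓝[>] 0) (𝓝 (K * 0)) :=
        (tendsto_id.const_mul _).mono_left nhdsWithin_le_nhds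
      rw [mul_zero] at h1 h2
      exact (h1.eventually_lt_const one_pos).and (h2.eventually_lt_const one_pos)
    refine IsBigO.of_bound (4 * |C| + K) ?_
    filter_upwards [h, hK, hsmall, self_mem_nhdsWithin] with ε ⟨δ, hδ, e⟩ hρε ⟨hs1, hs2⟩ hε
    have hε0 : 0 < ε := hε
    rw [Real.norm_eq_abs, Real.norm_eq_abs, abs_of_pos hε0] at hρε ⊢
    have hδ' : |δ| ≤ |C| * ε := hδ.trans (mul_le_mul_of_nonneg_right (le_abs_self C) hε0.le)
    rw [e, mul_div_cancel_left₀ _ (hM ε).ne']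
    have h1 := Real.abs_exp_sub_one_le (x := δ) (by linarith)
    have e2 : Real.exp δ * (1 + ρ ε) - 1 = (Real.exp δ - 1) * (1 + ρ ε) + ρ ε := by ring
    have h2 : |1 + ρ ε| ≤ 2 := by
      have := abs_add_le 1 (ρ ε)
      rw [abs_one] at this
      linarith
    rw [e2]
    have h3 := abs_add_le ((Real.exp δ - 1) * (1 + ρ ε)) (ρ ε)
    rw [abs_mul] at h3
    have h4 := mul_le_mul h1 h2 (abs_nonneg _) (by positivity)
    linarith
  · rw [add_sub_cancel, mul_div_cancel₀ _ (hM ε).ne']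

/-! ### The two asymptotic expansions -/

lemma qPochInf_self_eq_norm {q : ℝ} (hq0 : 0 < q) (hq1 : q < 1) :
    qPochInf (q : ℝ) q = (‖qPochInf (q : ℝ) q‖ : ℝ) := by
  have h := tendsto_prod_qPochInf hq0 hq1 (q : ℝ)
  refine tendsto_nhds_unique h (((Complex.continuous_ofReal.tendsto _).comp h.norm).congr fun n => ?_)
  have e : ∏ j ∈ Finset.range n, (1 - ((q : ℝ) : ℂ) * (q : ℂ) ^ j) =
      ((∏ j ∈ Finset.range n, (1 - q * q ^ j) : ℝ) : ℂ) := by push_cast; rfl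
  have h0 : 0 ≤ ∏ j ∈ Finset.range n, (1 - q * q ^ j) := Finset.prod_nonneg fun j _ => by
    have := pow_le_one₀ (n := j + 1) hq0.le hq1.le
    rw [pow_succ'] at this
    linarith
  rw [Function.comp, e, Complex.norm_real, Real.norm_of_nonneg h0]

/-- The expansion at `x = 1` when the saddle point `c` is not positive. The hypotheses on `P₁` and
`P₂` are those of `laplace_left`. -/
theorem qSeries_one_asymptotics {c u κ : ℝ} (hc : c ≤ 0) (hκ : 0 < κ) (hu0 : 0 < u)
    {P₁ P₂ : ℝ → ℝ} {L₁ L₂ : ℝ}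
    (hP₁ : ∀ v, 0 ≤ v → HasDerivAt P₁ (Real.exp (-v) / (1 - c * Real.exp (-v))) v)
    (hP₂ : ∀ v, 0 ≤ v → HasDerivAt P₂ ((Real.exp (-v) / (1 - c * Real.exp (-v))) ^ 2) v)
    (hL₁ : Tendsto P₁ atTop (𝓝 L₁)) (hL₂ : Tendsto P₂ atTop (𝓝 L₂))
    (hu : L₁ - P₁ 0 = u) (hk : L₂ - P₂ 0 = κ) :
    ∃ r : ℝ → ℝ, r =O[𝓝[>] 0] (fun ε : ℝ => ε) ∧ ∀ᶠ ε : ℝ in 𝓝[>] 0,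
      qSeries 1 (u / ε) (Real.exp (-ε)) =
        Real.exp (ε⁻¹ * (dilog c + u * (1 - c) - Real.pi ^ 2 / 6)) / √((1 - c) * κ) *
          (1 + r ε) := by
  obtain ⟨hint, hO⟩ := laplace_left hc hκ hP₁ hP₂ hL₁ hL₂ hu hk
  have hc1 : 0 < 1 - c := by linarith
  refine exists_relative_error (C := 1 + |c| / (2 * (1 - c))) (fun ε => by positivity) hO ?_
  filter_upwards [hint, Ioo_mem_nhdsGT (one_pos : (0 : ℝ) < 1)] with ε hG ⟨hε, hε1⟩
  set t := u / ε with ht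
  set q := Real.exp (-ε) with hq
  have hq0 : 0 < q := Real.exp_pos _
  have hq1 : q < 1 := by rw [hq, Real.exp_lt_one_iff]; linarith
  obtain ⟨δ₁, hδ₁, e₁⟩ := norm_qPochInf_self_asymptotics hε hε1.le
  obtain ⟨δ₂, hδ₂, e₂⟩ := qPochInf_asymptotics (z := c) (by linarith) hε
  rw [← hq] at e₁ e₂
  set Q := ‖qPochInf (q : ℝ) q‖ with hQ
  set B := Real.exp (-(dilog c / ε)) * √(1 - c) * Real.exp δ₂ with hB
  have hB0 : 0 < B := by positivity
  set G : ℝ → ℂ := fun η => Complex.exp ((t * η : ℝ) * Complex.I) *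
    (qPochInf c q / qPochInf (c - η * Complex.I) q) with hGdef
  set J := ∫ η : ℝ, (G η).re with hJ
  have hF : qSeries 1 t q = Real.exp t * (1 / (2 * Real.pi)) * (Real.exp (-(t * c)) * Q / B) * J := by
    have h1 := qSeries_one_eq_integral (t := t) (by positivity) hε hc
    have h2 : ∀ η : ℝ, Complex.exp (t * (-c + η * Complex.I)) *
        (qPochInf (q : ℝ) q / qPochInf (c - η * Complex.I) q) =
        ((Real.exp (-(t * c)) * Q / B : ℝ) : ℂ) * G η := fun η => by
      have hBC : (B : ℂ) ≠ 0 := by exact_mod_cast hB0.ne'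
      have h3 : Complex.exp (t * (-c + η * Complex.I)) =
          (Real.exp (-(t * c)) : ℝ) * Complex.exp ((t * η : ℝ) * Complex.I) := by
        rw [Complex.ofReal_exp, ← Complex.exp_add]
        congr 1
        push_cast
        ring
      simp only [hGdef]
      rw [qPochInf_self_eq_norm hq0 hq1, ← hQ, e₂, h3]
      push_cast
      field_simp
    rw [← hq] at h1
    simp only [h2] at h1
    rw [MeasureTheory.integral_const_mul] at h1
    have h4 := congrArg Complex.re h1
    have h5 : (∫ η, G η).re = J := (integral_re hG).symm
    rw [← mul_assoc, ← mul_assoc, ← Complex.ofReal_mul, ← Complex.ofReal_mul,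
      Complex.ofReal_re, Complex.re_ofReal_mul, h5] at h4
    exact h4
  refine ⟨δ₁ - δ₂, ?_, ?_⟩
  · refine (abs_sub _ _).trans ?_
    linarith
  · have hJ' : J = √(2 * Real.pi * ε / κ) * (1 + (J / √(2 * Real.pi * ε / κ) - 1)) := by
      have : √(2 * Real.pi * ε / κ) ≠ 0 := by positivity
      field_simp
      ring
    have hsq : √(2 * Real.pi / ε) * √(2 * Real.pi * ε / κ) = 2 * Real.pi / √κ := by
      rw [← Real.sqrt_mul (by positivity)]
      have : 2 * Real.pi / ε * (2 * Real.pi * ε / κ) = (2 * Real.pi) ^ 2 / κ := by field_simp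
      rw [this, Real.sqrt_div (by positivity), Real.sqrt_sq (by positivity)]
    have hexp : Real.exp (ε⁻¹ * (dilog c + u * (1 - c) - Real.pi ^ 2 / 6)) =
        Real.exp t * Real.exp (-(t * c)) * Real.exp (-(Real.pi ^ 2 / (6 * ε))) *
          (Real.exp (-(dilog c / ε)))⁻¹ := by
      rw [← Real.exp_neg, ← Real.exp_add, ← Real.exp_add, ← Real.exp_add, ht]
      congr 1
      field_simp
      ring
    rw [hF, hJ']
    generalize J / √(2 * Real.pi * ε / κ) - 1 = ρ
    rw [hexp, e₁, hB, Real.exp_sub, Real.sqrt_mul hc1.le]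
    have h1 : Real.exp t * (1 / (2 * Real.pi)) *
        (Real.exp (-(t * c)) * (√(2 * Real.pi / ε) * Real.exp (-(Real.pi ^ 2 / (6 * ε))) *
          Real.exp δ₁) / (Real.exp (-(dilog c / ε)) * √(1 - c) * Real.exp δ₂)) *
        (√(2 * Real.pi * ε / κ) * (1 + ρ)) =
        Real.exp t * Real.exp (-(t * c)) * Real.exp (-(Real.pi ^ 2 / (6 * ε))) *
          (Real.exp (-(dilog c / ε)))⁻¹ * (Real.exp δ₁ / Real.exp δ₂) * (1 + ρ) / √(1 - c) *
          (1 / (2 * Real.pi) * (√(2 * Real.pi / ε) * √(2 * Real.pi * ε / κ))) := by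
      field_simp
    rw [h1, hsq]
    field_simp
    ring

/-- The expansion when the saddle point `1 - b` is in `(0, 1)`. -/
theorem qSeries_asymptotics {x u b : ℝ} (hx : 0 < x) (hu : 0 < u) (hb0 : 0 < b) (hb1 : b < 1)
    (hub : u * b < 1) (hb : b = x * Real.exp (-(u * (1 - b)))) :
    ∃ r : ℝ → ℝ, r =O[𝓝[>] 0] (fun ε : ℝ => ε) ∧ ∀ᶠ ε : ℝ in 𝓝[>] 0,
      qSeries x (u / ε) (Real.exp (-ε)) =
        Real.exp (ε⁻¹ * (Real.log x * Real.log (1 - b) + dilog (1 - b) + u * b -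
          Real.pi ^ 2 / 6)) / √((1 - u * b) / (1 - b)) * (1 + r ε) := by
  have hb1' : 0 < 1 - b := by linarith
  have hub' : 0 < 1 - u * b := by linarith
  obtain ⟨σ, hσ⟩ : ∃ σ, σ = u * (1 - b) := ⟨_, rfl⟩
  have hσ0 : 0 < σ := by rw [hσ]; positivity
  obtain ⟨κ, hκ⟩ : ∃ κ, κ = 1 / σ - b / (1 - b) := ⟨_, rfl⟩
  have hκσ : κ * σ = 1 - u * b := by
    rw [hκ, hσ]; field_simp
  have hκ0 : 0 < κ := by
    by_contra h
    have := mul_nonneg (neg_nonneg.2 (not_lt.1 h)) hσ0.le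
    linarith
  obtain ⟨hint, hO⟩ := laplace_right hu hb0 hb1 hσ hκ0 hκ
  refine exists_relative_error (C := 1 / (4 * σ) + |b| / (2 * (1 - b))) (fun ε => by positivity)
    hO ?_
  filter_upwards [hint, self_mem_nhdsWithin] with ε hG hε
  replace hε : 0 < ε := hε
  set t := u / ε with ht
  have ht0 : 0 < t := by positivity
  set q := Real.exp (-ε) with hq
  obtain ⟨δ₂, hδ₂, e₂⟩ := qPochInf_asymptotics hb1 hε
  rw [← hq] at e₂
  set B := Real.exp (-(dilog b / ε)) * √(1 - b) * Real.exp δ₂ with hB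
  have hB0 : 0 < B := by positivity
  set s := σ / ε with hs
  have hs0 : 0 < s := by positivity
  have hΓ0 : 0 < Real.Gamma s := Real.Gamma_pos_of_pos hs0
  obtain ⟨hδ₁0, hδ₁⟩ := log_Gamma_stirling hs0
  set δ₁ := Real.log (Real.Gamma s) -
    ((s - 1 / 2) * Real.log s - s + Real.log (2 * Real.pi) / 2) with hδ₁def
  set G : ℝ → ℂ := fun τ => Complex.exp ((-(τ / ε * Real.log t) : ℝ) * Complex.I) *
      (Complex.Gamma (s + (τ / ε : ℝ) * Complex.I) / Complex.Gamma s) *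
      (qPochInf (b * Complex.exp (-(τ * Complex.I))) q / qPochInf b q) with hGdef
  set J := ∫ τ : ℝ, (G τ).re with hJ
  have hF : qSeries x t q = Real.exp t * (1 / (2 * Real.pi)) * ε⁻¹ *
      (Real.exp (-(s * Real.log t)) * Real.Gamma s * B) * J := by
    have h1 := qSeries_eq_mellinBarnes hx ht0 hε hs0
    set f : ℝ → ℂ := fun η => (t : ℂ) ^ (-(s + η * Complex.I)) *
      Complex.Gamma (s + η * Complex.I) *
        qPochInf (x * Complex.exp (-ε * (s + η * Complex.I))) q with hf
    have hsub := MeasureTheory.Measure.integral_comp_div f ε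
    rw [abs_of_pos hε] at hsub
    -- On this line `x q ^ s = b e ^ (-i τ)`, as `b = x exp (-σ)`.
    have h2 : ∀ τ : ℝ, f (τ / ε) =
        ((Real.exp (-(s * Real.log t)) * Real.Gamma s * B : ℝ) : ℂ) * G τ := fun τ => by
      have hBC : (B : ℂ) ≠ 0 := by exact_mod_cast hB0.ne'
      have hΓC : (Real.Gamma s : ℂ) ≠ 0 := by exact_mod_cast hΓ0.ne'
      have htC : (t : ℂ) ≠ 0 := by exact_mod_cast ht0.ne'
      have hεC : (ε : ℂ) ≠ 0 := by exact_mod_cast hε.ne'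
      have h3 : (t : ℂ) ^ (-(s + (τ / ε : ℝ) * Complex.I)) = (Real.exp (-(s * Real.log t)) : ℝ) *
          Complex.exp ((-(τ / ε * Real.log t) : ℝ) * Complex.I) := by
        rw [Complex.cpow_def_of_ne_zero htC, ← Complex.ofReal_log ht0.le, Complex.ofReal_exp,
          ← Complex.exp_add]
        congr 1
        push_cast
        ring
      have h4 : x * Complex.exp (-ε * (s + (τ / ε : ℝ) * Complex.I)) =
          b * Complex.exp (-(τ * Complex.I)) := by
        have h5 : (b : ℂ) = x * Complex.exp (-(σ : ℂ)) := by
          have h6 : b = x * Real.exp (-σ) := by rw [hσ]; exact hb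
          rw [← Complex.ofReal_neg, ← Complex.ofReal_exp, ← Complex.ofReal_mul, ← h6]
        rw [h5, mul_assoc, ← Complex.exp_add, hs]
        congr 2
        push_cast
        field_simp
        ring
      simp only [hf, hGdef]
      rw [h3, h4, e₂, Complex.Gamma_ofReal]
      push_cast
      field_simp
    simp only [h2] at hsub
    rw [MeasureTheory.integral_const_mul] at hsub
    have h6 : ∫ η, f η = ((ε⁻¹ * (Real.exp (-(s * Real.log t)) * Real.Gamma s * B) : ℝ) : ℂ) *
        ∫ τ, G τ := by
      rw [Complex.ofReal_mul, mul_assoc, hsub, Complex.real_smul, ← mul_assoc,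
        ← Complex.ofReal_mul, inv_mul_cancel₀ hε.ne', Complex.ofReal_one, one_mul]
    rw [h6] at h1
    have h4 := congrArg Complex.re h1
    have h5 : (∫ τ, G τ).re = J := (integral_re hG).symm
    rw [← mul_assoc, ← mul_assoc, ← Complex.ofReal_mul, ← Complex.ofReal_mul,
      Complex.ofReal_re, Complex.re_ofReal_mul, h5] at h4
    rw [h4]
    ring
  have hΓ : Real.Gamma s = √(2 * Real.pi / s) * Real.exp (s * Real.log s - s) * Real.exp δ₁ := by
    rw [← Real.exp_log hΓ0, Real.sqrt_eq_rpow, Real.rpow_def_of_pos (by positivity), ← Real.exp_add,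
      ← Real.exp_add, Real.log_div (by positivity) hs0.ne']
    congr 1
    rw [hδ₁def]
    ring
  refine ⟨δ₁ + δ₂, ?_, ?_⟩
  · refine (abs_add_le _ _).trans ?_
    rw [abs_of_nonneg hδ₁0]
    have e : 1 / (4 * s) = 1 / (4 * σ) * ε := by rw [hs]; field_simp
    rw [e] at hδ₁
    linarith
  · have hJ' : J = √(2 * Real.pi * ε / κ) * (1 + (J / √(2 * Real.pi * ε / κ) - 1)) := by
      have : √(2 * Real.pi * ε / κ) ≠ 0 := by positivity
      field_simp
      ring
    have hsq : √(2 * Real.pi / s) * √(1 - b) * √(2 * Real.pi * ε / κ) =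
        2 * Real.pi * ε / √((1 - u * b) / (1 - b)) := by
      rw [← Real.sqrt_mul (by positivity), ← Real.sqrt_mul (by positivity)]
      have : 2 * Real.pi / s * (1 - b) * (2 * Real.pi * ε / κ) =
          (2 * Real.pi * ε) ^ 2 / ((1 - u * b) / (1 - b)) := by
        rw [← hκσ, hs]; field_simp
      rw [this, Real.sqrt_div (by positivity), Real.sqrt_sq (by positivity)]
    have hexp : Real.exp (ε⁻¹ * (Real.log x * Real.log (1 - b) + dilog (1 - b) + u * b -
          Real.pi ^ 2 / 6)) = Real.exp t * Real.exp (-(s * Real.log t)) *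
          Real.exp (s * Real.log s - s) * Real.exp (-(dilog b / ε)) := by
      have hlogb : Real.log b = Real.log x - u * (1 - b) := by
        rw [hb, Real.log_mul hx.ne' (Real.exp_pos _).ne', Real.log_exp, ← hb]; ring
      have hli := dilog_add_dilog_one_sub (z := b) ⟨hb0, hb1⟩
      have hls : Real.log s = Real.log t + Real.log (1 - b) := by
        rw [hs, ht, hσ, ← Real.log_mul (by positivity) hb1'.ne']
        congr 1
        ring
      rw [← Real.exp_add, ← Real.exp_add, ← Real.exp_add, hls]
      congr 1
      have e : dilog b = Real.pi ^ 2 / 6 - (Real.log x - u * (1 - b)) * Real.log (1 - b) -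
          dilog (1 - b) := by rw [← hlogb]; linarith
      rw [e, hs, ht, hσ]
      field_simp
      ring
    rw [hF, hJ', hΓ, hB, hexp, Real.exp_add]
    generalize J / √(2 * Real.pi * ε / κ) - 1 = ρ
    have h1 : Real.exp t * (1 / (2 * Real.pi)) * ε⁻¹ * (Real.exp (-(s * Real.log t)) *
        (√(2 * Real.pi / s) * Real.exp (s * Real.log s - s) * Real.exp δ₁) *
        (Real.exp (-(dilog b / ε)) * √(1 - b) * Real.exp δ₂)) *
        (√(2 * Real.pi * ε / κ) * (1 + ρ)) =
        Real.exp t * Real.exp (-(s * Real.log t)) *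
          Real.exp (s * Real.log s - s) * Real.exp (-(dilog b / ε)) *
          (Real.exp δ₁ * Real.exp δ₂ * (1 + ρ)) * (1 / (2 * Real.pi) * ε⁻¹) *
          (√(2 * Real.pi / s) * √(1 - b) * √(2 * Real.pi * ε / κ)) := by
      ring
    rw [h1, hsq]
    field_simp
    ring

/-! ### The three cases of the theorem -/

lemma tendsto_log_one_sub_mul_exp_neg (c : ℝ) :
    Tendsto (fun v => Real.log (1 - c * Real.exp (-v))) atTop (𝓝 0) := by
  have := (Real.continuousAt_log one_ne_zero).tendsto.comp (tendsto_one_sub_mul_exp_neg c)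
  rwa [Real.log_one] at this

theorem qSeries_one_asymptotics_of_lt {u : ℝ} (hu0 : 0 < u) (hu1 : u < 1) :
    ∃ r : ℝ → ℝ, r =O[𝓝[>] 0] (fun ε : ℝ => ε) ∧ ∀ᶠ ε : ℝ in 𝓝[>] 0,
      qSeries 1 (u / ε) (Real.exp (-ε)) =
        Real.exp (ε⁻¹ * exponent 1 u) / √(radicand 1 u) * (1 + r ε) := by
  obtain ⟨hc, huc, hlog⟩ := saddle_one_of_lt hu0 hu1
  have hexp : exponent 1 u =
      dilog (saddle 1 u) + u * (1 - saddle 1 u) - Real.pi ^ 2 / 6 := by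
    rw [exponent, Real.log_one, zero_mul, zero_add]
  have hrad : radicand 1 u = 1 + (1 - u) * (1 - saddle 1 u) / saddle 1 u := by
    rw [radicand, if_neg fun h => hu1.ne h.2]
  generalize saddle 1 u = c at *
  have hc1 : 0 < 1 - c := by linarith
  have hκ : 0 < (1 / (1 - c) - u) / c := by
    refine div_pos_of_neg_of_neg ?_ hc
    rw [sub_neg, div_lt_iff₀ hc1]
    exact huc
  have hE : ∀ v, HasDerivAt (fun v : ℝ => 1 - c * Real.exp (-v)) (c * Real.exp (-v)) v :=
    fun v => ((((hasDerivAt_neg v).exp).const_mul c).const_sub 1).congr_deriv (by ring)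
  have hne : ∀ v, 0 ≤ v → 1 - c * Real.exp (-v) ≠ 0 := fun v hv =>
    (one_sub_mul_exp_neg_pos (by linarith) hv).ne'
  have hL := tendsto_log_one_sub_mul_exp_neg c
  have h := qSeries_one_asymptotics hc.le hκ hu0
    (P₁ := fun v => Real.log (1 - c * Real.exp (-v)) / c)
    (P₂ := fun v => -(Real.log (1 - c * Real.exp (-v)) + (1 - c * Real.exp (-v))⁻¹) / c ^ 2)
    (fun v hv => (((hE v).log (hne v hv)).div_const c).congr_deriv (by
      have := hne v hv
      have := hc.ne
      field_simp))
    (fun v hv => ((((hE v).log (hne v hv)).add ((hE v).fun_inv (hne v hv))).neg.div_const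
      (c ^ 2)).congr_deriv (by
      have := hne v hv
      have := hc.ne
      field_simp
      ring))
    (hL.div_const c)
    ((hL.add ((tendsto_one_sub_mul_exp_neg c).inv₀ one_ne_zero)).neg.div_const (c ^ 2))
    (by
      have := hc.ne
      simp only [neg_zero, Real.exp_zero, mul_one, hlog]
      field_simp
      ring)
    (by
      have := hc.ne
      simp only [neg_zero, Real.exp_zero, mul_one, hlog]
      field_simp
      ring)
  have e : radicand 1 u = (1 - c) * ((1 / (1 - c) - u) / c) := by
    rw [hrad]
    have := hc.ne
    field_simp
    ring
  rw [e, hexp]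
  exact h

/-- At `u = 1` the two real solutions of `1 - c = exp (-u c)` coalesce at `c = 0`, where `P₁` and
`P₂` are elementary. -/
theorem qSeries_one_asymptotics_one :
    ∃ r : ℝ → ℝ, r =O[𝓝[>] 0] (fun ε : ℝ => ε) ∧ ∀ᶠ ε : ℝ in 𝓝[>] 0,
      qSeries 1 (1 / ε) (Real.exp (-ε)) =
        Real.exp (ε⁻¹ * exponent 1 1) / √(radicand 1 1) * (1 + r ε) := by
  have h := qSeries_one_asymptotics (c := 0) (κ := 1 / 2) le_rfl (by norm_num) one_pos
    (P₁ := fun v => -Real.exp (-v)) (P₂ := fun v => -Real.exp (-v) ^ 2 / 2)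
    (fun v _ => ((hasDerivAt_neg v).exp).neg.congr_deriv (by ring))
    (fun v _ => ((((hasDerivAt_neg v).exp).fun_pow 2).neg.div_const 2).congr_deriv (by
      push_cast; ring))
    Real.tendsto_exp_neg_atTop_nhds_zero.neg
    ((Real.tendsto_exp_neg_atTop_nhds_zero.pow 2).neg.div_const 2)
    (by simp) (by simp; norm_num)
  have e : radicand 1 1 = (1 - 0) * (1 / 2) := by rw [radicand, if_pos ⟨rfl, rfl⟩]; norm_num
  have hexp : exponent 1 1 = dilog 0 + 1 * (1 - 0) - Real.pi ^ 2 / 6 := by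
    rw [exponent, Real.log_one, saddle_one_one]; ring
  rw [e, hexp]
  exact h

theorem theorem4p7 (x u : ℝ) (hxu : (x, u) ∈ admissibleRegion) :
    ∃ r : ℝ → ℝ, r =O[𝓝[>] 0] (fun ε : ℝ => ε) ∧
      ∀ᶠ ε : ℝ in 𝓝[>] 0,
        qSeries x (u / ε) (Real.exp (-ε)) =
          Real.exp (ε⁻¹ * exponent x u) / Real.sqrt (radicand x u) * (1 + r ε) := by
  by_cases h1 : x = 1 ∧ u ≤ 1
  · obtain ⟨rfl, hu1⟩ := h1
    have hu0 : 0 < u := by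
      rcases hxu with h | h
      · exact h.2
      · exact absurd h.1 (lt_irrefl _)
    rcases hu1.lt_or_eq with hu | rfl
    · exact qSeries_one_asymptotics_of_lt hu0 hu
    · exact qSeries_one_asymptotics_one
  · obtain ⟨hx, hu, b, hb0, hb1, hub, hsad, hb⟩ := exists_saddle_eq_one_sub hxu h1
    have hexp : exponent x u = Real.log x * Real.log (1 - b) + dilog (1 - b) + u * b -
        Real.pi ^ 2 / 6 := by
      rw [exponent, hsad, sub_sub_cancel]
    have hrad : radicand x u = (1 - u * b) / (1 - b) := by
      rw [radicand, if_neg fun h => h1 ⟨h.1, h.2.le⟩, hsad]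
      have : 1 - b ≠ 0 := by linarith
      field_simp
      ring
    rw [hexp, hrad]
    exact qSeries_asymptotics hx hu hb0 hb1 hub hb
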